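/- Let $\mathbf{No}$ be the ordered field of surreal numbers. For $x,e\in\mathbf{No}$ let $r_e(x)\in\mathbb R$ be the coefficient of $\omega^e$ in the normal form of $x$. A countable series $\sum_{k\in I}a_k$ of surreals converges absolutely in the sense of Conway to $s$ if for each $e\in\mathbf{No}$ the coefficient of $\omega^e$ in the finite partial sums is eventually constant (that is, the same for all finite partial sums containing a suitable finite set of terms) and equal to $r_e(s)$. A function $f$ is differentiable at $a$ with derivative $d$ if for every $\varepsilon>0$ in $\mathbf{No}$ there is $\delta>0$ in $\mathbf{No}$ such that $\left|\frac{f(x)-f(a)}{x-a}-d\right|<\varepsilon$ whenever $0<|x-a|<\delta$. Let $f_1,\dots,f_m$ be twice differentiable functions from the positive infinite surreals to the infinitesimal surreals. Let $n\in\mathbb Z$, let $I=\{\mathbf k\in\mathbb Z^m: k_i\ge n \text{ for all } i\}$, and let $(c_{\mathbf k})_{\mathbf k\in I}$ be real numbers. Suppose that $f_i$ has no zeros whenever $c_{\mathbf k}\ne0$ for some $\mathbf k\in I$ with $k_i<0$ (so that all terms below are defined). Then: (1) For each positive infinite $x$ the series $$g(x)=\sum_{\mathbf k\in I}c_{\mathbf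 k}\,\mathbf f(x)^{\mathbf k},\qquad \mathbf f(x)^{\mathbf k}=f_1(x)^{k_1}\cdots f_m(x)^{k_m},$$ converges absolutely in the sense of Conway to a unique surreal number. (2) The function $g$ is differentiable at each positive infinite $x$, and its derivative is given by termwise differentiation: $$g'(x)=\sum_{\mathbf k\in I}c_{\mathbf k}\sum_{i=1}^m k_i\,f_i(x)^{k_i-1}f_i'(x)\prod_{j\ne i}f_j(x)^{k_j},$$ where summands with $k_i=0$ or $c_{\mathbf k}=0$ are read as $0$, and the series converges absolutely in the sense of Conway. (3) If moreover $f_i'(x)=0$ for each $i$ with $f_i(x)=0$ (in particular if no $f_i(x)$ is $0$), then also $$g'(x)=\sum_{\mathbf k\in I}c_{\mathbf k}\left(\sum_{i=1}^m k_i\frac{f_i'(x)}{f_i(x)}\right)\mathbf f(x)^{\mathbf k},$$ where $f_i'(x)/f_i(x)=0$ if $f_i(x)=0$, and $c_{\mathbf k}\,\mathbf f(x)^{\mathbf k}=0$ if $c_{\mathbf k}=0$. -/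

import Mathlib

universe u

/-- Surreal numbers as sign expansions: a surreal number is a function from an ordinal (its length)
to the two signs.  It is encoded as a sequence of signs indexed by all ordinals whose value is `0`
("undefined") exactly from the length on. -/
def Surreal : Type (u + 1) :=
  {s : Lex (Ordinal.{u} → SignType) // ∃ l : Ordinal.{u}, ∀ α, ofLex s α ≠ 0 ↔ α < l}

namespace Surreal

noncomputable section

/-- The lexicographic order, with `- < undefined < +` at the first place of difference. -/
instance : LinearOrder Surreal.{u} :=
  inferInstanceAs (LinearOrder
    {s : Lex (Ordinal.{u} → SignType) // ∃ l : Ordinal.{u}, ∀ α, ofLex s α ≠ 0 ↔ α < l})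

/-- The sign of `x` at place `α`, which is `0` if `α` is not below the length of `x`. -/
def sign (x : Surreal.{u}) (α : Ordinal.{u}) : SignType := ofLex x.1 α

/-- The length of a sign expansion. -/
def length (x : Surreal.{u}) : Ordinal.{u} := x.2.choose

/-- `x` is simpler than `y`: `x` is a proper initial segment of `y`. -/
def SimplerThan (x y : Surreal.{u}) : Prop :=
  x.length < y.length ∧ ∀ α < x.length, x.sign α = y.sign α

/-- The empty sign expansion. -/
instance : Zero Surreal.{u} :=
  ⟨⟨toLex fun _ => 0, 0, fun α => by simp⟩⟩

open Classical in
/-- The simplest member of a class of surreal numbers, that is, the member that is simpler than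
every other member (there is one in each nonempty convex class). -/
def simplest (P : Surreal.{u} → Prop) : Surreal.{u} :=
  if h : ∃ z, P z ∧ ∀ w, P w → w = z ∨ SimplerThan z w then h.choose else 0

/-- `{L | R}`: the simplest surreal number between `L` and `R`. -/
def cut (L R : Set Surreal.{u}) : Surreal.{u} :=
  simplest fun z => (∀ a ∈ L, a < z) ∧ ∀ b ∈ R, z < b

/-- The predecessors of `x` (in the simplicity order) on the left of `x`. -/
def left (x : Surreal.{u}) : Set Surreal.{u} := {a | SimplerThan a x ∧ a < x}

/-- The predecessors of `x` (in the simplicity order) on the right of `x`. -/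
def right (x : Surreal.{u}) : Set Surreal.{u} := {a | SimplerThan a x ∧ x < a}

theorem length_left {x : Surreal.{u}} (a : left x) : a.1.length < x.length := a.2.1.1

theorem length_right {x : Surreal.{u}} (a : right x) : a.1.length < x.length := a.2.1.1

/-- `x + y = {x^L + y, x + y^L | x^R + y, x + y^R}`. -/
def add (x y : Surreal.{u}) : Surreal.{u} :=
  cut (Set.range (fun a : left x => add a.1 y) ∪ Set.range (fun b : left y => add x b.1))
    (Set.range (fun a : right x => add a.1 y) ∪ Set.range (fun b : right y => add x b.1))
termination_by (x.length, y.length)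
decreasing_by
  · exact Prod.Lex.left _ _ (length_left a)
  · exact Prod.Lex.right _ (length_left b)
  · exact Prod.Lex.left _ _ (length_right a)
  · exact Prod.Lex.right _ (length_right b)

instance : Add Surreal.{u} := ⟨add⟩

/-- `-x = {-x^R | -x^L}`. -/
def neg (x : Surreal.{u}) : Surreal.{u} :=
  cut (Set.range fun a : right x => neg a.1) (Set.range fun a : left x => neg a.1)
termination_by x.length
decreasing_by
  · exact length_right a
  · exact length_left a

instance : Neg Surreal.{u} := ⟨neg⟩

instance : Sub Surreal.{u} := ⟨fun x y => x + -y⟩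

/-- `xy = {x^L y + x y^L - x^L y^L, x^R y + x y^R - x^R y^R |`
`x^L y + x y^R - x^L y^R, x^R y + x y^L - x^R y^L}`. -/
def mul (x y : Surreal.{u}) : Surreal.{u} :=
  cut
    (Set.range (fun p : left x × left y =>
        mul p.1.1 y + mul x p.2.1 - mul p.1.1 p.2.1) ∪
      Set.range (fun p : right x × right y =>
        mul p.1.1 y + mul x p.2.1 - mul p.1.1 p.2.1))
    (Set.range (fun p : left x × right y =>
        mul p.1.1 y + mul x p.2.1 - mul p.1.1 p.2.1) ∪
      Set.range (fun p : right x × left y =>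
        mul p.1.1 y + mul x p.2.1 - mul p.1.1 p.2.1))
termination_by (x.length, y.length)
decreasing_by
  all_goals first
    | exact Prod.Lex.left _ _ (length_left p.1)
    | exact Prod.Lex.left _ _ (length_right p.1)
    | exact Prod.Lex.right _ (length_left p.2)
    | exact Prod.Lex.right _ (length_right p.2)

instance : Mul Surreal.{u} := ⟨mul⟩

/-- `1 = {0 | }`. -/
instance : One Surreal.{u} := ⟨cut {0} ∅⟩

open Classical in
/-- The multiplicative inverse, with the value `0` where there is none (that is, at `0`). -/
instance : Inv Surreal.{u} :=
  ⟨fun x => if h : ∃ z, x * z = 1 then h.choose else 0⟩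

instance : Div Surreal.{u} := ⟨fun x y => x * y⁻¹⟩

/-- `n • x` is the `n`-fold sum of `x`. -/
instance : SMul ℕ Surreal.{u} := ⟨nsmulRec⟩

/-- `p • x` is the `p`-fold sum of `x` for `p ≥ 0`, and `-((-p) • x)` for `p < 0`. -/
instance : SMul ℤ Surreal.{u} := ⟨zsmulRec nsmulRec⟩

/-- Powers with natural exponents, by iterated multiplication. -/
instance : Pow Surreal.{u} ℕ := ⟨fun x k => npowRec k x⟩

/-- Powers with integer exponents: `x ^ (-k) = (x ^ k)⁻¹` for `k > 0`. -/
instance : Pow Surreal.{u} ℤ := ⟨fun x k => zpowRec npowRec k x⟩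

/-- The absolute value. -/
def abs (x : Surreal.{u}) : Surreal.{u} := max x (-x)

/-- `a ≪ b`: the number `a` is infinitesimal relative to `b ≠ 0`. -/
def Negligible (a b : Surreal.{u}) : Prop := ∀ n : ℕ, n • abs a < abs b

/-- `x` is infinitesimal: `n |x| < 1` for every `n`. -/
def Infinitesimal (x : Surreal.{u}) : Prop := ∀ n : ℕ, n • abs x < 1

/-- `x` is positive infinite: `x > n` for every `n`. -/
def PosInfinite (x : Surreal.{u}) : Prop := ∀ n : ℕ, n • (1 : Surreal.{u}) < x

/-- The canonical (initial) copy of the reals: `r` is the simplest surreal number that lies above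
all rationals `p / q < r` and below all rationals `p / q > r`. -/
def ofReal (r : ℝ) : Surreal.{u} :=
  simplest fun z => ∀ (p : ℤ) (q : ℕ), 0 < q →
    ((p / q : ℝ) < r → p • (1 : Surreal.{u}) < q • z) ∧
    (r < (p / q : ℝ) → q • z < p • (1 : Surreal.{u}))

/-- The `ω`-map: `ω^x` is the simplest positive number `z` with `ω^(x^L) ≪ z ≪ ω^(x^R)` for all
predecessors `x^L`, `x^R` of `x` on its left and on its right. -/
def omegaPow (x : Surreal.{u}) : Surreal.{u} :=
  simplest fun z => 0 < z ∧ (∀ a : left x, Negligible (omegaPow a.1) z) ∧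
    ∀ a : right x, Negligible z (omegaPow a.1)
termination_by x.length
decreasing_by
  · exact length_left a
  · exact length_right a

/-- The sum `∑_{α < β} ω^(y α) r α`: the simplest number `z` such that for each `α < β` the
difference of `z` and the sum of the terms up to and including the `α`-th one is
`≪ ω^(y α)`. -/
def normalSum (y : Ordinal.{u} → Surreal.{u}) (r : Ordinal.{u} → ℝ) (β : Ordinal.{u}) :
    Surreal.{u} :=
  simplest fun z => ∀ α : Set.Iio β,
    Negligible (z - (normalSum y r α.1 + ofReal (r α.1) * omegaPow (y α.1))) (omegaPow (y α.1))
termination_by β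
decreasing_by exact α.2

/-- `∑_{α < β} ω^(y α) r α` is the normal form of `x`. -/
def IsNormalForm (x : Surreal.{u}) (β : Ordinal.{u}) (y : Ordinal.{u} → Surreal.{u})
    (r : Ordinal.{u} → ℝ) : Prop :=
  StrictAntiOn y (Set.Iio β) ∧ (∀ α < β, r α ≠ 0) ∧ normalSum y r β = x

open Classical in
/-- The coefficient `r_e(x)` of `ω^e` in the normal form of `x`, which is `0` if `ω^e` does not
occur. -/
def coeff (e x : Surreal.{u}) : ℝ :=
  if h : ∃ c : ℝ, ∃ β y r, IsNormalForm x β y r ∧ ∃ α < β, y α = e ∧ r α = c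
  then h.choose else 0

/-- The series `∑ k, a k` converges absolutely in the sense of Conway to `s`: for each `e`, the
coefficient of `ω^e` in the finite partial sums is eventually constant (for every order of
summation) and equal to the coefficient of `ω^e` in `s`. -/
def HasConwaySum {ι : Type} (a : ι → Surreal.{u}) (s : Surreal.{u}) : Prop :=
  ∀ e : Surreal.{u}, ∃ F : Finset ι, ∀ l : List ι, l.Nodup → (∀ k ∈ F, k ∈ l) →
    coeff e (l.map a).sum = coeff e s

/-- `f` is differentiable at `a` with derivative `d`.  Only the values of `f` on an arbitrarily
small interval around `a` matter. -/
def HasDerivative (f : Surreal.{u} → Surreal.{u}) (d a : Surreal.{u}) : Prop :=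
  ∀ ε : Surreal.{u}, 0 < ε → ∃ δ : Surreal.{u}, 0 < δ ∧
    ∀ x : Surreal.{u}, x ≠ a → abs (x - a) < δ → abs ((f x - f a) / (x - a) - d) < ε

/-- `h^k = h_1^{k_1} ⋯ h_m^{k_m}`. -/
def monomial {m : ℕ} (h : Fin m → Surreal.{u}) (k : Fin m → ℤ) : Surreal.{u} :=
  (List.ofFn fun i => h i ^ k i).prod

/-- The derivative `∑ i, k_i h_i^{k_i - 1} h'_i ∏_{j ≠ i} h_j^{k_j}` of the monomial `h^k`. -/
def monomialDeriv {m : ℕ} (h h' : Fin m → Surreal.{u}) (k : Fin m → ℤ) : Surreal.{u} :=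
  (List.ofFn fun i =>
    ofReal (k i : ℝ) * h' i * monomial h (Function.update k i (k i - 1))).sum

/-- The logarithmic form `(∑ i, k_i h'_i / h_i) h^k` of the derivative of `h^k`, where
`h'_i / h_i = 0` if `h_i = 0`. -/
def monomialLogDeriv {m : ℕ} (h h' : Fin m → Surreal.{u}) (k : Fin m → ℤ) : Surreal.{u} :=
  (List.ofFn fun i => ofReal (k i : ℝ) * (h' i / h i)).sum * monomial h k

end

end Surreal

/-!
The surreal numbers form an ordered field that embeds, by normal forms, into the field of Hahn
series over the reals with exponents in the surreal numbers.  In a field of Hahn series the series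
in question can be summed without any estimates, and what remains is to see that differentiation
may be carried out termwise.  None of this is available for surreal numbers given as sign
expansions, so it is developed here.

*Arithmetic.*  Every recursive definition fills a cut by the simplest number in it.  A number `x` is
represented by a class of options (`IsRep`) if it is the simplest number on its own side of each of
them.  Sums, products and powers of `ω` can be computed from arbitrary representations
(`IsRep.add`, `IsRep.mul`, `IsRep.omegaPow`), and two numbers are equal as soon as each lies on the
correct side of the options of the other (`IsRep.eq`).  The axioms of an ordered ring, the
embedding of the reals and `omegaPow_add` follow by induction on simplicity.

*Normal forms.*  For each exponent `e`, let `trunc e x` be the simplest number that differs from `x`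
by less than all terms with exponents above `e`, and let `normalCoeff e x` be the leading
coefficient of `x - trunc e x` at `ω ^ e`.  The options that describe simplicity modulo negligible
terms are `x ± r ω ^ d`; with them uniformity shows that simplicity passes to sums and products
(`SimpleMod.add`, `SimpleMod.mul`).  Hence the coefficients of a product are given by convolution
(`normalCoeff_mul`), and `hahnHom` is an injective ring homomorphism.  Its image consists of the
series with small support (`exists_hahnHom_eq`), so that inverses exist (`instField`), and
`coeff_eq_normalCoeff` identifies `normalCoeff` with the coefficients of Conway normal forms.

*Conway sums.*  A summable family of Hahn series has a Conway sum (`HahnSum.hasConwaySum`), which is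
unique since a number is determined by its coefficients.  The monomials in infinitesimal numbers
form a summable family.  If `N i` is a lower bound for the exponents of `f i` that occur, the series
`g` is the product of the monomial with exponents `N` and a power series in the `f i`.

*Differentiation.*  If all terms of a sum are bounded by real multiples of `b`, then so is the sum,
even if the real factors are unbounded (`HahnSum.dominated`): all coefficients beyond the leading
exponent of `b` vanish.  Taylor expansion of each monomial to first order therefore yields the
Taylor expansion of the power series, with a remainder bounded by a real multiple of the square of
the increment (`dominated_powerSeries_sub`), hence by the fixed multiple with factor `ω`, which is
what differentiability requires (`HasDerivative.powerSeries`).  The product rule then gives the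
derivative of `g`, and the terms of its series are those of the termwise derivative.
-/

namespace Surreal

noncomputable section

/-! ### Sign expansions and simplicity -/

theorem ext_sign {x y : Surreal.{u}} (h : ∀ α, x.sign α = y.sign α) : x = y :=
  Subtype.ext (funext h)

theorem sign_ne_zero_iff (x : Surreal.{u}) (α : Ordinal.{u}) : x.sign α ≠ 0 ↔ α < x.length :=
  x.2.choose_spec α

theorem sign_eq_zero_iff (x : Surreal.{u}) (α : Ordinal.{u}) : x.sign α = 0 ↔ x.length ≤ α := by
  rw [← not_lt, ← sign_ne_zero_iff, not_not]

theorem lt_iff_sign {x y : Surreal.{u}} :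
    x < y ↔ ∃ α, (∀ β < α, x.sign β = y.sign β) ∧ x.sign α < y.sign α :=
  Iff.rfl

theorem zero_sign (α : Ordinal.{u}) : (0 : Surreal.{u}).sign α = 0 := rfl

theorem zero_length : (0 : Surreal.{u}).length = 0 := by
  have := (sign_eq_zero_iff (0 : Surreal.{u}) 0).1 rfl
  exact le_antisymm this (zero_le)

/-- The initial segment of `x` of length at most `α`. -/
def restrict (x : Surreal.{u}) (α : Ordinal.{u}) : Surreal.{u} :=
  ⟨toLex fun β => if β < α then x.sign β else 0, min α x.length, fun β => by
    by_cases h : β < α <;> simp [h, sign_ne_zero_iff]⟩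

theorem restrict_sign (x : Surreal.{u}) (α β : Ordinal.{u}) :
    (x.restrict α).sign β = if β < α then x.sign β else 0 := rfl

theorem restrict_length (x : Surreal.{u}) {α : Ordinal.{u}} (h : α ≤ x.length) :
    (x.restrict α).length = α := by
  apply le_antisymm
  · rw [← sign_eq_zero_iff, restrict_sign, if_neg (lt_irrefl _)]
  · by_contra! h'
    have h1 := (sign_eq_zero_iff _ _).2 (le_refl (x.restrict α).length)
    rw [restrict_sign, if_pos h'] at h1
    exact ((sign_ne_zero_iff _ _).2 (h'.trans_le h)) h1

theorem SimplerThan.asymm {x y : Surreal.{u}} (h : SimplerThan x y) : ¬ SimplerThan y x :=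
  fun h' => h.1.asymm h'.1

theorem SimplerThan.ne {x y : Surreal.{u}} (h : SimplerThan x y) : x ≠ y := by
  rintro rfl; exact h.1.false

theorem signType_cases {a b : SignType} (h : a < b) (ha : a ≠ 0) (hb : b ≠ 0) : a < 0 ∧ 0 < b := by
  revert a b; decide

/-- Two comparable sign expansions are either in the relation of simplicity or are separated by
their longest common initial segment. -/
theorem simplerThan_trichotomy {x y : Surreal.{u}} (h : x < y) :
    SimplerThan x y ∨ SimplerThan y x ∨
      ∃ t, SimplerThan t x ∧ SimplerThan t y ∧ x < t ∧ t < y := by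
  obtain ⟨α, hα, hlt⟩ := lt_iff_sign.1 h
  by_cases hx : x.sign α = 0
  · refine .inl ⟨((sign_eq_zero_iff _ _).1 hx).trans_lt ((sign_ne_zero_iff _ _).1 ?_),
      fun β hβ => hα β (hβ.trans_le ((sign_eq_zero_iff _ _).1 hx))⟩
    rw [hx] at hlt; exact hlt.ne'
  by_cases hy : y.sign α = 0
  · refine .inr (.inl ⟨((sign_eq_zero_iff _ _).1 hy).trans_lt ((sign_ne_zero_iff _ _).1 hx),
      fun β hβ => (hα β (hβ.trans_le ((sign_eq_zero_iff _ _).1 hy))).symm⟩)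
  have hs := signType_cases hlt hx hy
  have hx' := (sign_ne_zero_iff _ _).1 hx
  have hy' := (sign_ne_zero_iff _ _).1 hy
  have hl := restrict_length x hx'.le
  refine .inr (.inr ⟨x.restrict α, ⟨by rwa [hl], fun β hβ => ?_⟩, ⟨by rwa [hl], fun β hβ => ?_⟩,
    lt_iff_sign.2 ⟨α, fun β hβ => ?_, ?_⟩, lt_iff_sign.2 ⟨α, fun β hβ => ?_, ?_⟩⟩)
  · rw [hl] at hβ; rw [restrict_sign, if_pos hβ]
  · rw [hl] at hβ; rw [restrict_sign, if_pos hβ, hα β hβ]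
  · rw [restrict_sign, if_pos hβ]
  · rw [restrict_sign, if_neg (lt_irrefl _)]; exact hs.1
  · rw [restrict_sign, if_pos hβ, hα β hβ]
  · rw [restrict_sign, if_neg (lt_irrefl _)]; exact hs.2

/-- `z` is the simplest member of the class `P`. -/
def IsSimplest (P : Surreal.{u} → Prop) (z : Surreal.{u}) : Prop :=
  P z ∧ ∀ w, P w → w = z ∨ SimplerThan z w

theorem IsSimplest.unique {P : Surreal.{u} → Prop} {x y : Surreal.{u}} (hx : IsSimplest P x)
    (hy : IsSimplest P y) : x = y := by
  rcases hy.2 x hx.1 with h | h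
  · exact h
  rcases hx.2 y hy.1 with h' | h'
  · exact h'.symm
  · exact absurd h h'.asymm

theorem IsSimplest.simplest_eq {P : Surreal.{u} → Prop} {z : Surreal.{u}} (h : IsSimplest P z) :
    simplest P = z := by
  have h' : ∃ z, P z ∧ ∀ w, P w → w = z ∨ SimplerThan z w := ⟨z, h⟩
  rw [simplest, dif_pos h']
  exact IsSimplest.unique h'.choose_spec h

/-- A nonempty convex class has a simplest member: any member of minimal length. -/
theorem isSimplest_simplest {P : Surreal.{u} → Prop}
    (hc : ∀ a b z, P a → P b → a < z → z < b → P z) (hne : ∃ z, P z) :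
    IsSimplest P (simplest P) := by
  obtain ⟨l, ⟨z, hz, rfl⟩, hmin⟩ := WellFounded.has_min (wellFounded_lt (α := Ordinal.{u}))
    {l | ∃ z, P z ∧ z.length = l} (hne.imp' _ fun z hz => ⟨z, hz, rfl⟩)
  have hmin' : ∀ w, P w → z.length ≤ w.length := fun w hw => not_lt.1 (hmin _ ⟨w, hw, rfl⟩)
  have key : IsSimplest P z := by
    refine ⟨hz, fun w hw => ?_⟩
    rcases lt_trichotomy w z with h | h | h
    · rcases simplerThan_trichotomy h with h1 | h1 | ⟨t, h1, h2, h3, h4⟩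
      · exact absurd h1.1 (hmin' w hw).not_gt
      · exact .inr h1
      · exact absurd h2.1 (hmin' t (hc _ _ _ hw hz h3 h4)).not_gt
    · exact .inl h
    · rcases simplerThan_trichotomy h with h1 | h1 | ⟨t, h1, h2, h3, h4⟩
      · exact .inr h1
      · exact absurd h1.1 (hmin' w hw).not_gt
      · exact absurd h1.1 (hmin' t (hc _ _ _ hz hw h3 h4)).not_gt
  rwa [key.simplest_eq]

/-! ### Filling small cuts -/

/-- The initial segment of length `α` of a transfinite sequence of signs. -/
def initialSegment (s : Ordinal.{u} → SignType) (α : Ordinal.{u}) : Lex (Ordinal.{u} → SignType) :=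
  toLex fun β => if β < α then s β else 0

open Classical in
/-- The walk towards the cut between `L` and `R`: it turns right as long as some member of `L` is
not yet on the left, and otherwise turns left as long as some member of `R` is not yet on the
right. -/
def walk (L R : Set Surreal.{u}) (α : Ordinal.{u}) : SignType :=
  if ∃ a ∈ L, toLex (fun β => if _ : β < α then walk L R β else 0) ≤ a.1 then 1
  else if ∃ b ∈ R, b.1 ≤ toLex (fun β => if _ : β < α then walk L R β else 0) then -1
  else 0
termination_by α

open Classical in
theorem walk_eq (L R : Set Surreal.{u}) (α : Ordinal.{u}) :
    walk L R α = if ∃ a ∈ L, initialSegment (walk L R) α ≤ a.1 then 1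
      else if ∃ b ∈ R, b.1 ≤ initialSegment (walk L R) α then -1 else 0 := by
  rw [walk]; rfl

theorem walk_eq_one_iff {L R : Set Surreal.{u}} {α : Ordinal.{u}} :
    walk L R α = 1 ↔ ∃ a ∈ L, initialSegment (walk L R) α ≤ a.1 := by
  rw [walk_eq]; split_ifs <;> simp_all

theorem exists_of_walk_eq_neg_one {L R : Set Surreal.{u}} {α : Ordinal.{u}}
    (h : walk L R α = -1) : ∃ b ∈ R, b.1 ≤ initialSegment (walk L R) α := by
  rw [walk_eq] at h; split_ifs at h with h1 h2
  exact h2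

theorem lt_of_walk_eq_zero {L R : Set Surreal.{u}} {α : Ordinal.{u}} (h : walk L R α = 0) :
    (∀ a ∈ L, a.1 < initialSegment (walk L R) α) ∧ ∀ b ∈ R, initialSegment (walk L R) α < b.1 := by
  rw [walk_eq] at h; split_ifs at h with h1 h2
  push Not at h1 h2
  exact ⟨h1, h2⟩

theorem initialSegment_le_of_agree {s : Ordinal.{u} → SignType} {α : Ordinal.{u}} {a : Surreal.{u}}
    (h : ∀ β < α, s β = a.sign β) (h' : 0 ≤ a.sign α) : initialSegment s α ≤ a.1 := by
  rcases h'.eq_or_lt with h0 | h0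
  · refine le_of_eq (funext fun β => ?_)
    change (if β < α then s β else 0) = a.sign β
    split_ifs with hβ
    · exact h β hβ
    · exact ((sign_eq_zero_iff _ _).2 (((sign_eq_zero_iff _ _).1 h0.symm).trans (not_lt.1 hβ))).symm
  · refine le_of_lt ⟨α, fun β hβ => ?_, ?_⟩
    · change (if β < α then s β else 0) = a.sign β
      rw [if_pos hβ, h β hβ]
    · change (if α < α then s α else 0) < a.sign α
      rwa [if_neg (lt_irrefl _)]

theorem le_initialSegment_of_agree {s : Ordinal.{u} → SignType} {α : Ordinal.{u}} {a : Surreal.{u}}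
    (h : ∀ β < α, s β = a.sign β) (h' : a.sign α ≤ 0) : a.1 ≤ initialSegment s α := by
  rcases h'.eq_or_lt with h0 | h0
  · refine ge_of_eq (funext fun β => ?_)
    change (if β < α then s β else 0) = a.sign β
    split_ifs with hβ
    · exact h β hβ
    · exact ((sign_eq_zero_iff _ _).2 (((sign_eq_zero_iff _ _).1 h0).trans (not_lt.1 hβ))).symm
  · refine le_of_lt ⟨α, fun β hβ => ?_, ?_⟩
    · change a.sign β = (if β < α then s β else 0)
      rw [if_pos hβ, h β hβ]
    · change a.sign α < (if α < α then s α else 0)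
      rwa [if_neg (lt_irrefl _)]

/-- The walk stops.  Otherwise, after passing the lengths of all members of `L` and `R`, it would
turn at `l` because of a member `a` of, say, `L` to its right.  Where `a` leaves the walk, the walk
turns left although `a` is not yet on its left. -/
theorem walk_eq_zero_of_length_lt {L R : Set Surreal.{u}} (hLR : ∀ a ∈ L, ∀ b ∈ R, a < b)
    {l : Ordinal.{u}} (hL : ∀ a ∈ L, a.length < l) (hR : ∀ b ∈ R, b.length < l) :
    ∃ α, walk L R α = 0 := by
  by_contra! hne
  have hseg : ∀ α : Ordinal.{u}, ∀ a : Surreal.{u}, a.length < α →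
      a.1 ≠ initialSegment (walk L R) α := by
    intro α a ha h
    have h1 : a.sign a.length = if a.length < α then walk L R a.length else 0 :=
      congrArg (fun f : Lex (Ordinal.{u} → SignType) => ofLex f a.length) h
    rw [if_pos ha, (sign_eq_zero_iff a _).2 le_rfl] at h1
    exact hne _ h1.symm
  by_cases h1 : walk L R l = 1
  · obtain ⟨a, ha, hle⟩ := walk_eq_one_iff.1 h1
    obtain ⟨α, hα, hlt⟩ := lt_of_le_of_ne hle (hseg l a (hL a ha)).symm
    change (if α < l then walk L R α else 0) < a.sign α at hlt
    have hαl : α < l := by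
      by_contra! h
      rw [if_neg h.not_gt, (sign_eq_zero_iff a _).2 ((hL a ha).le.trans h)] at hlt
      exact hlt.false
    rw [if_pos hαl] at hlt
    have hα' : ∀ β < α, walk L R β = a.sign β := fun β hβ => by
      have := hα β hβ
      change (if β < l then walk L R β else 0) = a.sign β at this
      rwa [if_pos (hβ.trans hαl)] at this
    have h2 : 0 ≤ a.sign α ∧ walk L R α ≠ 1 := by
      have := hne α
      revert hlt this; generalize walk L R α = p; generalize a.sign α = q; revert p q; decide
    exact h2.2 (walk_eq_one_iff.2 ⟨a, ha, initialSegment_le_of_agree hα' h2.1⟩)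
  · have h1 : walk L R l = -1 := by
      have := hne l
      revert h1 this; generalize walk L R l = p; revert p; decide
    obtain ⟨b, hb, hle⟩ := exists_of_walk_eq_neg_one h1
    obtain ⟨α, hα, hlt⟩ := lt_of_le_of_ne hle (hseg l b (hR b hb))
    change b.sign α < (if α < l then walk L R α else 0) at hlt
    have hαl : α < l := by
      by_contra! h
      rw [if_neg h.not_gt, (sign_eq_zero_iff b _).2 ((hR b hb).le.trans h)] at hlt
      exact hlt.false
    rw [if_pos hαl] at hlt
    have hα' : ∀ β < α, walk L R β = b.sign β := fun β hβ => by
      have := hα β hβ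
      change b.sign β = (if β < l then walk L R β else 0) at this
      rw [if_pos (hβ.trans hαl)] at this
      exact this.symm
    have h2 : b.sign α ≤ 0 ∧ walk L R α = 1 := by
      have := hne α
      revert hlt this; generalize walk L R α = p; generalize b.sign α = q; revert p q; decide
    obtain ⟨a, ha, hle'⟩ := walk_eq_one_iff.1 h2.2
    exact absurd (hLR a ha b hb)
      (not_lt.2 ((le_initialSegment_of_agree hα' h2.1).trans hle' : b.1 ≤ a.1))

theorem exists_length_bound (L : Set Surreal.{u}) [Small.{u} L] :
    ∃ l : Ordinal.{u}, ∀ a ∈ L, a.length < l := by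
  obtain ⟨l, hl⟩ := Ordinal.bddAbove_of_small (s := Set.range fun a : L => a.1.length)
  exact ⟨Order.succ l, fun a ha => Order.lt_succ_of_le (hl ⟨⟨a, ha⟩, rfl⟩)⟩

/-- Small classes `L < R` of surreal numbers have a surreal number between them. -/
theorem exists_between (L R : Set Surreal.{u}) [Small.{u} L] [Small.{u} R]
    (hLR : ∀ a ∈ L, ∀ b ∈ R, a < b) : ∃ z, (∀ a ∈ L, a < z) ∧ ∀ b ∈ R, z < b := by
  obtain ⟨l, hl⟩ := exists_length_bound L
  obtain ⟨l', hl'⟩ := exists_length_bound R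
  have hex := walk_eq_zero_of_length_lt hLR (l := max l l')
    (fun a ha => (hl a ha).trans_le (le_max_left _ _))
    (fun b hb => (hl' b hb).trans_le (le_max_right _ _))
  obtain ⟨α, hα, hmin⟩ := WellFounded.has_min (wellFounded_lt (α := Ordinal.{u}))
    {α | walk L R α = 0} hex
  refine ⟨⟨initialSegment (walk L R) α, α, fun β => ?_⟩, lt_of_walk_eq_zero hα⟩
  change (if β < α then walk L R β else 0) ≠ 0 ↔ β < α
  split_ifs with h
  · exact iff_of_true (fun h0 => hmin β h0 h) h
  · simp [h]

/-- The class of numbers between `L` and `R`. -/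
def Between (L R : Set Surreal.{u}) (z : Surreal.{u}) : Prop :=
  (∀ a ∈ L, a < z) ∧ ∀ b ∈ R, z < b

theorem isSimplest_cut_of_exists {L R : Set Surreal.{u}} (h : ∃ z, Between L R z) :
    IsSimplest (Between L R) (cut L R) :=
  isSimplest_simplest (fun _ _ _ ha hb hz hz' =>
    ⟨fun c hc => (ha.1 c hc).trans hz, fun c hc => hz'.trans (hb.2 c hc)⟩) h

theorem isSimplest_cut {L R : Set Surreal.{u}} [Small.{u} L] [Small.{u} R]
    (hLR : ∀ a ∈ L, ∀ b ∈ R, a < b) : IsSimplest (Between L R) (cut L R) :=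
  isSimplest_cut_of_exists (exists_between L R hLR)

/-- A predecessor of `x` is determined by its length. -/
instance small_predecessors (x : Surreal.{u}) : Small.{u} {a : Surreal.{u} // SimplerThan a x} := by
  refine small_of_injective (β := Set.Iio x.length) (f := fun a => ⟨a.1.length, a.2.1⟩) ?_
  intro a b h
  have hl : a.1.length = b.1.length := congrArg Subtype.val h
  refine Subtype.ext (ext_sign fun α => ?_)
  by_cases hα : α < a.1.length
  · rw [a.2.2 α hα, b.2.2 α (hl ▸ hα)]
  · rw [(sign_eq_zero_iff _ _).2 (not_lt.1 hα), (sign_eq_zero_iff _ _).2 (hl ▸ not_lt.1 hα)]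

instance small_left (x : Surreal.{u}) : Small.{u} (left x) :=
  small_of_injective (β := {a : Surreal.{u} // SimplerThan a x}) (f := fun a => ⟨a.1, a.2.1⟩)
    fun a b h => Subtype.ext (by simpa using h)

instance small_right (x : Surreal.{u}) : Small.{u} (right x) :=
  small_of_injective (β := {a : Surreal.{u} // SimplerThan a x}) (f := fun a => ⟨a.1, a.2.1⟩)
    fun a b h => Subtype.ext (by simpa using h)

/-- Every surreal number is the simplest one between its left and its right predecessors. -/
theorem isSimplest_canonical (x : Surreal.{u}) : IsSimplest (Between (left x) (right x)) x := by
  have hx : Between (left x) (right x) x := ⟨fun a ha => ha.2, fun b hb => hb.2⟩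
  have h := isSimplest_cut_of_exists ⟨x, hx⟩
  rcases h.2 x hx with h1 | h1
  · rwa [← h1] at h
  · rcases lt_trichotomy (cut (left x) (right x)) x with h2 | h2 | h2
    · exact absurd (h.1.1 _ ⟨h1, h2⟩) (lt_irrefl _)
    · exact absurd h2 h1.ne
    · exact absurd (h.1.2 _ ⟨h1, h2⟩) (lt_irrefl _)

/-! ### Addition -/

/-- `x` is represented by the class of options `O`: it is the simplest number among those that lie
on the same side of every member of `O` as `x`.  The side of each option is read off from `x`. -/
def IsRep (x : Surreal.{u}) (O : Set Surreal.{u}) : Prop :=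
  x ∉ O ∧ ∀ w, (∀ o ∈ O, (o < x → o < w) ∧ (x < o → w < o)) → w = x ∨ SimplerThan x w

theorem isRep_predecessors (x : Surreal.{u}) : IsRep x {a | SimplerThan a x} :=
  ⟨fun h => h.ne rfl, fun w hw => (isSimplest_canonical x).2 w
    ⟨fun a ha => (hw a ha.1).1 ha.2, fun a ha => (hw a ha.1).2 ha.2⟩⟩

theorem IsRep.eq {x y : Surreal.{u}} {O Q : Set Surreal.{u}} (hx : IsRep x O) (hy : IsRep y Q)
    (hxy : ∀ o ∈ O, (o < x → o < y) ∧ (x < o → y < o))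
    (hyx : ∀ o ∈ Q, (o < y → o < x) ∧ (y < o → x < o)) : x = y := by
  rcases hx.2 y hxy with h | h
  · exact h.symm
  rcases hy.2 x hyx with h' | h'
  · exact h'
  · exact absurd h h'.asymm

/-- Options of any representation of `x` are cofinal in the predecessors of `x`. -/
theorem IsRep.exists_le {x a : Surreal.{u}} {O : Set Surreal.{u}} (hx : IsRep x O)
    (ha : SimplerThan a x) : (a < x → ∃ o ∈ O, a ≤ o ∧ o < x) ∧ (x < a → ∃ o ∈ O, o ≤ a ∧ x < o) := by
  constructor
  · intro hax
    by_contra! h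
    have hs : ∀ o ∈ O, (o < x → o < a) ∧ (x < o → a < o) := fun o ho =>
      ⟨fun hox => not_le.1 fun h' => (h o ho h').not_gt hox, fun hxo => hax.trans hxo⟩
    exact (hx.2 a hs).elim ha.ne ha.asymm
  · intro hax
    by_contra! h
    have hs : ∀ o ∈ O, (o < x → o < a) ∧ (x < o → a < o) := fun o ho =>
      ⟨fun hox => hox.trans hax, fun hxo => not_le.1 fun h' => (h o ho h').not_gt hxo⟩
    exact (hx.2 a hs).elim ha.ne ha.asymm

theorem isRep_cut {L R : Set Surreal.{u}} [Small.{u} L] [Small.{u} R]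
    (hLR : ∀ a ∈ L, ∀ b ∈ R, a < b) : IsRep (cut L R) (L ∪ R) := by
  have h := isSimplest_cut hLR
  refine ⟨?_, fun w hw => h.2 w ⟨fun a ha => (hw a (.inl ha)).1 (h.1.1 a ha),
    fun a ha => (hw a (.inr ha)).2 (h.1.2 a ha)⟩⟩
  rintro (h1 | h1)
  · exact (h.1.1 _ h1).false
  · exact (h.1.2 _ h1).false

theorem add_eq_cut (x y : Surreal.{u}) : x + y =
    cut (Set.range (fun a : left x => a.1 + y) ∪ Set.range (fun b : left y => x + b.1))
      (Set.range (fun a : right x => a.1 + y) ∪ Set.range (fun b : right y => x + b.1)) := by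
  change add x y = _
  rw [add]; rfl

/-- `x + y` lies on the correct side of its options. -/
def AddBetween (x y : Surreal.{u}) : Prop :=
  (∀ a, SimplerThan a x → (a < x → a + y < x + y) ∧ (x < a → x + y < a + y)) ∧
    ∀ b, SimplerThan b y → (b < y → x + b < x + y) ∧ (y < b → x + y < x + b)

theorem AddBetween.add_lt_add_right {x x' y : Surreal.{u}} (h : AddBetween x y)
    (h' : AddBetween x' y) (hlt : x < x') : x + y < x' + y := by
  rcases simplerThan_trichotomy hlt with h1 | h1 | ⟨t, h1, h2, h3, h4⟩
  · exact (h'.1 x h1).1 hlt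
  · exact (h.1 x' h1).2 hlt
  · exact ((h.1 t h1).2 h3).trans ((h'.1 t h2).1 h4)

theorem AddBetween.add_lt_add_left {x y y' : Surreal.{u}} (h : AddBetween x y)
    (h' : AddBetween x y') (hlt : y < y') : x + y < x + y' := by
  rcases simplerThan_trichotomy hlt with h1 | h1 | ⟨t, h1, h2, h3, h4⟩
  · exact (h'.2 y h1).1 hlt
  · exact (h.2 y' h1).2 hlt
  · exact ((h.2 t h1).2 h3).trans ((h'.2 t h2).1 h4)

/-- The cut that defines `x + y` is filled; monotonicity and the representation of the sum by the
options that stem from predecessors are proved in one induction. -/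
theorem addBetween_and_isRep (x y : Surreal.{u}) : AddBetween x y ∧
    IsRep (x + y) ((fun a => a + y) '' {a | SimplerThan a x} ∪
      (fun b => x + b) '' {b | SimplerThan b y}) := by
  have h1 : ∀ a, SimplerThan a x → AddBetween a y := fun a _ => (addBetween_and_isRep a y).1
  have h2 : ∀ b, SimplerThan b y → AddBetween x b := fun b _ => (addBetween_and_isRep x b).1
  have hLR : ∀ p ∈ Set.range (fun a : left x => a.1 + y) ∪ Set.range (fun b : left y => x + b.1),
      ∀ q ∈ Set.range (fun a : right x => a.1 + y) ∪ Set.range (fun b : right y => x + b.1),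
      p < q := by
    rintro _ (⟨⟨a, ha⟩, rfl⟩ | ⟨⟨b, hb⟩, rfl⟩) _ (⟨⟨c, hc⟩, rfl⟩ | ⟨⟨d, hd⟩, rfl⟩)
    · exact (h1 a ha.1).add_lt_add_right (h1 c hc.1) (ha.2.trans hc.2)
    · exact (((h1 a ha.1).2 d hd.1).2 hd.2).trans (((h2 d hd.1).1 a ha.1).1 ha.2)
    · exact (((h2 b hb.1).1 c hc.1).2 hc.2).trans (((h1 c hc.1).2 b hb.1).1 hb.2)
    · exact (h2 b hb.1).add_lt_add_left (h2 d hd.1) (hb.2.trans hd.2)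
  have hc := (isSimplest_cut hLR).1
  have hr := isRep_cut hLR
  rw [← add_eq_cut] at hc hr
  refine ⟨⟨fun a ha => ⟨fun h => hc.1 _ (.inl ⟨⟨a, ha, h⟩, rfl⟩), fun h =>
      hc.2 _ (.inl ⟨⟨a, ha, h⟩, rfl⟩)⟩, fun a ha => ⟨fun h => hc.1 _ (.inr ⟨⟨a, ha, h⟩, rfl⟩),
      fun h => hc.2 _ (.inr ⟨⟨a, ha, h⟩, rfl⟩)⟩⟩, ?_⟩
  have hs : ∀ z : Surreal.{u}, {a | SimplerThan a z} = left z ∪ right z := fun z => by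
    ext a
    constructor
    · intro h
      rcases lt_or_gt_of_ne h.ne with h' | h'
      · exact .inl ⟨h, h'⟩
      · exact .inr ⟨h, h'⟩
    · rintro (h | h)
      exacts [h.1, h.1]
  convert hr using 1
  rw [hs, hs, Set.image_union, Set.image_union]
  simp only [Set.image_eq_range]
  ac_rfl
termination_by (x.length, y.length)
decreasing_by
  · rename_i h; exact Prod.Lex.left _ _ h.1
  · rename_i h; exact Prod.Lex.right _ h.1

theorem addBetween (x y : Surreal.{u}) : AddBetween x y := (addBetween_and_isRep x y).1

protected theorem add_lt_add_right' {x x' : Surreal.{u}} (h : x < x') (y : Surreal.{u}) :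
    x + y < x' + y := (addBetween x y).add_lt_add_right (addBetween x' y) h

protected theorem add_lt_add_left' {y y' : Surreal.{u}} (h : y < y') (x : Surreal.{u}) :
    x + y < x + y' := (addBetween x y).add_lt_add_left (addBetween x y') h

protected theorem add_le_add_right' {x x' : Surreal.{u}} (h : x ≤ x') (y : Surreal.{u}) :
    x + y ≤ x' + y := by
  rcases h.eq_or_lt with rfl | h
  exacts [le_rfl, (Surreal.add_lt_add_right' h y).le]

protected theorem add_le_add_left' {y y' : Surreal.{u}} (h : y ≤ y') (x : Surreal.{u}) :
    x + y ≤ x + y' := by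
  rcases h.eq_or_lt with rfl | h
  exacts [le_rfl, (Surreal.add_lt_add_left' h x).le]

protected theorem lt_of_add_lt_add_right' {x x' y : Surreal.{u}} (h : x + y < x' + y) : x < x' := by
  by_contra! h'
  exact (Surreal.add_le_add_right' h' y).not_gt h

protected theorem lt_of_add_lt_add_left' {x y y' : Surreal.{u}} (h : x + y < x + y') : y < y' := by
  by_contra! h'
  exact (Surreal.add_le_add_left' h' x).not_gt h

/-- Uniformity of addition: the sum can be computed from arbitrary representations. -/
theorem IsRep.add {x y : Surreal.{u}} {O Q : Set Surreal.{u}} (hx : IsRep x O) (hy : IsRep y Q) :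
    IsRep (x + y) ((fun a => a + y) '' O ∪ (fun b => x + b) '' Q) := by
  constructor
  · rintro (⟨a, ha, h⟩ | ⟨b, hb, h⟩)
    · have hne : a ≠ x := by rintro rfl; exact hx.1 ha
      rcases lt_or_gt_of_ne hne with h' | h'
      · exact (Surreal.add_lt_add_right' h' y).ne h
      · exact (Surreal.add_lt_add_right' h' y).ne' h
    · have hne : b ≠ y := by rintro rfl; exact hy.1 hb
      rcases lt_or_gt_of_ne hne with h' | h'
      · exact (Surreal.add_lt_add_left' h' x).ne h
      · exact (Surreal.add_lt_add_left' h' x).ne' h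
  intro w hw
  have hw1 : ∀ o ∈ O, (o < x → o + y < w) ∧ (x < o → w < o + y) := fun o ho =>
    ⟨fun h => (hw _ (.inl ⟨o, ho, rfl⟩)).1 (Surreal.add_lt_add_right' h y),
      fun h => (hw _ (.inl ⟨o, ho, rfl⟩)).2 (Surreal.add_lt_add_right' h y)⟩
  have hw2 : ∀ o ∈ Q, (o < y → x + o < w) ∧ (y < o → w < x + o) := fun o ho =>
    ⟨fun h => (hw _ (.inr ⟨o, ho, rfl⟩)).1 (Surreal.add_lt_add_left' h x),
      fun h => (hw _ (.inr ⟨o, ho, rfl⟩)).2 (Surreal.add_lt_add_left' h x)⟩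
  refine (addBetween_and_isRep x y).2.2 w ?_
  rintro _ (⟨a, ha, rfl⟩ | ⟨b, hb, rfl⟩)
  · constructor
    · intro h
      obtain ⟨o, ho, h1, h2⟩ := (hx.exists_le ha).1 (Surreal.lt_of_add_lt_add_right' h)
      exact (Surreal.add_le_add_right' h1 y).trans_lt ((hw1 o ho).1 h2)
    · intro h
      obtain ⟨o, ho, h1, h2⟩ := (hx.exists_le ha).2 (Surreal.lt_of_add_lt_add_right' h)
      exact ((hw1 o ho).2 h2).trans_le (Surreal.add_le_add_right' h1 y)
  · constructor
    · intro h
      obtain ⟨o, ho, h1, h2⟩ := (hy.exists_le hb).1 (Surreal.lt_of_add_lt_add_left' h)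
      exact (Surreal.add_le_add_left' h1 x).trans_lt ((hw2 o ho).1 h2)
    · intro h
      obtain ⟨o, ho, h1, h2⟩ := (hy.exists_le hb).2 (Surreal.lt_of_add_lt_add_left' h)
      exact ((hw2 o ho).2 h2).trans_le (Surreal.add_le_add_left' h1 x)

protected theorem add_comm' (x y : Surreal.{u}) : x + y = y + x := by
  have h1 : ∀ a, SimplerThan a x → a + y = y + a := fun a _ => Surreal.add_comm' a y
  have h2 : ∀ b, SimplerThan b y → x + b = b + x := fun b _ => Surreal.add_comm' x b
  refine (addBetween_and_isRep x y).2.eq (addBetween_and_isRep y x).2 ?_ ?_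
  · rintro _ (⟨a, ha, rfl⟩ | ⟨b, hb, rfl⟩) <;> beta_reduce
    · rw [h1 a ha, ← h1 a ha]
      refine ⟨fun h => ?_, fun h => ?_⟩ <;> rw [h1 a ha] <;>
        exact Surreal.add_lt_add_left' (Surreal.lt_of_add_lt_add_right' h) y
    · refine ⟨fun h => ?_, fun h => ?_⟩ <;> rw [h2 b hb] <;>
        exact Surreal.add_lt_add_right' (Surreal.lt_of_add_lt_add_left' h) x
  · rintro _ (⟨b, hb, rfl⟩ | ⟨a, ha, rfl⟩) <;> beta_reduce
    · refine ⟨fun h => ?_, fun h => ?_⟩ <;> rw [← h2 b hb] <;>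
        exact Surreal.add_lt_add_left' (Surreal.lt_of_add_lt_add_right' h) x
    · refine ⟨fun h => ?_, fun h => ?_⟩ <;> rw [← h1 a ha] <;>
        exact Surreal.add_lt_add_right' (Surreal.lt_of_add_lt_add_left' h) y
termination_by (x.length, y.length)
decreasing_by
  · rename_i h; exact Prod.Lex.left _ _ h.1
  · rename_i h; exact Prod.Lex.right _ h.1

theorem not_simplerThan_zero {a : Surreal.{u}} : ¬ SimplerThan a 0 := fun h => by
  have := h.1; rw [zero_length] at this; exact not_lt_zero this

theorem zero_simplerThan {x : Surreal.{u}} (h : x ≠ 0) : SimplerThan 0 x := by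
  refine ⟨?_, fun α hα => ?_⟩
  · rw [zero_length, pos_iff_ne_zero]
    intro h'
    refine h (ext_sign fun α => ?_)
    rw [zero_sign, sign_eq_zero_iff, h']; exact zero_le
  · rw [zero_length] at hα; exact absurd hα not_lt_zero

theorem isRep_zero_empty : IsRep (0 : Surreal.{u}) ∅ :=
  ⟨fun h => h, fun _ _ => or_iff_not_imp_left.2 fun h => zero_simplerThan h⟩

protected theorem add_zero' (x : Surreal.{u}) : x + 0 = x := by
  have h1 : ∀ a, SimplerThan a x → a + 0 = a := fun a _ => Surreal.add_zero' a
  refine (addBetween_and_isRep x 0).2.eq (isRep_predecessors x) ?_ ?_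
  · rintro _ (⟨a, ha, rfl⟩ | ⟨b, hb, rfl⟩) <;> beta_reduce
    · refine ⟨fun h => ?_, fun h => ?_⟩ <;> rw [h1 a ha] <;>
        exact Surreal.lt_of_add_lt_add_right' h
    · exact absurd hb not_simplerThan_zero
  · intro a ha
    refine ⟨fun h => ?_, fun h => ?_⟩
    · exact (h1 a ha).symm.trans_lt (Surreal.add_lt_add_right' h 0)
    · exact (Surreal.add_lt_add_right' h 0).trans_eq (h1 a ha)
termination_by x.length
decreasing_by
  rename_i h; exact h.1

protected theorem add_assoc' (x y z : Surreal.{u}) : x + y + z = x + (y + z) := by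
  have h1 : ∀ a, SimplerThan a x → a + y + z = a + (y + z) := fun a _ => Surreal.add_assoc' a y z
  have h2 : ∀ b, SimplerThan b y → x + b + z = x + (b + z) := fun b _ => Surreal.add_assoc' x b z
  have h3 : ∀ c, SimplerThan c z → x + y + c = x + (y + c) := fun c _ => Surreal.add_assoc' x y c
  refine ((addBetween_and_isRep x y).2.add (isRep_predecessors z)).eq
    ((isRep_predecessors x).add (addBetween_and_isRep y z).2) ?_ ?_
  · rintro _ (⟨_, (⟨a, ha, rfl⟩ | ⟨b, hb, rfl⟩), rfl⟩ | ⟨c, hc, rfl⟩) <;> beta_reduce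
    · refine ⟨fun h => ?_, fun h => ?_⟩ <;> rw [h1 a ha] <;>
        exact Surreal.add_lt_add_right' (Surreal.lt_of_add_lt_add_right'
          (Surreal.lt_of_add_lt_add_right' h)) _
    · refine ⟨fun h => ?_, fun h => ?_⟩ <;> rw [h2 b hb] <;>
        exact Surreal.add_lt_add_left' (Surreal.add_lt_add_right' (Surreal.lt_of_add_lt_add_left'
          (Surreal.lt_of_add_lt_add_right' h)) _) _
    · refine ⟨fun h => ?_, fun h => ?_⟩ <;> rw [h3 c hc] <;>
        exact Surreal.add_lt_add_left' (Surreal.add_lt_add_left'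
          (Surreal.lt_of_add_lt_add_left' h) _) _
  · rintro _ (⟨a, ha, rfl⟩ | ⟨_, (⟨b, hb, rfl⟩ | ⟨c, hc, rfl⟩), rfl⟩) <;> beta_reduce
    · refine ⟨fun h => ?_, fun h => ?_⟩ <;> rw [← h1 a ha] <;>
        exact Surreal.add_lt_add_right' (Surreal.add_lt_add_right'
          (Surreal.lt_of_add_lt_add_right' h) _) _
    · refine ⟨fun h => ?_, fun h => ?_⟩ <;> rw [← h2 b hb] <;>
        exact Surreal.add_lt_add_right' (Surreal.add_lt_add_left' (Surreal.lt_of_add_lt_add_right'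
          (Surreal.lt_of_add_lt_add_left' h)) _) _
    · refine ⟨fun h => ?_, fun h => ?_⟩ <;> rw [← h3 c hc] <;>
        exact Surreal.add_lt_add_left' (Surreal.lt_of_add_lt_add_left'
          (Surreal.lt_of_add_lt_add_left' h)) _
termination_by (x.length, y.length, z.length)
decreasing_by
  · rename_i h; exact Prod.Lex.left _ _ h.1
  · rename_i h; exact Prod.Lex.right _ (Prod.Lex.left _ _ h.1)
  · rename_i h; exact Prod.Lex.right _ (Prod.Lex.right _ h.1)

theorem neg_eq_cut (x : Surreal.{u}) : -x =
    cut (Set.range fun a : right x => -a.1) (Set.range fun a : left x => -a.1) := by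
  change neg x = _
  rw [neg]; rfl

/-- `-x` lies on the correct side of its options and is an additive inverse of `x`. -/
theorem neg_spec (x : Surreal.{u}) :
    (∀ a, SimplerThan a x → (a < x → -x < -a) ∧ (x < a → -a < -x)) ∧ x + -x = 0 := by
  have h1 : ∀ a, SimplerThan a x →
      (∀ b, SimplerThan b a → (b < a → -a < -b) ∧ (a < b → -b < -a)) ∧ a + -a = 0 :=
    fun a _ => neg_spec a
  have hLR : ∀ p ∈ Set.range fun a : right x => -a.1, ∀ q ∈ Set.range fun a : left x => -a.1,
      p < q := by
    rintro _ ⟨⟨a, ha⟩, rfl⟩ _ ⟨⟨b, hb⟩, rfl⟩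
    rcases simplerThan_trichotomy (hb.2.trans ha.2) with h | h | ⟨t, h2, h3, h4, h5⟩
    · exact ((h1 a ha.1).1 b h).1 (hb.2.trans ha.2)
    · exact ((h1 b hb.1).1 a h).2 (hb.2.trans ha.2)
    · exact (((h1 a ha.1).1 t h3).1 h5).trans (((h1 b hb.1).1 t h2).2 h4)
  have hc := (isSimplest_cut hLR).1
  have hr := isRep_cut hLR
  rw [← neg_eq_cut] at hc hr
  have hside : ∀ a, SimplerThan a x → (a < x → -x < -a) ∧ (x < a → -a < -x) := fun a ha =>
    ⟨fun h => hc.2 _ ⟨⟨a, ha, h⟩, rfl⟩, fun h => hc.1 _ ⟨⟨a, ha, h⟩, rfl⟩⟩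
  refine ⟨hside, ?_⟩
  refine ((isRep_predecessors x).add hr).eq isRep_zero_empty ?_ fun o ho => absurd ho id
  have hneg : ∀ a, SimplerThan a x → (x + -a < x + -x → x + -a < 0) ∧
      (x + -x < x + -a → 0 < x + -a) := fun a ha => by
    rcases lt_or_gt_of_ne ha.ne with h | h
    · exact ⟨fun h' => absurd (Surreal.lt_of_add_lt_add_left' h') ((hside a ha).1 h).asymm,
        fun _ => (h1 a ha).2.symm.trans_lt (Surreal.add_lt_add_right' h _)⟩
    · exact ⟨fun _ => (Surreal.add_lt_add_right' h _).trans_eq (h1 a ha).2,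
        fun h' => absurd (Surreal.lt_of_add_lt_add_left' h') ((hside a ha).2 h).asymm⟩
  rintro _ (⟨a, ha, rfl⟩ | ⟨_, (⟨⟨a, ha⟩, rfl⟩ | ⟨⟨a, ha⟩, rfl⟩), rfl⟩) <;> beta_reduce
  · refine ⟨fun h => ?_, fun h => ?_⟩ <;> rw [← (h1 a ha).2] <;>
      apply Surreal.add_lt_add_left'
    · exact (hside a ha).1 (Surreal.lt_of_add_lt_add_right' h)
    · exact (hside a ha).2 (Surreal.lt_of_add_lt_add_right' h)
  · exact hneg a ha.1
  · exact hneg a ha.1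
termination_by x.length
decreasing_by
  rename_i h; exact h.1

instance instAddCommGroup : AddCommGroup Surreal.{u} where
  add_assoc := Surreal.add_assoc'
  zero_add x := by rw [Surreal.add_comm', Surreal.add_zero']
  add_zero := Surreal.add_zero'
  nsmul n x := n • x
  nsmul_zero _ := rfl
  nsmul_succ _ _ := rfl
  sub_eq_add_neg _ _ := rfl
  zsmul n x := n • x
  zsmul_zero' _ := rfl
  zsmul_succ' _ _ := rfl
  zsmul_neg' _ _ := rfl
  neg_add_cancel x := by rw [Surreal.add_comm', (neg_spec x).2]
  add_comm := Surreal.add_comm'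

instance instIsOrderedAddMonoid : IsOrderedAddMonoid Surreal.{u} where
  add_le_add_left _ _ h z := Surreal.add_le_add_right' h z
  add_le_add_right _ _ h z := Surreal.add_le_add_left' h z

/-! ### Multiplication -/

/-- The option of `x * y` that belongs to the options `a` of `x` and `b` of `y`. -/
def mulOption (x y a b : Surreal.{u}) : Surreal.{u} := a * y + x * b - a * b

/-- The inequality `0 < (x' - x) * (y' - y)` in expanded form, which does not presuppose the
distributive law. -/
def MulLT (x x' y y' : Surreal.{u}) : Prop := x * y' + x' * y < x * y + x' * y'

theorem mul_eq_cut (x y : Surreal.{u}) : x * y =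
    cut (Set.range (fun p : left x × left y => mulOption x y p.1 p.2) ∪
        Set.range (fun p : right x × right y => mulOption x y p.1 p.2))
      (Set.range (fun p : left x × right y => mulOption x y p.1 p.2) ∪
        Set.range (fun p : right x × left y => mulOption x y p.1 p.2)) := by
  change mul x y = _
  rw [mul]; rfl

/-- `x * y` lies on the correct side of its options. -/
def MulBetween (x y : Surreal.{u}) : Prop :=
  ∀ a b, SimplerThan a x → SimplerThan b y →
    (a < x → b < y → mulOption x y a b < x * y) ∧ (x < a → y < b → mulOption x y a b < x * y) ∧
    (a < x → y < b → x * y < mulOption x y a b) ∧ (x < a → b < y → x * y < mulOption x y a b)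

theorem MulLT.trans_left {x t x' y y' : Surreal.{u}} (h : MulLT x t y y') (h' : MulLT t x' y y') :
    MulLT x x' y y' := by
  unfold MulLT at *; grind

/-- The intervals are subdivided until their end points are comparable with respect to simplicity,
where the inequality says that a product lies on the correct side of one of its options. -/
theorem MulBetween.mulLT {x x' y y' : Surreal.{u}} (h₁ : MulBetween x y) (h₂ : MulBetween x y')
    (h₃ : MulBetween x' y) (h₄ : MulBetween x' y') (hx : x < x') (hy : y < y') :
    MulLT x x' y y' := by
  have key : ∀ s s' : Surreal.{u}, s < s' → SimplerThan s s' ∨ SimplerThan s' s →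
      (SimplerThan s s' → MulBetween s' y ∧ MulBetween s' y') →
      (SimplerThan s' s → MulBetween s y ∧ MulBetween s y') → MulLT s s' y y' := by
    intro s s' hs hss h5 h6
    rcases hss with hss | hss
    · obtain ⟨h7, h8⟩ := h5 hss
      rcases simplerThan_trichotomy hy with h | h | ⟨t, h1, h2, h3, h4⟩
      · have := (h8 s y hss h).1 hs hy
        unfold mulOption at this; unfold MulLT; grind
      · have := (h7 s y' hss h).2.2.1 hs hy
        unfold mulOption at this; unfold MulLT; grind
      · have h9 := (h7 s t hss h1).2.2.1 hs h3
        have h10 := (h8 s t hss h2).1 hs h4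
        unfold mulOption at h9 h10; unfold MulLT; grind
    · obtain ⟨h7, h8⟩ := h6 hss
      rcases simplerThan_trichotomy hy with h | h | ⟨t, h1, h2, h3, h4⟩
      · have := (h8 s' y hss h).2.2.2 hs hy
        unfold mulOption at this; unfold MulLT; grind
      · have := (h7 s' y' hss h).2.1 hs hy
        unfold mulOption at this; unfold MulLT; grind
      · have h9 := (h7 s' t hss h1).2.1 hs h3
        have h10 := (h8 s' t hss h2).2.2.2 hs h4
        unfold mulOption at h9 h10; unfold MulLT; grind
  rcases simplerThan_trichotomy hx with h | h | ⟨t, h1, h2, h3, h4⟩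
  · exact key x x' hx (.inl h) (fun _ => ⟨h₃, h₄⟩) (fun _ => ⟨h₁, h₂⟩)
  · exact key x x' hx (.inr h) (fun _ => ⟨h₃, h₄⟩) (fun _ => ⟨h₁, h₂⟩)
  · exact (key x t h3 (.inr h1) (fun h => absurd h1 h.asymm) (fun _ => ⟨h₁, h₂⟩)).trans_left
      (key t x' h4 (.inl h2) (fun _ => ⟨h₃, h₄⟩) (fun h => absurd h2 h.asymm))

theorem MulLT.mulOption_lt₁ {x y s s' t : Surreal.{u}} (h : MulLT s s' t y) :
    mulOption x y s t < mulOption x y s' t := by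
  unfold MulLT at h; unfold mulOption; grind

theorem MulLT.mulOption_lt₂ {x y s s' t : Surreal.{u}} (h : MulLT s s' y t) :
    mulOption x y s' t < mulOption x y s t := by
  unfold MulLT at h; unfold mulOption; grind

theorem MulLT.mulOption_lt₃ {x y s t t' : Surreal.{u}} (h : MulLT s x t t') :
    mulOption x y s t < mulOption x y s t' := by
  unfold MulLT at h; unfold mulOption; grind

theorem MulLT.mulOption_lt₄ {x y s t t' : Surreal.{u}} (h : MulLT x s t t') :
    mulOption x y s t' < mulOption x y s t := by
  unfold MulLT at h; unfold mulOption; grind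

/-- The cut that defines `x * y` is filled, and the product is represented by the options that stem
from predecessors. -/
theorem mulBetween_and_isRep (x y : Surreal.{u}) : MulBetween x y ∧
    IsRep (x * y) (Set.image2 (mulOption x y) {a | SimplerThan a x} {b | SimplerThan b y}) := by
  have h1 : ∀ a, SimplerThan a x → MulBetween a y := fun a _ => (mulBetween_and_isRep a y).1
  have h2 : ∀ b, SimplerThan b y → MulBetween x b := fun b _ => (mulBetween_and_isRep x b).1
  have h3 : ∀ a, SimplerThan a x → ∀ b, MulBetween a b := fun a _ b => (mulBetween_and_isRep a b).1
  -- The monotonicity properties of the options in each of their two arguments.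
  have m1 : ∀ s s' t, SimplerThan s x → SimplerThan s' x → SimplerThan t y → s < s' → t < y →
      mulOption x y s t < mulOption x y s' t := fun s s' t hs hs' ht hlt h =>
    (MulBetween.mulLT (h3 s hs t) (h1 s hs) (h3 s' hs' t) (h1 s' hs') hlt h).mulOption_lt₁
  have m2 : ∀ s s' t, SimplerThan s x → SimplerThan s' x → SimplerThan t y → s < s' → y < t →
      mulOption x y s' t < mulOption x y s t := fun s s' t hs hs' ht hlt h =>
    (MulBetween.mulLT (h1 s hs) (h3 s hs t) (h1 s' hs') (h3 s' hs' t) hlt h).mulOption_lt₂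
  have m3 : ∀ s t t', SimplerThan s x → SimplerThan t y → SimplerThan t' y → t < t' → s < x →
      mulOption x y s t < mulOption x y s t' := fun s t t' hs ht ht' hlt h =>
    (MulBetween.mulLT (h3 s hs t) (h3 s hs t') (h2 t ht) (h2 t' ht') h hlt).mulOption_lt₃
  have m4 : ∀ s t t', SimplerThan s x → SimplerThan t y → SimplerThan t' y → t < t' → x < s →
      mulOption x y s t' < mulOption x y s t := fun s t t' hs ht ht' hlt h =>
    (MulBetween.mulLT (h2 t ht) (h2 t' ht') (h3 s hs t) (h3 s hs t') h hlt).mulOption_lt₄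
  have hLR : ∀ p ∈ Set.range (fun p : left x × left y => mulOption x y p.1 p.2) ∪
        Set.range (fun p : right x × right y => mulOption x y p.1 p.2),
      ∀ q ∈ Set.range (fun p : left x × right y => mulOption x y p.1 p.2) ∪
        Set.range (fun p : right x × left y => mulOption x y p.1 p.2), p < q := by
    rintro _ (⟨⟨⟨a, ha, ha'⟩, ⟨b, hb, hb'⟩⟩, rfl⟩ | ⟨⟨⟨a, ha, ha'⟩, ⟨b, hb, hb'⟩⟩, rfl⟩) _
      (⟨⟨⟨c, hc, hc'⟩, ⟨d, hd, hd'⟩⟩, rfl⟩ | ⟨⟨⟨c, hc, hc'⟩, ⟨d, hd, hd'⟩⟩, rfl⟩) <;> dsimp only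
    · rcases lt_trichotomy a c with h | rfl | h
      · exact (m1 a c b ha hc hb h hb').trans (m3 c b d hc hb hd (hb'.trans hd') hc')
      · exact m3 a b d ha hb hd (hb'.trans hd') ha'
      · exact (m3 a b d ha hb hd (hb'.trans hd') ha').trans (m2 c a d hc ha hd h hd')
    · rcases lt_trichotomy b d with h | rfl | h
      · exact (m3 a b d ha hb hd h ha').trans (m1 a c d ha hc hd (ha'.trans hc') hd')
      · exact m1 a c b ha hc hb (ha'.trans hc') hb'
      · exact (m1 a c b ha hc hb (ha'.trans hc') hb').trans (m4 c d b hc hd hb h hc')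
    · rcases lt_trichotomy b d with h | rfl | h
      · exact (m2 c a b hc ha hb (hc'.trans ha') hb').trans (m3 c b d hc hb hd h hc')
      · exact m2 c a b hc ha hb (hc'.trans ha') hb'
      · exact (m4 a d b ha hd hb h ha').trans (m2 c a d hc ha hd (hc'.trans ha') hd')
    · rcases lt_trichotomy a c with h | rfl | h
      · exact (m4 a d b ha hd hb (hd'.trans hb') ha').trans (m1 a c d ha hc hd h hd')
      · exact m4 a d b ha hd hb (hd'.trans hb') ha'
      · exact (m2 c a b hc ha hb h hb').trans (m4 c d b hc hd hb (hd'.trans hb') hc')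
  have hc := (isSimplest_cut hLR).1
  have hr := isRep_cut hLR
  rw [← mul_eq_cut] at hc hr
  refine ⟨fun a b ha hb => ⟨fun h h' => ?_, fun h h' => ?_, fun h h' => ?_, fun h h' => ?_⟩, ?_⟩
  · exact hc.1 _ (.inl ⟨(⟨a, ha, h⟩, ⟨b, hb, h'⟩), rfl⟩)
  · exact hc.1 _ (.inr ⟨(⟨a, ha, h⟩, ⟨b, hb, h'⟩), rfl⟩)
  · exact hc.2 _ (.inl ⟨(⟨a, ha, h⟩, ⟨b, hb, h'⟩), rfl⟩)
  · exact hc.2 _ (.inr ⟨(⟨a, ha, h⟩, ⟨b, hb, h'⟩), rfl⟩)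
  convert hr using 1
  ext o
  constructor
  · rintro ⟨a, ha, b, hb, rfl⟩
    rcases lt_or_gt_of_ne ha.ne with h | h <;> rcases lt_or_gt_of_ne hb.ne with h' | h'
    · exact .inl (.inl ⟨(⟨a, ha, h⟩, ⟨b, hb, h'⟩), rfl⟩)
    · exact .inr (.inl ⟨(⟨a, ha, h⟩, ⟨b, hb, h'⟩), rfl⟩)
    · exact .inr (.inr ⟨(⟨a, ha, h⟩, ⟨b, hb, h'⟩), rfl⟩)
    · exact .inl (.inr ⟨(⟨a, ha, h⟩, ⟨b, hb, h'⟩), rfl⟩)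
  · rintro ((⟨p, rfl⟩ | ⟨p, rfl⟩) | (⟨p, rfl⟩ | ⟨p, rfl⟩)) <;>
      exact ⟨_, p.1.2.1, _, p.2.2.1, rfl⟩
termination_by (x.length, y.length)
decreasing_by
  · rename_i h; exact Prod.Lex.left _ _ h.1
  · rename_i h; exact Prod.Lex.right _ h.1
  · rename_i h; exact Prod.Lex.left _ _ h.1

theorem mulLT_of_lt {x x' y y' : Surreal.{u}} (hx : x < x') (hy : y < y') : MulLT x x' y y' :=
  MulBetween.mulLT (mulBetween_and_isRep _ _).1 (mulBetween_and_isRep _ _).1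
    (mulBetween_and_isRep _ _).1 (mulBetween_and_isRep _ _).1 hx hy

/-- The sign rule `x * y - (a * y + x * b - a * b) = (x - a) * (y - b)`, before the distributive
law is available. -/
theorem sign_mul_sub_mulOption (x y a b : Surreal.{u}) :
    SignType.sign (x * y - mulOption x y a b) =
      SignType.sign (x - a) * SignType.sign (y - b) := by
  rcases lt_trichotomy a x with h | rfl | h <;> rcases lt_trichotomy b y with h' | rfl | h'
  · have := mulLT_of_lt h h'
    rw [sign_pos (sub_pos.2 h), sign_pos (sub_pos.2 h'), sign_pos]
    · rfl
    · unfold MulLT at this; unfold mulOption; grind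
  · rw [sub_self b, sign_zero, mul_zero, mulOption]
    rw [show x * b - (a * b + x * b - a * b) = 0 by abel, sign_zero]
  · have := mulLT_of_lt h h'
    rw [sign_pos (sub_pos.2 h), sign_neg (sub_neg.2 h'), sign_neg]
    · rfl
    · unfold MulLT at this; unfold mulOption; grind
  · rw [sub_self a, sign_zero, zero_mul, mulOption]
    rw [show a * y - (a * y + a * b - a * b) = 0 by abel, sign_zero]
  · rw [sub_self a, sign_zero, zero_mul, mulOption]
    rw [show a * b - (a * b + a * b - a * b) = 0 by abel, sign_zero]
  · rw [sub_self a, sign_zero, zero_mul, mulOption]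
    rw [show a * y - (a * y + a * b - a * b) = 0 by abel, sign_zero]
  · have := mulLT_of_lt h h'
    rw [sign_neg (sub_neg.2 h), sign_pos (sub_pos.2 h'), sign_neg]
    · rfl
    · unfold MulLT at this; unfold mulOption; grind
  · rw [sub_self b, sign_zero, mul_zero, mulOption]
    rw [show x * b - (a * b + x * b - a * b) = 0 by abel, sign_zero]
  · have := mulLT_of_lt h h'
    rw [sign_neg (sub_neg.2 h), sign_neg (sub_neg.2 h'), sign_pos]
    · rfl
    · unfold MulLT at this; unfold mulOption; grind

theorem sides_of_sign_eq {x y o : Surreal.{u}}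
    (h : SignType.sign (x - o) = SignType.sign (y - o)) : (o < x → o < y) ∧ (x < o → y < o) := by
  constructor
  · intro h'
    rw [sign_pos (sub_pos.2 h'), eq_comm, sign_eq_one_iff] at h
    exact sub_pos.1 h
  · intro h'
    rw [sign_neg (sub_neg.2 h'), eq_comm, sign_eq_neg_one_iff] at h
    exact sub_neg.1 h

theorem IsRep.eq_of_sign {x y : Surreal.{u}} {O Q : Set Surreal.{u}} (hx : IsRep x O)
    (hy : IsRep y Q) (hxy : ∀ o ∈ O, SignType.sign (x - o) = SignType.sign (y - o))
    (hyx : ∀ o ∈ Q, SignType.sign (x - o) = SignType.sign (y - o)) : x = y :=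
  hx.eq hy (fun o ho => sides_of_sign_eq (hxy o ho)) fun o ho => sides_of_sign_eq (hyx o ho).symm

theorem mulOption_le₁ {x y s s' t : Surreal.{u}} (h : s ≤ s') (ht : t < y) :
    mulOption x y s t ≤ mulOption x y s' t := by
  rcases h.eq_or_lt with rfl | h
  exacts [le_rfl, (mulLT_of_lt h ht).mulOption_lt₁.le]

theorem mulOption_le₂ {x y s s' t : Surreal.{u}} (h : s ≤ s') (ht : y < t) :
    mulOption x y s' t ≤ mulOption x y s t := by
  rcases h.eq_or_lt with rfl | h
  exacts [le_rfl, (mulLT_of_lt h ht).mulOption_lt₂.le]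

theorem mulOption_le₃ {x y s t t' : Surreal.{u}} (h : t ≤ t') (hs : s < x) :
    mulOption x y s t ≤ mulOption x y s t' := by
  rcases h.eq_or_lt with rfl | h
  exacts [le_rfl, (mulLT_of_lt hs h).mulOption_lt₃.le]

theorem mulOption_le₄ {x y s t t' : Surreal.{u}} (h : t ≤ t') (hs : x < s) :
    mulOption x y s t' ≤ mulOption x y s t := by
  rcases h.eq_or_lt with rfl | h
  exacts [le_rfl, (mulLT_of_lt hs h).mulOption_lt₄.le]

/-- Uniformity of multiplication: the product can be computed from arbitrary representations. -/
theorem IsRep.mul {x y : Surreal.{u}} {O Q : Set Surreal.{u}} (hx : IsRep x O) (hy : IsRep y Q) :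
    IsRep (x * y) (Set.image2 (mulOption x y) O Q) := by
  constructor
  · rintro ⟨a, ha, b, hb, h⟩
    have h' := sign_mul_sub_mulOption x y a b
    rw [h, sub_self, sign_zero, eq_comm, mul_eq_zero, _root_.sign_eq_zero_iff,
      _root_.sign_eq_zero_iff, sub_eq_zero, sub_eq_zero] at h'
    rcases h' with rfl | rfl
    exacts [hx.1 ha, hy.1 hb]
  intro w hw
  have hw' : ∀ o ∈ O, ∀ q ∈ Q, (mulOption x y o q < x * y → mulOption x y o q < w) ∧
      (x * y < mulOption x y o q → w < mulOption x y o q) := fun o ho q hq =>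
    hw _ ⟨o, ho, q, hq, rfl⟩
  have hpos : ∀ o q : Surreal.{u}, (o < x ∧ q < y ∨ x < o ∧ y < q) → mulOption x y o q < x * y := by
    rintro o q (⟨h, h'⟩ | ⟨h, h'⟩) <;>
      rw [← sub_pos, ← sign_eq_one_iff, sign_mul_sub_mulOption]
    · rw [sign_pos (sub_pos.2 h), sign_pos (sub_pos.2 h')]; rfl
    · rw [sign_neg (sub_neg.2 h), sign_neg (sub_neg.2 h')]; rfl
  have hneg : ∀ o q : Surreal.{u}, (o < x ∧ y < q ∨ x < o ∧ q < y) → x * y < mulOption x y o q := by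
    rintro o q (⟨h, h'⟩ | ⟨h, h'⟩) <;>
      rw [← sub_neg, ← sign_eq_neg_one_iff, sign_mul_sub_mulOption]
    · rw [sign_pos (sub_pos.2 h), sign_neg (sub_neg.2 h')]; rfl
    · rw [sign_neg (sub_neg.2 h), sign_pos (sub_pos.2 h')]; rfl
  refine (mulBetween_and_isRep x y).2.2 w ?_
  rintro _ ⟨a, ha, b, hb, rfl⟩
  rcases lt_or_gt_of_ne ha.ne with h | h <;> rcases lt_or_gt_of_ne hb.ne with h' | h'
  · obtain ⟨o, ho, h1, h2⟩ := (hx.exists_le ha).1 h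
    obtain ⟨q, hq, h3, h4⟩ := (hy.exists_le hb).1 h'
    refine ⟨fun _ => ?_, fun h5 => absurd h5 (hpos a b (.inl ⟨h, h'⟩)).asymm⟩
    exact ((mulOption_le₁ h1 h').trans (mulOption_le₃ h3 h2)).trans_lt
      ((hw' o ho q hq).1 (hpos o q (.inl ⟨h2, h4⟩)))
  · obtain ⟨o, ho, h1, h2⟩ := (hx.exists_le ha).1 h
    obtain ⟨q, hq, h3, h4⟩ := (hy.exists_le hb).2 h'
    refine ⟨fun h5 => absurd h5 (hneg a b (.inl ⟨h, h'⟩)).asymm, fun _ => ?_⟩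
    exact ((hw' o ho q hq).2 (hneg o q (.inl ⟨h2, h4⟩))).trans_le
      ((mulOption_le₃ h3 h2).trans (mulOption_le₂ h1 h'))
  · obtain ⟨o, ho, h1, h2⟩ := (hx.exists_le ha).2 h
    obtain ⟨q, hq, h3, h4⟩ := (hy.exists_le hb).1 h'
    refine ⟨fun h5 => absurd h5 (hneg a b (.inr ⟨h, h'⟩)).asymm, fun _ => ?_⟩
    exact ((hw' o ho q hq).2 (hneg o q (.inr ⟨h2, h4⟩))).trans_le
      ((mulOption_le₄ h3 h2).trans (mulOption_le₁ h1 h'))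
  · obtain ⟨o, ho, h1, h2⟩ := (hx.exists_le ha).2 h
    obtain ⟨q, hq, h3, h4⟩ := (hy.exists_le hb).2 h'
    refine ⟨fun _ => ?_, fun h5 => absurd h5 (hpos a b (.inr ⟨h, h'⟩)).asymm⟩
    exact ((mulOption_le₂ h1 h').trans (mulOption_le₄ h3 h2)).trans_lt
      ((hw' o ho q hq).1 (hpos o q (.inr ⟨h2, h4⟩)))

theorem mul_isRep (x y : Surreal.{u}) :
    IsRep (x * y) (Set.image2 (mulOption x y) {a | SimplerThan a x} {b | SimplerThan b y}) :=
  (mulBetween_and_isRep x y).2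

protected theorem mul_comm' (x y : Surreal.{u}) : x * y = y * x := by
  have h1 : ∀ a, SimplerThan a x → ∀ b, a * b = b * a := fun a _ b => Surreal.mul_comm' a b
  have h2 : ∀ b, SimplerThan b y → x * b = b * x := fun b _ => Surreal.mul_comm' x b
  have key : ∀ a b, SimplerThan a x → SimplerThan b y → mulOption x y a b = mulOption y x b a := by
    intro a b ha hb
    simp only [mulOption, h1 a ha, h2 b hb]; abel
  refine (mul_isRep x y).eq_of_sign (mul_isRep y x) ?_ ?_
  · rintro _ ⟨a, ha, b, hb, rfl⟩
    rw [sign_mul_sub_mulOption, key a b ha hb, sign_mul_sub_mulOption, mul_comm]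
  · rintro _ ⟨b, hb, a, ha, rfl⟩
    rw [sign_mul_sub_mulOption, ← key a b ha hb, sign_mul_sub_mulOption, mul_comm]
termination_by (x.length, y.length)
decreasing_by
  · rename_i h; exact Prod.Lex.left _ _ h.1
  · rename_i h; exact Prod.Lex.right _ h.1

protected theorem mul_zero' (x : Surreal.{u}) : x * 0 = 0 := by
  refine (mul_isRep x 0).eq_of_sign isRep_zero_empty ?_ fun o ho => absurd ho id
  rintro _ ⟨a, ha, b, hb, rfl⟩
  exact absurd hb not_simplerThan_zero

theorem isSimplest_one : IsSimplest (Between {0} ∅) (1 : Surreal.{u}) :=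
  isSimplest_cut (by rintro a - b ⟨⟩)

protected theorem zero_lt_one' : (0 : Surreal.{u}) < 1 := isSimplest_one.1.1 0 rfl

theorem isRep_one : IsRep (1 : Surreal.{u}) {0} :=
  ⟨fun h => Surreal.zero_lt_one'.ne h.symm, fun w hw => isSimplest_one.2 w
    ⟨by rintro _ rfl; exact (hw 0 rfl).1 Surreal.zero_lt_one', by rintro _ ⟨⟩⟩⟩

protected theorem mul_one' (x : Surreal.{u}) : x * 1 = x := by
  have h1 : ∀ a, SimplerThan a x → a * 1 = a := fun a _ => Surreal.mul_one' a
  have key : ∀ a, SimplerThan a x → mulOption x 1 a 0 = a := fun a ha => by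
    rw [mulOption, h1 a ha, Surreal.mul_zero', Surreal.mul_zero']; abel
  have hs : ∀ a, SimplerThan a x → SignType.sign (x * 1 - a) = SignType.sign (x - a) := by
    intro a ha
    conv_lhs => rw [← key a ha]
    rw [sign_mul_sub_mulOption, sub_zero, sign_pos Surreal.zero_lt_one', mul_one]
  refine ((isRep_predecessors x).mul isRep_one).eq_of_sign (isRep_predecessors x) ?_ fun a ha =>
    hs a ha
  rintro _ ⟨a, ha, _, rfl, rfl⟩
  rw [key a ha, hs a ha]
termination_by x.length
decreasing_by
  rename_i h; exact h.1

protected theorem mul_add' (x y z : Surreal.{u}) : x * (y + z) = x * y + x * z := by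
  have h1 : ∀ a, SimplerThan a x → ∀ b c, a * (b + c) = a * b + a * c :=
    fun a _ b c => Surreal.mul_add' a b c
  have h2 : ∀ b, SimplerThan b y → x * (b + z) = x * b + x * z :=
    fun b _ => Surreal.mul_add' x b z
  have h3 : ∀ c, SimplerThan c z → x * (y + c) = x * y + x * c :=
    fun c _ => Surreal.mul_add' x y c
  have k1 : ∀ a b, SimplerThan a x → SimplerThan b y →
      mulOption x (y + z) a (b + z) = mulOption x y a b + x * z := fun a b ha hb => by
    simp only [mulOption, h1 a ha, h2 b hb]; abel
  have k2 : ∀ a c, SimplerThan a x → SimplerThan c z →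
      mulOption x (y + z) a (y + c) = x * y + mulOption x z a c := fun a c ha hc => by
    simp only [mulOption, h1 a ha, h3 c hc]; abel
  have s1 : ∀ a b, SimplerThan a x → SimplerThan b y →
      SignType.sign (x * (y + z) - mulOption x (y + z) a (b + z)) =
        SignType.sign (x * y + x * z - mulOption x (y + z) a (b + z)) := fun a b ha hb => by
    rw [sign_mul_sub_mulOption, k1 a b ha hb, add_sub_add_right_eq_sub, add_sub_add_right_eq_sub,
      sign_mul_sub_mulOption]
  have s2 : ∀ a c, SimplerThan a x → SimplerThan c z →
      SignType.sign (x * (y + z) - mulOption x (y + z) a (y + c)) =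
        SignType.sign (x * y + x * z - mulOption x (y + z) a (y + c)) := fun a c ha hc => by
    rw [sign_mul_sub_mulOption, k2 a c ha hc, add_sub_add_left_eq_sub, add_sub_add_left_eq_sub,
      sign_mul_sub_mulOption]
  refine ((isRep_predecessors x).mul (addBetween_and_isRep y z).2).eq_of_sign
    ((mul_isRep x y).add (mul_isRep x z)) ?_ ?_
  · rintro _ ⟨a, ha, _, (⟨b, hb, rfl⟩ | ⟨c, hc, rfl⟩), rfl⟩
    exacts [s1 a b ha hb, s2 a c ha hc]
  · rintro _ (⟨_, ⟨a, ha, b, hb, rfl⟩, rfl⟩ | ⟨_, ⟨a, ha, c, hc, rfl⟩, rfl⟩) <;> beta_reduce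
    · rw [← k1 a b ha hb, s1 a b ha hb]
    · rw [← k2 a c ha hc, s2 a c ha hc]
termination_by (x.length, y.length, z.length)
decreasing_by
  · rename_i h; exact Prod.Lex.left _ _ h.1
  · rename_i h; exact Prod.Lex.right _ (Prod.Lex.left _ _ h.1)
  · rename_i h; exact Prod.Lex.right _ (Prod.Lex.right _ h.1)

protected theorem mul_sub' (x y z : Surreal.{u}) : x * (y - z) = x * y - x * z := by
  rw [eq_sub_iff_add_eq, ← Surreal.mul_add', sub_add_cancel]

protected theorem add_mul' (x y z : Surreal.{u}) : (x + y) * z = x * z + y * z := by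
  rw [Surreal.mul_comm', Surreal.mul_add', Surreal.mul_comm' z, Surreal.mul_comm' z]

protected theorem sub_mul' (x y z : Surreal.{u}) : (x - y) * z = x * z - y * z := by
  rw [Surreal.mul_comm', Surreal.mul_sub', Surreal.mul_comm' z, Surreal.mul_comm' z]

protected theorem mul_assoc' (x y z : Surreal.{u}) : x * y * z = x * (y * z) := by
  have h1 : ∀ a, SimplerThan a x → ∀ b c, a * b * c = a * (b * c) :=
    fun a _ b c => Surreal.mul_assoc' a b c
  have h2 : ∀ b, SimplerThan b y → ∀ c, x * b * c = x * (b * c) :=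
    fun b _ c => Surreal.mul_assoc' x b c
  have h3 : ∀ c, SimplerThan c z → x * y * c = x * (y * c) :=
    fun c _ => Surreal.mul_assoc' x y c
  have key : ∀ a b c, SimplerThan a x → SimplerThan b y → SimplerThan c z →
      mulOption (x * y) z (mulOption x y a b) c = mulOption x (y * z) a (mulOption y z b c) := by
    intro a b c ha hb hc
    simp only [mulOption, Surreal.mul_add', Surreal.add_mul', Surreal.mul_sub', Surreal.sub_mul',
      h1 a ha, h2 b hb, h3 c hc]
    abel
  refine ((mul_isRep x y).mul (isRep_predecessors z)).eq_of_sign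
    ((isRep_predecessors x).mul (mul_isRep y z)) ?_ ?_
  · rintro _ ⟨_, ⟨a, ha, b, hb, rfl⟩, c, hc, rfl⟩
    rw [sign_mul_sub_mulOption, sign_mul_sub_mulOption, key a b c ha hb hc, sign_mul_sub_mulOption,
      sign_mul_sub_mulOption, mul_assoc]
  · rintro _ ⟨a, ha, _, ⟨b, hb, c, hc, rfl⟩, rfl⟩
    rw [sign_mul_sub_mulOption, sign_mul_sub_mulOption, ← key a b c ha hb hc,
      sign_mul_sub_mulOption, sign_mul_sub_mulOption, mul_assoc]
termination_by (x.length, y.length, z.length)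
decreasing_by
  · rename_i h; exact Prod.Lex.left _ _ h.1
  · rename_i h; exact Prod.Lex.right _ (Prod.Lex.left _ _ h.1)
  · rename_i h; exact Prod.Lex.right _ (Prod.Lex.right _ h.1)

instance instCommRing : CommRing Surreal.{u} where
  __ := instAddCommGroup
  left_distrib := Surreal.mul_add'
  right_distrib := Surreal.add_mul'
  zero_mul x := by rw [Surreal.mul_comm', Surreal.mul_zero']
  mul_zero := Surreal.mul_zero'
  mul_assoc := Surreal.mul_assoc'
  one_mul x := by rw [Surreal.mul_comm', Surreal.mul_one']
  mul_one := Surreal.mul_one'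
  mul_comm := Surreal.mul_comm'
  npow k x := x ^ k
  npow_zero _ := rfl
  npow_succ _ _ := rfl

instance instNontrivial : Nontrivial Surreal.{u} := ⟨0, 1, Surreal.zero_lt_one'.ne⟩

instance instZeroLEOneClass : ZeroLEOneClass Surreal.{u} := ⟨Surreal.zero_lt_one'.le⟩

instance instIsStrictOrderedRing : IsStrictOrderedRing Surreal.{u} :=
  .of_mul_pos fun a b ha hb => by
    have h := mulLT_of_lt ha hb
    unfold MulLT at h
    simpa using h

theorem mulOption_eq (x y a b : Surreal.{u}) : mulOption x y a b = x * y - (x - a) * (y - b) := by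
  unfold mulOption; ring

/-! ### The real numbers -/

/-- The number `1 / 2`. -/
def oneHalf : Surreal.{u} := cut {0} {1}

theorem isSimplest_oneHalf : IsSimplest (Between {0} {1}) oneHalf.{u} :=
  isSimplest_cut (by rintro _ rfl _ rfl; exact zero_lt_one)

theorem oneHalf_pos : 0 < oneHalf.{u} := isSimplest_oneHalf.1.1 0 rfl

theorem oneHalf_add_oneHalf : oneHalf + oneHalf = (1 : Surreal.{u}) := by
  have hr : IsRep oneHalf.{u} ({0} ∪ {1}) := isRep_cut (by rintro _ rfl _ rfl; exact zero_lt_one)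
  have h0 := oneHalf_pos.{u}
  have h1 : oneHalf.{u} < 1 := isSimplest_oneHalf.1.2 1 rfl
  refine (hr.add hr).eq isRep_one ?_ ?_
  · rintro _ (⟨_, rfl | rfl, rfl⟩ | ⟨_, rfl | rfl, rfl⟩) <;> constructor <;> intro h <;> grind
  · rintro _ rfl
    constructor <;> intro h <;> grind

theorem two_pow_mul_oneHalf_pow (k : ℕ) : (2 : Surreal.{u}) ^ k * oneHalf ^ k = 1 := by
  rw [← mul_pow, two_mul, oneHalf_add_oneHalf, one_pow]

theorem oneHalf_pow_pos (k : ℕ) : 0 < oneHalf.{u} ^ k := pow_pos oneHalf_pos k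

/-- The class of numbers that lie in the same rational cut as `r`. -/
def RealCut (r : ℝ) (z : Surreal.{u}) : Prop :=
  ∀ (p : ℤ) (q : ℕ), 0 < q →
    ((p / q : ℝ) < r → p • (1 : Surreal.{u}) < q • z) ∧
    (r < (p / q : ℝ) → q • z < p • (1 : Surreal.{u}))

theorem RealCut.lt {r : ℝ} {z : Surreal.{u}} (h : RealCut r z) {p : ℤ} {q : ℕ} (hq : 0 < q)
    (hp : (p : ℝ) < q * r) : (p : Surreal.{u}) < q * z := by
  have hq' : (0 : ℝ) < q := by exact_mod_cast hq
  have := (h p q hq).1 (by rw [div_lt_iff₀ hq']; linarith)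
  simpa using this

theorem RealCut.gt {r : ℝ} {z : Surreal.{u}} (h : RealCut r z) {p : ℤ} {q : ℕ} (hq : 0 < q)
    (hp : q * r < (p : ℝ)) : q * z < (p : Surreal.{u}) := by
  have hq' : (0 : ℝ) < q := by exact_mod_cast hq
  have := (h p q hq).2 (by rw [lt_div_iff₀ hq']; linarith)
  simpa using this

theorem RealCut.of_lt_of_gt {r : ℝ} {z : Surreal.{u}}
    (h : ∀ (p : ℤ) (q : ℕ), 0 < q → (p : ℝ) < q * r → (p : Surreal.{u}) < q * z)
    (h' : ∀ (p : ℤ) (q : ℕ), 0 < q → q * r < (p : ℝ) → q * z < (p : Surreal.{u})) :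
    RealCut r z := by
  intro p q hq
  have hq' : (0 : ℝ) < q := by exact_mod_cast hq
  constructor
  · intro hp
    rw [div_lt_iff₀ hq'] at hp
    simpa using h p q hq (by linarith)
  · intro hp
    rw [lt_div_iff₀ hq'] at hp
    simpa using h' p q hq (by linarith)

theorem RealCut.neg {r : ℝ} {z : Surreal.{u}} (h : RealCut r z) : RealCut (-r) (-z) := by
  refine RealCut.of_lt_of_gt (fun p q hq hp => ?_) (fun p q hq hp => ?_)
  · have := h.gt (p := -p) hq (by push_cast; linarith)
    push_cast at this; linarith
  · have := h.lt (p := -p) hq (by push_cast; linarith)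
    push_cast at this; linarith

theorem RealCut.convex {r : ℝ} {a b z : Surreal.{u}} (ha : RealCut r a) (hb : RealCut r b)
    (h : a < z) (h' : z < b) : RealCut r z := by
  refine RealCut.of_lt_of_gt (fun p q hq hp => ?_) (fun p q hq hp => ?_)
  · exact (ha.lt hq hp).trans_le (by gcongr)
  · exact lt_of_le_of_lt (by gcongr) (hb.gt hq hp)

theorem intCast_mul_oneHalf_pow_lt {p p' : ℤ} {k k' : ℕ} (h : (p / 2 ^ k : ℝ) < p' / 2 ^ k') :
    (p : Surreal.{u}) * oneHalf ^ k < p' * oneHalf ^ k' := by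
  rw [div_lt_div_iff₀ (by positivity) (by positivity)] at h
  have h1 : p * 2 ^ k' < p' * 2 ^ k := by exact_mod_cast h
  have h2 : (p : Surreal.{u}) * 2 ^ k' < p' * 2 ^ k := by exact_mod_cast h1
  have h3 := mul_lt_mul_of_pos_right h2 (mul_pos (oneHalf_pow_pos.{u} k) (oneHalf_pow_pos.{u} k'))
  calc (p : Surreal.{u}) * oneHalf ^ k = p * oneHalf ^ k * (2 ^ k' * oneHalf ^ k') := by
        rw [two_pow_mul_oneHalf_pow, mul_one]
    _ = p * 2 ^ k' * (oneHalf ^ k * oneHalf ^ k') := by ring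
    _ < p' * 2 ^ k * (oneHalf ^ k * oneHalf ^ k') := h3
    _ = p' * oneHalf ^ k' * (2 ^ k * oneHalf ^ k) := by ring
    _ = _ := by rw [two_pow_mul_oneHalf_pow, mul_one]

theorem exists_dyadic_between {a b : ℝ} (h : a < b) : ∃ (p : ℤ) (k : ℕ), a < p / 2 ^ k ∧
    (p / 2 ^ k : ℝ) < b := by
  obtain ⟨k, hk⟩ := exists_nat_gt (1 / (b - a))
  have h2 : (k : ℝ) < 2 ^ k := by exact_mod_cast Nat.lt_two_pow_self
  have h3 : 1 < 2 ^ k * (b - a) := by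
    rw [div_lt_iff₀ (by linarith)] at hk
    nlinarith
  refine ⟨⌊2 ^ k * a⌋ + 1, k, ?_, ?_⟩
  · rw [lt_div_iff₀ (by positivity)]
    push_cast
    linarith [Int.lt_floor_add_one (2 ^ k * a)]
  · rw [div_lt_iff₀ (by positivity)]
    push_cast
    linarith [Int.floor_le (2 ^ k * a)]

/-- The cut of a real number in the dyadic rational numbers is small, hence it is filled. -/
theorem exists_realCut (r : ℝ) : ∃ z : Surreal.{u}, RealCut r z := by
  obtain ⟨z, hz, hz'⟩ := exists_between
    ((fun pk : ℤ × ℕ => (pk.1 : Surreal.{u}) * oneHalf ^ pk.2) ''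
      {pk : ℤ × ℕ | (pk.1 / 2 ^ pk.2 : ℝ) < r})
    ((fun pk : ℤ × ℕ => (pk.1 : Surreal.{u}) * oneHalf ^ pk.2) ''
      {pk : ℤ × ℕ | r < (pk.1 / 2 ^ pk.2 : ℝ)}) (by
      rintro _ ⟨pk, h, rfl⟩ _ ⟨pk', h', rfl⟩
      exact intCast_mul_oneHalf_pow_lt (lt_trans h h'))
  refine ⟨z, RealCut.of_lt_of_gt (fun p q hq hp => ?_) (fun p q hq hp => ?_)⟩
  · have hq' : (0 : ℝ) < q := by exact_mod_cast hq
    obtain ⟨p', k, h1, h2⟩ := exists_dyadic_between (a := p / q) (b := r)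
      (by rw [div_lt_iff₀ hq']; linarith)
    rw [div_lt_div_iff₀ hq' (by positivity)] at h1
    have h3 : p * 2 ^ k < p' * (q : ℤ) := by exact_mod_cast h1
    have h4 : (p : Surreal.{u}) * 2 ^ k < p' * q := by exact_mod_cast h3
    have h5 := hz _ ⟨(p', k), h2, rfl⟩
    have h6 := mul_lt_mul_of_pos_right h4 (oneHalf_pow_pos.{u} k)
    rw [mul_assoc, two_pow_mul_oneHalf_pow, mul_one] at h6
    refine h6.trans ?_
    have h7 : (0 : Surreal.{u}) < q := by exact_mod_cast hq
    have := mul_lt_mul_of_pos_left h5 h7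
    dsimp only at this
    linarith
  · have hq' : (0 : ℝ) < q := by exact_mod_cast hq
    obtain ⟨p', k, h1, h2⟩ := exists_dyadic_between (a := r) (b := p / q)
      (by rw [lt_div_iff₀ hq']; linarith)
    rw [div_lt_div_iff₀ (by positivity) hq'] at h2
    have h3 : p' * (q : ℤ) < p * 2 ^ k := by exact_mod_cast h2
    have h4 : (p' : Surreal.{u}) * q < p * 2 ^ k := by exact_mod_cast h3
    have h5 := hz' _ ⟨(p', k), h1, rfl⟩
    have h6 := mul_lt_mul_of_pos_right h4 (oneHalf_pow_pos.{u} k)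
    rw [mul_assoc (p : Surreal.{u}), two_pow_mul_oneHalf_pow, mul_one] at h6
    refine lt_trans ?_ h6
    have h7 : (0 : Surreal.{u}) < q := by exact_mod_cast hq
    have := mul_lt_mul_of_pos_left h5 h7
    dsimp only at this
    linarith

theorem isSimplest_ofReal (r : ℝ) : IsSimplest (RealCut r) (ofReal.{u} r) :=
  isSimplest_simplest (fun _ _ _ ha hb h h' => ha.convex hb h h') (exists_realCut r)

theorem realCut_ofReal (r : ℝ) : RealCut r (ofReal.{u} r) := (isSimplest_ofReal r).1

/-- `x` is the simplest among the numbers whose distance to `x` is below all powers of `1 / 2`. -/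
def IsReal (x : Surreal.{u}) : Prop :=
  IsRep x {z | ∃ k : ℕ, z = x + oneHalf ^ k ∨ z = x - oneHalf ^ k}

theorem isReal_iff {x : Surreal.{u}} : IsReal x ↔
    ∀ w, (∀ k : ℕ, |w - x| < oneHalf ^ k) → w = x ∨ SimplerThan x w := by
  constructor
  · intro h w hw
    refine h.2 w ?_
    rintro _ ⟨k, rfl | rfl⟩ <;> have h1 := oneHalf_pow_pos.{u} k <;> have h2 := abs_lt.1 (hw k)
    · exact ⟨fun h' => by linarith, fun h' => by linarith⟩
    · exact ⟨fun h' => by linarith, fun h' => by linarith⟩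
  · intro h
    refine ⟨?_, fun w hw => h w fun k => ?_⟩
    · rintro ⟨k, h | h⟩ <;> have h1 := oneHalf_pow_pos.{u} k <;> linarith
    · have h1 := oneHalf_pow_pos.{u} k
      have h2 := (hw _ ⟨k, .inl rfl⟩).2 (by linarith)
      have h3 := (hw _ ⟨k, .inr rfl⟩).1 (by linarith)
      rw [abs_lt]; constructor <;> linarith

theorem IsReal.eq {x y : Surreal.{u}} (hx : IsReal x) (hy : IsReal y)
    (h : ∀ k : ℕ, |x - y| < oneHalf ^ k) : x = y := by
  rcases isReal_iff.1 hy x h with h1 | h1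
  · exact h1
  rcases isReal_iff.1 hx y (fun k => by rw [abs_sub_comm]; exact h k) with h2 | h2
  · exact h2.symm
  · exact absurd h1 h2.asymm

theorem IsReal.add {x y : Surreal.{u}} (hx : IsReal x) (hy : IsReal y) : IsReal (x + y) := by
  unfold IsReal
  convert IsRep.add hx hy using 1
  ext z
  constructor
  · rintro ⟨k, rfl | rfl⟩
    · exact .inl ⟨x + oneHalf ^ k, ⟨k, .inl rfl⟩, by ring⟩
    · exact .inl ⟨x - oneHalf ^ k, ⟨k, .inr rfl⟩, by ring⟩
  · rintro (⟨_, ⟨k, rfl | rfl⟩, rfl⟩ | ⟨_, ⟨k, rfl | rfl⟩, rfl⟩)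
    · exact ⟨k, .inl (by ring)⟩
    · exact ⟨k, .inr (by ring)⟩
    · exact ⟨k, .inl (by ring)⟩
    · exact ⟨k, .inr (by ring)⟩

theorem IsReal.mul {x y : Surreal.{u}} (hx : IsReal x) (hy : IsReal y) : IsReal (x * y) := by
  unfold IsReal
  convert IsRep.mul hx hy using 1
  ext z
  constructor
  · rintro ⟨k, rfl | rfl⟩
    · exact ⟨x + oneHalf ^ k, ⟨k, .inl rfl⟩, y - oneHalf ^ 0, ⟨0, .inr rfl⟩, by
        rw [mulOption_eq]; ring⟩
    · exact ⟨x + oneHalf ^ k, ⟨k, .inl rfl⟩, y + oneHalf ^ 0, ⟨0, .inl rfl⟩, by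
        rw [mulOption_eq]; ring⟩
  · rintro ⟨_, ⟨k, rfl | rfl⟩, _, ⟨l, rfl | rfl⟩, rfl⟩
    · exact ⟨k + l, .inr (by rw [mulOption_eq]; ring)⟩
    · exact ⟨k + l, .inl (by rw [mulOption_eq]; ring)⟩
    · exact ⟨k + l, .inl (by rw [mulOption_eq]; ring)⟩
    · exact ⟨k + l, .inr (by rw [mulOption_eq]; ring)⟩

theorem isReal_one : IsReal (1 : Surreal.{u}) := by
  rw [isReal_iff]
  intro w hw
  refine isRep_one.2 w ?_
  rintro _ rfl
  have := abs_lt.1 (hw 0)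
  exact ⟨fun _ => by rw [pow_zero] at this; linarith, fun h => absurd h zero_lt_one.asymm⟩

theorem lt_oneHalf_pow_of_forall {x : Surreal.{u}} (h : ∀ n : ℕ, n * x ≤ 2) (k : ℕ) :
    x < oneHalf ^ k := by
  have h1 := h (2 ^ (k + 2))
  have h2 := mul_le_mul_of_nonneg_right h1 (oneHalf_pow_pos.{u} (k + 2)).le
  push_cast at h2
  have h3 : x ≤ 2 * oneHalf ^ (k + 2) := by
    calc x = 2 ^ (k + 2) * oneHalf ^ (k + 2) * x := by rw [two_pow_mul_oneHalf_pow, one_mul]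
      _ ≤ _ := by linarith
  have h4 : 2 * oneHalf.{u} ^ (k + 2) = oneHalf ^ (k + 1) * (oneHalf + oneHalf) := by ring
  rw [h4, oneHalf_add_oneHalf, mul_one] at h3
  have h5 : oneHalf.{u} ^ k = oneHalf ^ (k + 1) + oneHalf ^ (k + 1) := by
    rw [pow_succ, ← mul_add, oneHalf_add_oneHalf, mul_one]
  linarith [oneHalf_pow_pos.{u} (k + 1)]

/-- Numbers in the same real cut are at infinitesimal distance. -/
theorem RealCut.abs_sub_lt {r : ℝ} {x y : Surreal.{u}} (hx : RealCut r x) (hy : RealCut r y)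
    (k : ℕ) : |x - y| < oneHalf ^ k := by
  refine lt_oneHalf_pow_of_forall (fun n => ?_) k
  rcases n.eq_zero_or_pos with rfl | hn
  · simp
  have h1 : ((⌈n * r⌉ - 1 : ℤ) : ℝ) < n * r := by push_cast; linarith [Int.ceil_lt_add_one (n * r)]
  have h2 : n * r < ((⌈n * r⌉ + 1 : ℤ) : ℝ) := by push_cast; linarith [Int.le_ceil (n * r)]
  have a1 := hx.lt hn h1
  have a2 := hx.gt hn h2
  have b1 := hy.lt hn h1
  have b2 := hy.gt hn h2
  push_cast at *
  have hn' : (0 : Surreal.{u}) < n := by exact_mod_cast hn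
  calc (n : Surreal.{u}) * |x - y| = |n * (x - y)| := by rw [abs_mul, abs_of_pos hn']
    _ ≤ 2 := by rw [abs_le]; constructor <;> linarith

theorem RealCut.of_abs_sub_lt {r : ℝ} {x y : Surreal.{u}} (hx : RealCut r x)
    (h : ∀ k : ℕ, |y - x| < oneHalf ^ k) : RealCut r y := by
  have key : ∀ {r : ℝ} {x y : Surreal.{u}}, RealCut r x → (∀ k : ℕ, |y - x| < oneHalf ^ k) →
      ∀ (p : ℤ) (q : ℕ), 0 < q → (p : ℝ) < q * r → (p : Surreal.{u}) < q * y := by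
    intro r x y hx h p q hq hp
    have hq' : (0 : ℝ) < q := by exact_mod_cast hq
    obtain ⟨p', k, h1, h2⟩ := exists_dyadic_between (a := p / q) (b := r)
      (by rw [div_lt_iff₀ hq']; linarith)
    rw [div_lt_div_iff₀ hq' (by positivity)] at h1
    have h3 : p * 2 ^ k < p' * (q : ℤ) := by exact_mod_cast h1
    have h4 : (p : Surreal.{u}) * 2 ^ k + 1 ≤ p' * q := by exact_mod_cast Int.add_one_le_iff.2 h3
    rw [div_lt_iff₀ (by positivity)] at h2
    have h5 := hx.lt (p := p') (q := 2 ^ k) (by positivity) (by push_cast; linarith)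
    push_cast at h5
    have h6 := (abs_lt.1 (h (k + q))).1
    have hq2 : (0 : Surreal.{u}) < q := by exact_mod_cast hq
    have h7 : (q : Surreal.{u}) < 2 ^ q := by exact_mod_cast Nat.lt_two_pow_self
    have h8 : (2 : Surreal.{u}) ^ k * q * oneHalf ^ (k + q) < 1 := by
      have h9 : (2 : Surreal.{u}) ^ k * oneHalf ^ (k + q) = oneHalf ^ q := by
        rw [pow_add, ← mul_assoc, two_pow_mul_oneHalf_pow, one_mul]
      have h10 : (2 : Surreal.{u}) ^ q * oneHalf ^ q = 1 := two_pow_mul_oneHalf_pow q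
      have := mul_lt_mul_of_pos_right h7 (oneHalf_pow_pos.{u} q)
      calc (2 : Surreal.{u}) ^ k * q * oneHalf ^ (k + q) = q * (2 ^ k * oneHalf ^ (k + q)) := by ring
        _ < 1 := by rw [h9]; linarith
    have h2k : (0 : Surreal.{u}) < 2 ^ k := by positivity
    have h11 : (2 : Surreal.{u}) ^ k * q * -oneHalf ^ (k + q) < 2 ^ k * q * (y - x) :=
      mul_lt_mul_of_pos_left h6 (by positivity)
    have h12 := mul_lt_mul_of_pos_left h5 hq2
    have h13 : (2 : Surreal.{u}) ^ k * p < 2 ^ k * (q * y) := by nlinarith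
    exact lt_of_mul_lt_mul_left h13 h2k.le
  refine RealCut.of_lt_of_gt (key hx h) fun p q hq hp => ?_
  have := key hx.neg (y := -y) (fun k => by
    rw [show -y - -x = -(y - x) by ring, abs_neg]; exact h k) (-p) q hq (by push_cast; linarith)
  push_cast at this
  linarith

theorem isReal_ofReal (r : ℝ) : IsReal (ofReal.{u} r) :=
  isReal_iff.2 fun w hw => (isSimplest_ofReal r).2 w ((realCut_ofReal r).of_abs_sub_lt hw)

theorem IsReal.eq_ofReal {x : Surreal.{u}} (hx : IsReal x) {r : ℝ} (h : RealCut r x) :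
    x = ofReal r := hx.eq (isReal_ofReal r) fun k => h.abs_sub_lt (realCut_ofReal r) k

theorem RealCut.add {r s : ℝ} {x y : Surreal.{u}} (hx : RealCut r x) (hy : RealCut s y) :
    RealCut (r + s) (x + y) := by
  have key : ∀ {r s : ℝ} {x y : Surreal.{u}}, RealCut r x → RealCut s y →
      ∀ (p : ℤ) (q : ℕ), 0 < q → (p : ℝ) < q * (r + s) → (p : Surreal.{u}) < q * (x + y) := by
    intro r s x y hx hy p q hq hp
    have hq' : (0 : ℝ) < q := by exact_mod_cast hq
    obtain ⟨a, k, h1, h2⟩ := exists_dyadic_between (a := p / q - s) (b := r) (by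
      rw [sub_lt_iff_lt_add, div_lt_iff₀ hq']; linarith)
    obtain ⟨b, l, h3, h4⟩ := exists_dyadic_between (a := p / q - a / 2 ^ k) (b := s) (by linarith)
    have h5 : (p : ℝ) / q < a / 2 ^ k + b / 2 ^ l := by linarith
    rw [div_add_div _ _ (by positivity) (by positivity), div_lt_div_iff₀ hq' (by positivity)] at h5
    have h6 : p * (2 ^ k * 2 ^ l) < (a * 2 ^ l + 2 ^ k * b) * (q : ℤ) := by exact_mod_cast h5
    have h7 : (p : Surreal.{u}) * (2 ^ k * 2 ^ l) < (a * 2 ^ l + 2 ^ k * b) * q := by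
      exact_mod_cast h6
    rw [div_lt_iff₀ (by positivity)] at h2 h4
    have h8 := hx.lt (p := a) (q := 2 ^ k) (by positivity) (by push_cast; linarith)
    have h9 := hy.lt (p := b) (q := 2 ^ l) (by positivity) (by push_cast; linarith)
    push_cast at h8 h9
    have hk : (0 : Surreal.{u}) < 2 ^ k := by positivity
    have hl : (0 : Surreal.{u}) < 2 ^ l := by positivity
    have hq2 : (0 : Surreal.{u}) < q := by exact_mod_cast hq
    have h10 := mul_lt_mul_of_pos_left h8 (mul_pos hq2 hl)
    have h11 := mul_lt_mul_of_pos_left h9 (mul_pos hq2 hk)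
    have h12 : (2 : Surreal.{u}) ^ k * 2 ^ l * p < 2 ^ k * 2 ^ l * (q * (x + y)) := by linarith
    exact lt_of_mul_lt_mul_left h12 (mul_pos hk hl).le
  refine RealCut.of_lt_of_gt (key hx hy) fun p q hq hp => ?_
  have := key hx.neg hy.neg (-p) q hq (by push_cast; linarith)
  push_cast at this
  linarith

theorem ofReal_add (r s : ℝ) : ofReal.{u} (r + s) = ofReal r + ofReal s :=
  (((isReal_ofReal r).add (isReal_ofReal s)).eq_ofReal
    ((realCut_ofReal r).add (realCut_ofReal s))).symm

theorem ofReal_one : ofReal.{u} 1 = 1 := by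
  refine (isReal_one.eq_ofReal (RealCut.of_lt_of_gt (fun p q hq hp => ?_)
    (fun p q hq hp => ?_))).symm
  · rw [mul_one] at *; exact_mod_cast hp
  · rw [mul_one] at *; exact_mod_cast hp

theorem ofReal_strictMono : StrictMono ofReal.{u} := by
  intro r s h
  obtain ⟨p, k, h1, h2⟩ := exists_dyadic_between h
  rw [lt_div_iff₀ (by positivity)] at h1
  rw [div_lt_iff₀ (by positivity)] at h2
  have h3 := (realCut_ofReal.{u} r).gt (p := p) (q := 2 ^ k) (by positivity)
    (by push_cast; linarith)
  have h4 := (realCut_ofReal.{u} s).lt (p := p) (q := 2 ^ k) (by positivity)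
    (by push_cast; linarith)
  exact lt_of_mul_lt_mul_left (h3.trans h4) (by positivity)

/-- `ofReal` as a homomorphism of additive groups. -/
def ofRealAddHom : ℝ →+ Surreal.{u} := AddMonoidHom.mk' ofReal ofReal_add

/-- For natural numbers `n`, expanding `n * r` and `n * s` into integral and fractional part shows
that `n ^ 2` times the difference of both sides lies between `-1` and `1`. -/
theorem ofReal_mul (r s : ℝ) : ofReal.{u} (r * s) = ofReal r * ofReal s := by
  refine (((isReal_ofReal r).mul (isReal_ofReal s)).eq (isReal_ofReal (r * s)) fun k => ?_).symm
  refine lt_oneHalf_pow_of_forall (fun n => ?_) k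
  rcases n.eq_zero_or_pos with rfl | hn
  · simp
  have hint : ∀ (a : ℤ) (t : ℝ), ofReal.{u} (a * t) = a * ofReal t := fun a t => by
    have := map_zsmul ofRealAddHom.{u} a t
    simpa [ofRealAddHom] using this
  have hint1 : ∀ a : ℤ, ofReal.{u} a = a := fun a => by
    simpa [ofReal_one] using hint a 1
  obtain ⟨a, α, hr, hα0, hα1⟩ : ∃ (a : ℤ) (α : ℝ), n * r = a + α ∧ 0 ≤ α ∧ α ≤ 1 :=
    ⟨⌊n * r⌋, Int.fract (n * r), (Int.floor_add_fract _).symm, Int.fract_nonneg _,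
      (Int.fract_lt_one _).le⟩
  obtain ⟨b, β, hs, hβ0, hβ1⟩ : ∃ (b : ℤ) (β : ℝ), n * s = b + β ∧ 0 ≤ β ∧ β ≤ 1 :=
    ⟨⌊n * s⌋, Int.fract (n * s), (Int.floor_add_fract _).symm, Int.fract_nonneg _,
      (Int.fract_lt_one _).le⟩
  have e1 : (n : Surreal.{u}) * ofReal r = a + ofReal α := by
    rw [← hint1, ← ofReal_add, ← hr]
    simpa using (hint n r).symm
  have e2 : (n : Surreal.{u}) * ofReal s = b + ofReal β := by
    rw [← hint1, ← ofReal_add, ← hs]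
    simpa using (hint n s).symm
  have e3 : (n : Surreal.{u}) * n * ofReal (r * s) =
      a * b + a * ofReal β + b * ofReal α + ofReal (α * β) := by
    have e4 : ((n * n : ℤ) : ℝ) * (r * s) = ((a * b : ℤ) : ℝ) + a * β + b * α + α * β := by
      calc ((n * n : ℤ) : ℝ) * (r * s) = (n * r) * (n * s) := by push_cast; ring
        _ = _ := by rw [hr, hs]; push_cast; ring
    have := hint (n * n : ℤ) (r * s)
    rw [e4, ofReal_add, ofReal_add, ofReal_add, hint, hint, hint1] at this
    push_cast at this
    exact this.symm
  have f0 : ofReal.{u} 0 = 0 := map_zero ofRealAddHom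
  have hm := ofReal_strictMono.{u}.monotone
  have a0 := hm hα0
  have a1 := hm hα1
  have b0 := hm hβ0
  have b1 := hm hβ1
  have c0 := hm (mul_nonneg hα0 hβ0)
  have c1 := hm (mul_le_one₀ hα1 hβ0 hβ1)
  rw [f0] at a0 b0 c0
  rw [ofReal_one] at a1 b1 c1
  have hd : (n : Surreal.{u}) * n * (ofReal r * ofReal s - ofReal (r * s)) =
      ofReal α * ofReal β - ofReal (α * β) := by
    calc (n : Surreal.{u}) * n * (ofReal r * ofReal s - ofReal (r * s)) =
        (n * ofReal r) * (n * ofReal s) - n * n * ofReal (r * s) := by ring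
      _ = _ := by rw [e1, e2, e3]; ring
  have hn1 : (1 : Surreal.{u}) ≤ n := by exact_mod_cast hn
  have hle : |(n : Surreal.{u}) * n * (ofReal r * ofReal s - ofReal (r * s))| ≤ 1 := by
    rw [hd, abs_le]
    constructor
    · linarith [mul_nonneg a0 b0]
    · linarith [mul_le_one₀ a1 b0 b1]
  rw [abs_mul, abs_of_nonneg (by positivity)] at hle
  have hpos := abs_nonneg (ofReal.{u} r * ofReal s - ofReal (r * s))
  have : (n : Surreal.{u}) * |ofReal r * ofReal s - ofReal (r * s)| ≤
      n * (n * |ofReal r * ofReal s - ofReal (r * s)|) :=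
    le_mul_of_one_le_left (by positivity) hn1
  linarith

/-- The embedding of the real numbers as a ring homomorphism. -/
def realHom : ℝ →+* Surreal.{u} where
  toFun := ofReal
  map_one' := ofReal_one
  map_mul' := ofReal_mul
  map_zero' := map_zero ofRealAddHom
  map_add' := ofReal_add

theorem ofReal_zero : ofReal.{u} 0 = 0 := map_zero realHom

theorem ofReal_neg (r : ℝ) : ofReal.{u} (-r) = -ofReal r := map_neg realHom r

theorem ofReal_sub (r s : ℝ) : ofReal.{u} (r - s) = ofReal r - ofReal s := map_sub realHom r s

theorem ofReal_natCast (n : ℕ) : ofReal.{u} n = n := map_natCast realHom n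

theorem ofReal_intCast (n : ℤ) : ofReal.{u} n = n := map_intCast realHom n

theorem ofReal_lt_iff {r s : ℝ} : ofReal.{u} r < ofReal s ↔ r < s := ofReal_strictMono.lt_iff_lt

theorem ofReal_le_iff {r s : ℝ} : ofReal.{u} r ≤ ofReal s ↔ r ≤ s := ofReal_strictMono.le_iff_le

theorem ofReal_pos {r : ℝ} : 0 < ofReal.{u} r ↔ 0 < r := by rw [← ofReal_zero, ofReal_lt_iff]

theorem abs_ofReal (r : ℝ) : |ofReal.{u} r| = ofReal |r| := by
  rcases le_total 0 r with h | h
  · rw [abs_of_nonneg h, abs_of_nonneg]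
    rw [← ofReal_zero]; exact ofReal_le_iff.2 h
  · rw [abs_of_nonpos h, abs_of_nonpos, ofReal_neg]
    rw [← ofReal_zero]; exact ofReal_le_iff.2 h

/-! ### Orders of magnitude -/

theorem abs_eq (x : Surreal.{u}) : x.abs = |x| := rfl

theorem negligible_iff {a b : Surreal.{u}} :
    Negligible a b ↔ ∀ r : ℝ, 0 < r → |a| < ofReal r * |b| := by
  constructor
  · intro h r hr
    obtain ⟨n, hn⟩ := exists_nat_gt (1 / r)
    have h1 := h n
    rw [abs_eq, abs_eq, nsmul_eq_mul] at h1
    have h2 : 1 ≤ r * n := by rw [div_lt_iff₀ hr] at hn; linarith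
    have h3 : 1 ≤ ofReal.{u} r * n := by
      rw [← ofReal_natCast, ← ofReal_mul, ← ofReal_one]; exact ofReal_le_iff.2 h2
    calc |a| ≤ ofReal r * n * |a| := le_mul_of_one_le_left (_root_.abs_nonneg _) h3
      _ = ofReal r * (n * |a|) := by ring
      _ < _ := mul_lt_mul_of_pos_left h1 (ofReal_pos.2 hr)
  · intro h n
    rw [abs_eq, abs_eq, nsmul_eq_mul]
    rcases n.eq_zero_or_pos with rfl | hn
    · have := h 1 one_pos
      rw [ofReal_one, one_mul] at this
      simpa using (_root_.abs_nonneg a).trans_lt this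
    · have hn' : (0 : ℝ) < n := by exact_mod_cast hn
      have h1 := h (1 / n) (by positivity)
      have h2 : (n : Surreal.{u}) * ofReal (1 / n) = 1 := by
        rw [← ofReal_natCast, ← ofReal_mul, ← ofReal_one]
        congr 1; field_simp
      have h3 : (0 : Surreal.{u}) < n := by exact_mod_cast hn
      calc (n : Surreal.{u}) * |a| < n * (ofReal (1 / n) * |b|) := mul_lt_mul_of_pos_left h1 h3
        _ = _ := by rw [← mul_assoc, h2, one_mul]

theorem Negligible.lt {a b : Surreal.{u}} (h : Negligible a b) {r : ℝ} (hr : 0 < r) :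
    |a| < ofReal r * |b| := negligible_iff.1 h r hr

theorem Negligible.abs_lt {a b : Surreal.{u}} (h : Negligible a b) : |a| < |b| := by
  simpa [ofReal_one] using h.lt one_pos

theorem Negligible.of_abs_le {a a' b : Surreal.{u}} (h : Negligible a b) (ha : |a'| ≤ |a|) :
    Negligible a' b := negligible_iff.2 fun _ hr => ha.trans_lt (h.lt hr)

theorem Negligible.neg {a b : Surreal.{u}} (h : Negligible a b) : Negligible (-a) b :=
  h.of_abs_le (abs_neg a).le

theorem Negligible.add {a a' b : Surreal.{u}} (h : Negligible a b) (h' : Negligible a' b) :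
    Negligible (a + a') b := negligible_iff.2 fun r hr => by
  have h1 := h.lt (half_pos hr)
  have h2 := h'.lt (half_pos hr)
  have h3 : ofReal.{u} r = ofReal (r / 2) + ofReal (r / 2) := by
    rw [← ofReal_add, add_halves]
  rw [h3]
  linarith [abs_add_le a a']

theorem Negligible.sub {a a' b : Surreal.{u}} (h : Negligible a b) (h' : Negligible a' b) :
    Negligible (a - a') b := by rw [sub_eq_add_neg]; exact h.add h'.neg

theorem negligible_zero {b : Surreal.{u}} (h : b ≠ 0) : Negligible 0 b :=
  negligible_iff.2 fun _ hr => by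
    rw [_root_.abs_zero]; exact mul_pos (ofReal_pos.2 hr) (abs_pos.2 h)

/-- `a` is at most of the order of magnitude of `b`. -/
def Dominated (a b : Surreal.{u}) : Prop := ∃ r : ℝ, |a| ≤ ofReal r * |b|

theorem Dominated.exists_pos {a b : Surreal.{u}} (h : Dominated a b) :
    ∃ r : ℝ, 0 < r ∧ |a| ≤ ofReal r * |b| := by
  obtain ⟨r, hr⟩ := h
  refine ⟨max r 1, lt_max_of_lt_right one_pos, hr.trans ?_⟩
  exact mul_le_mul_of_nonneg_right (ofReal_le_iff.2 (le_max_left _ _)) (_root_.abs_nonneg _)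

theorem Negligible.dominated {a b : Surreal.{u}} (h : Negligible a b) : Dominated a b :=
  ⟨1, (h.lt one_pos).le⟩

theorem Dominated.refl (a : Surreal.{u}) : Dominated a a := ⟨1, by rw [ofReal_one, one_mul]⟩

theorem Dominated.trans_negligible {a b c : Surreal.{u}} (h : Dominated a b)
    (h' : Negligible b c) : Negligible a c := by
  obtain ⟨r, hr, hle⟩ := h.exists_pos
  refine negligible_iff.2 fun s hs => hle.trans_lt ?_
  have h1 := mul_lt_mul_of_pos_left (h'.lt (div_pos hs hr)) (ofReal_pos.{u}.2 hr)
  rwa [← mul_assoc, ← ofReal_mul, mul_div_cancel₀ _ hr.ne'] at h1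

theorem Negligible.trans_dominated {a b c : Surreal.{u}} (h : Negligible a b)
    (h' : Dominated b c) : Negligible a c := by
  obtain ⟨r, hr, hle⟩ := h'.exists_pos
  refine negligible_iff.2 fun s hs => (h.lt (div_pos hs hr)).trans_le ?_
  have h1 := mul_le_mul_of_nonneg_left hle (ofReal_pos.{u}.2 (div_pos hs hr)).le
  rwa [← mul_assoc, ← ofReal_mul, div_mul_cancel₀ _ hr.ne'] at h1

theorem Negligible.trans {a b c : Surreal.{u}} (h : Negligible a b) (h' : Negligible b c) :
    Negligible a c := h.dominated.trans_negligible h'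

theorem Dominated.add {a a' b : Surreal.{u}} (h : Dominated a b) (h' : Dominated a' b) :
    Dominated (a + a') b := by
  obtain ⟨r, hr⟩ := h
  obtain ⟨s, hs⟩ := h'
  refine ⟨r + s, ?_⟩
  rw [ofReal_add]
  linarith [abs_add_le a a']

theorem Dominated.mul {a a' b b' : Surreal.{u}} (h : Dominated a b) (h' : Dominated a' b') :
    Dominated (a * a') (b * b') := by
  obtain ⟨r, hr0, hr⟩ := h.exists_pos
  obtain ⟨s, hs0, hs⟩ := h'.exists_pos
  refine ⟨r * s, ?_⟩
  rw [abs_mul, abs_mul, ofReal_mul]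
  calc |a| * |a'| ≤ (ofReal r * |b|) * (ofReal s * |b'|) :=
        mul_le_mul hr hs (_root_.abs_nonneg _)
          (mul_nonneg (ofReal_pos.2 hr0).le (_root_.abs_nonneg _))
    _ = _ := by ring

theorem Dominated.ofReal_mul {a b : Surreal.{u}} (h : Dominated a b) (r : ℝ) :
    Dominated (ofReal r * a) b := by
  obtain ⟨s, hs⟩ := h
  refine ⟨|r| * s, ?_⟩
  rw [abs_mul, abs_ofReal, Surreal.ofReal_mul, mul_assoc]
  refine mul_le_mul_of_nonneg_left hs ?_
  rw [← ofReal_zero]; exact ofReal_le_iff.2 (abs_nonneg r)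

theorem Negligible.ofReal_mul {a b : Surreal.{u}} (h : Negligible a b) (r : ℝ) :
    Negligible (ofReal r * a) b := ((Dominated.refl a).ofReal_mul r).trans_negligible h

theorem dominated_ofReal_mul {r : ℝ} (hr : r ≠ 0) (a : Surreal.{u}) : Dominated a (ofReal r * a) := by
  refine ⟨|r⁻¹|, ?_⟩
  rw [abs_mul, ← abs_ofReal, ← mul_assoc, ← abs_mul, ← Surreal.ofReal_mul, inv_mul_cancel₀ hr,
    ofReal_one, _root_.abs_one, one_mul]

theorem Negligible.mul_dominated {a b c d : Surreal.{u}} (h : Negligible a b) (h' : Dominated c d)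
    (hd : d ≠ 0) : Negligible (a * c) (b * d) := by
  obtain ⟨s, hs0, hs⟩ := h'.exists_pos
  refine negligible_iff.2 fun r hr => ?_
  have h1 := h.lt (div_pos hr hs0)
  rw [abs_mul, abs_mul]
  calc |a| * |c| ≤ |a| * (ofReal s * |d|) := mul_le_mul_of_nonneg_left hs (_root_.abs_nonneg _)
    _ < ofReal (r / s) * |b| * (ofReal s * |d|) :=
        mul_lt_mul_of_pos_right h1 (mul_pos (ofReal_pos.2 hs0) (abs_pos.2 hd))
    _ = ofReal (r / s * s) * (|b| * |d|) := by rw [Surreal.ofReal_mul]; ring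
    _ = _ := by rw [div_mul_cancel₀ _ hs0.ne']

theorem Negligible.mul_left {a b c : Surreal.{u}} (h : Negligible a b) (hc : c ≠ 0) :
    Negligible (c * a) (c * b) := by
  rw [mul_comm c, mul_comm c]; exact h.mul_dominated (Dominated.refl c) hc

theorem Negligible.asymm {a b : Surreal.{u}} (h : Negligible a b) : ¬ Dominated b a := fun h' =>
  (h.trans_dominated h').abs_lt.false

/-! ### The powers of `ω` -/

theorem omegaPow_eq (x : Surreal.{u}) : omegaPow x =
    simplest fun z => 0 < z ∧ (∀ a : left x, Negligible (omegaPow a.1) z) ∧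
      ∀ a : right x, Negligible z (omegaPow a.1) := by
  rw [omegaPow]

/-- `omegaPow x` is positive and has the correct relation to its options. -/
def OmegaSpec (x : Surreal.{u}) : Prop :=
  0 < omegaPow x ∧ ∀ a, SimplerThan a x →
    (a < x → Negligible (omegaPow a) (omegaPow x)) ∧
    (x < a → Negligible (omegaPow x) (omegaPow a))

theorem OmegaSpec.negligible {x y : Surreal.{u}} (hx : OmegaSpec x) (hy : OmegaSpec y)
    (h : x < y) : Negligible (omegaPow x) (omegaPow y) := by
  rcases simplerThan_trichotomy h with h1 | h1 | ⟨t, h1, h2, h3, h4⟩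
  · exact (hy.2 x h1).1 h
  · exact (hx.2 y h1).2 h
  · exact ((hx.2 t h1).2 h3).trans ((hy.2 t h2).1 h4)

/-- The options of `ω ^ x` that stem from the options `O` of `x`. -/
def omegaOptions (O : Set Surreal.{u}) : Set Surreal.{u} :=
  {z | z = 0 ∨ ∃ r : ℝ, 0 < r ∧ ∃ o ∈ O, z = ofReal r * omegaPow o}

theorem negligible_of_forall_lt {a b : Surreal.{u}} (ha : 0 < a)
    (h : ∀ r : ℝ, 0 < r → ofReal r * a < b) : Negligible a b := by
  have hb : 0 < b := (mul_pos (ofReal_pos.2 one_pos) ha).trans (h 1 one_pos)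
  refine negligible_iff.2 fun r hr => ?_
  have h1 := mul_lt_mul_of_pos_left (h (1 / r) (by positivity)) (ofReal_pos.{u}.2 hr)
  rwa [← mul_assoc, ← Surreal.ofReal_mul, mul_one_div_cancel hr.ne', ofReal_one, one_mul,
    ← abs_of_pos ha, ← abs_of_pos hb] at h1

theorem Negligible.ofReal_mul_lt {a b : Surreal.{u}} (h : Negligible a b) (hb : 0 < b) (r : ℝ) :
    ofReal r * a < b := by
  have h1 := (h.ofReal_mul r).abs_lt
  rw [abs_of_pos hb] at h1
  exact (le_abs_self _).trans_lt h1

theorem Negligible.lt_ofReal_mul {a b : Surreal.{u}} (h : Negligible a b) (hb : 0 < b) {r : ℝ}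
    (hr : 0 < r) : a < ofReal r * b := by
  have h1 := h.lt hr
  rw [abs_of_pos hb] at h1
  exact (le_abs_self _).trans_lt h1

theorem negligible_of_forall_gt {a b : Surreal.{u}} (ha : 0 < a) (hb : 0 < b)
    (h : ∀ r : ℝ, 0 < r → a < ofReal r * b) : Negligible a b := by
  refine negligible_iff.2 fun r hr => ?_
  rw [abs_of_pos ha, abs_of_pos hb]
  exact h r hr

/-- The cut that defines `ω ^ x` is filled: it is the cut of the real multiples of the powers of `ω`
that belong to the predecessors of `x`. -/
theorem omegaSpec_and_isRep (x : Surreal.{u}) :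
    OmegaSpec x ∧ IsRep (omegaPow x) (omegaOptions {a | SimplerThan a x}) := by
  have h1 : ∀ a, SimplerThan a x → OmegaSpec a := fun a _ => (omegaSpec_and_isRep a).1
  have hlt : ∀ a, SimplerThan a x → ∀ c, SimplerThan c x → a < c → ∀ r s : ℝ, 0 < r → 0 < s →
      ofReal r * omegaPow a < ofReal s * omegaPow c := by
    intro a ha c hc hac r s _ hs
    exact (((h1 a ha).negligible (h1 c hc) hac).ofReal_mul r).lt_ofReal_mul (h1 c hc).1 hs
  set P : Surreal.{u} → Prop := fun z => 0 < z ∧ (∀ a : left x, Negligible (omegaPow a.1) z) ∧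
      ∀ a : right x, Negligible z (omegaPow a.1) with hP
  have hconv : ∀ a b z, P a → P b → a < z → z < b → P z := by
    rintro a b z ⟨ha, ha1, ha2⟩ ⟨hb, hb1, hb2⟩ haz hzb
    have hz := ha.trans haz
    refine ⟨hz, fun c => ?_, fun c => (hb2 c).of_abs_le ?_⟩
    · refine (ha1 c).trans_dominated ⟨1, ?_⟩
      rw [ofReal_one, one_mul, abs_of_pos ha, abs_of_pos hz]; exact haz.le
    · rw [abs_of_pos hb, abs_of_pos hz]; exact hzb.le
  have hne : ∃ z, P z := by
    obtain ⟨z, hz1, hz2⟩ := exists_between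
      ({0} ∪ Set.range fun p : {r : ℝ // 0 < r} × left x => ofReal p.1.1 * omegaPow p.2.1)
      (Set.range fun p : {r : ℝ // 0 < r} × right x => ofReal p.1.1 * omegaPow p.2.1) (by
        rintro _ (rfl | ⟨⟨⟨r, hr⟩, ⟨a, ha, hax⟩⟩, rfl⟩) _ ⟨⟨⟨s, hs⟩, ⟨c, hc, hcx⟩⟩, rfl⟩
        · exact mul_pos (ofReal_pos.2 hs) (h1 c hc).1
        · exact hlt a ha c hc (hax.trans hcx) r s hr hs)
    have hz0 : 0 < z := hz1 0 (.inl rfl)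
    refine ⟨z, hz0, fun a => ?_, fun a => ?_⟩
    · exact negligible_of_forall_lt (h1 a.1 a.2.1).1 fun r hr => hz1 _ (.inr ⟨(⟨r, hr⟩, a), rfl⟩)
    · exact negligible_of_forall_gt hz0 (h1 a.1 a.2.1).1 fun r hr => hz2 _ ⟨(⟨r, hr⟩, a), rfl⟩
  have hs := isSimplest_simplest hconv hne
  rw [← omegaPow_eq] at hs
  obtain ⟨⟨hs0, hs1, hs2⟩, hs3⟩ := hs
  have hspec : OmegaSpec x := ⟨hs0, fun a ha => ⟨fun h => hs1 ⟨a, ha, h⟩, fun h => hs2 ⟨a, ha, h⟩⟩⟩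
  refine ⟨hspec, ?_, fun w hw => hs3 w ⟨?_, fun a => ?_, fun a => ?_⟩⟩
  · rintro (h | ⟨r, hr, a, ha, h⟩)
    · exact hs0.ne' h
    · rcases lt_or_gt_of_ne (SimplerThan.ne ha) with h' | h'
      · exact (((hspec.2 a ha).1 h').ofReal_mul_lt hs0 r).ne h.symm
      · exact (((hspec.2 a ha).2 h').lt_ofReal_mul (h1 a ha).1 hr).ne h
  · exact (hw 0 (.inl rfl)).1 hs0
  · exact negligible_of_forall_lt (h1 a.1 a.2.1).1 fun r hr =>
      (hw _ (.inr ⟨r, hr, a.1, a.2.1, rfl⟩)).1 ((hs1 a).ofReal_mul_lt hs0 r)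
  · exact negligible_of_forall_gt ((hw 0 (.inl rfl)).1 hs0) (h1 a.1 a.2.1).1 fun r hr =>
      (hw _ (.inr ⟨r, hr, a.1, a.2.1, rfl⟩)).2 ((hs2 a).lt_ofReal_mul (h1 a.1 a.2.1).1 hr)
termination_by x.length
decreasing_by
  rename_i h; exact h.1

theorem omegaPow_pos (x : Surreal.{u}) : 0 < omegaPow x := (omegaSpec_and_isRep x).1.1

theorem omegaPow_ne_zero (x : Surreal.{u}) : omegaPow x ≠ 0 := (omegaPow_pos x).ne'

theorem negligible_omegaPow {x y : Surreal.{u}} (h : x < y) :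
    Negligible (omegaPow x) (omegaPow y) :=
  (omegaSpec_and_isRep x).1.negligible (omegaSpec_and_isRep y).1 h

theorem dominated_omegaPow {x y : Surreal.{u}} (h : x ≤ y) :
    Dominated (omegaPow x) (omegaPow y) := by
  rcases h.eq_or_lt with rfl | h
  exacts [Dominated.refl _, (negligible_omegaPow h).dominated]

theorem ofReal_mul_omegaPow_lt {x y : Surreal.{u}} (h : x < y) (r : ℝ) :
    ofReal r * omegaPow x < omegaPow y :=
  (negligible_omegaPow h).ofReal_mul_lt (omegaPow_pos y) r

theorem omegaPow_lt_ofReal_mul {x y : Surreal.{u}} (h : x < y) {r : ℝ} (hr : 0 < r) :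
    omegaPow x < ofReal r * omegaPow y :=
  (negligible_omegaPow h).lt_ofReal_mul (omegaPow_pos y) hr

theorem omegaPow_le_omegaPow {x y : Surreal.{u}} (h : x ≤ y) : omegaPow x ≤ omegaPow y := by
  rcases h.eq_or_lt with rfl | h
  · exact le_rfl
  · simpa [ofReal_one] using (ofReal_mul_omegaPow_lt h 1).le

/-- Uniformity of the `ω`-map. -/
theorem IsRep.omegaPow {x : Surreal.{u}} {O : Set Surreal.{u}} (hx : IsRep x O) :
    IsRep (omegaPow x) (omegaOptions O) := by
  have hmono : ∀ {r : ℝ}, 0 < r → ∀ {a b : Surreal.{u}}, a ≤ b →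
      ofReal r * Surreal.omegaPow a ≤ ofReal r * Surreal.omegaPow b := fun hr _ _ h =>
    mul_le_mul_of_nonneg_left (omegaPow_le_omegaPow h) (ofReal_pos.2 hr).le
  constructor
  · rintro (h | ⟨r, hr, a, ha, h⟩)
    · exact omegaPow_ne_zero x h
    · have hne : a ≠ x := by rintro rfl; exact hx.1 ha
      rcases lt_or_gt_of_ne hne with h' | h'
      · exact (ofReal_mul_omegaPow_lt h' r).ne h.symm
      · exact (omegaPow_lt_ofReal_mul h' hr).ne h
  · intro w hw
    refine (omegaSpec_and_isRep x).2.2 w ?_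
    rintro _ (rfl | ⟨r, hr, a, ha, rfl⟩)
    · exact hw 0 (.inl rfl)
    · rcases lt_or_gt_of_ne (SimplerThan.ne ha) with h' | h'
      · obtain ⟨o, ho, h1, h2⟩ := (hx.exists_le ha).1 h'
        refine ⟨fun _ => (hmono hr h1).trans_lt
          ((hw _ (.inr ⟨r, hr, o, ho, rfl⟩)).1 (ofReal_mul_omegaPow_lt h2 r)), fun h => ?_⟩
        exact absurd h (ofReal_mul_omegaPow_lt h' r).asymm
      · obtain ⟨o, ho, h1, h2⟩ := (hx.exists_le ha).2 h'
        refine ⟨fun h => ?_, fun _ => ((hw _ (.inr ⟨r, hr, o, ho, rfl⟩)).2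
          (omegaPow_lt_ofReal_mul h2 hr)).trans_le (hmono hr h1)⟩
        exact absurd h (omegaPow_lt_ofReal_mul h' hr).asymm

theorem omegaPow_zero : omegaPow (0 : Surreal.{u}) = 1 := by
  refine (isRep_zero_empty.omegaPow).eq isRep_one ?_ ?_
  · rintro _ (rfl | ⟨r, hr, a, ha, rfl⟩)
    · exact ⟨fun _ => one_pos, fun h => absurd h (omegaPow_pos _).asymm⟩
    · exact absurd ha id
  · rintro _ rfl
    exact ⟨fun _ => omegaPow_pos _, fun h => absurd h one_pos.asymm⟩

theorem omegaPow_add (x y : Surreal.{u}) : omegaPow (x + y) = omegaPow x * omegaPow y := by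
  have h1 : ∀ a, SimplerThan a x → ∀ b, omegaPow (a + b) = omegaPow a * omegaPow b :=
    fun a _ b => omegaPow_add a b
  have h2 : ∀ b, SimplerThan b y → omegaPow (x + b) = omegaPow x * omegaPow b :=
    fun b _ => omegaPow_add x b
  have hZ := omegaPow_pos (x + y)
  have hX := omegaPow_pos x
  have hY := omegaPow_pos y
  have hXY := mul_pos hX hY
  -- All options lie on the same side of `ω ^ (x + y)` and of `ω ^ x * ω ^ y`.
  have key1 : ∀ r : ℝ, 0 < r → ∀ a, SimplerThan a x →
      (ofReal r * (omegaPow a * omegaPow y) < omegaPow (x + y) ∧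
        ofReal r * (omegaPow a * omegaPow y) < omegaPow x * omegaPow y) ∨
      (omegaPow (x + y) < ofReal r * (omegaPow a * omegaPow y) ∧
        omegaPow x * omegaPow y < ofReal r * (omegaPow a * omegaPow y)) := by
    intro r hr a ha
    rw [← h1 a ha]
    rcases lt_or_gt_of_ne ha.ne with h | h
    · refine .inl ⟨ofReal_mul_omegaPow_lt (by simpa using h) r, ?_⟩
      rw [h1 a ha, ← mul_assoc]
      exact mul_lt_mul_of_pos_right (ofReal_mul_omegaPow_lt h r) hY
    · refine .inr ⟨omegaPow_lt_ofReal_mul (by simpa using h) hr, ?_⟩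
      rw [h1 a ha, ← mul_assoc]
      exact mul_lt_mul_of_pos_right (omegaPow_lt_ofReal_mul h hr) hY
  have key2 : ∀ r : ℝ, 0 < r → ∀ b, SimplerThan b y →
      (ofReal r * (omegaPow x * omegaPow b) < omegaPow (x + y) ∧
        ofReal r * (omegaPow x * omegaPow b) < omegaPow x * omegaPow y) ∨
      (omegaPow (x + y) < ofReal r * (omegaPow x * omegaPow b) ∧
        omegaPow x * omegaPow y < ofReal r * (omegaPow x * omegaPow b)) := by
    intro r hr b hb
    have e : ofReal r * (omegaPow x * omegaPow b) = omegaPow x * (ofReal r * omegaPow b) := by ring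
    rcases lt_or_gt_of_ne hb.ne with h | h
    · refine .inl ⟨?_, ?_⟩
      · rw [← h2 b hb]; exact ofReal_mul_omegaPow_lt (by simpa using h) r
      · rw [e]; exact mul_lt_mul_of_pos_left (ofReal_mul_omegaPow_lt h r) hX
    · refine .inr ⟨?_, ?_⟩
      · rw [← h2 b hb]; exact omegaPow_lt_ofReal_mul (by simpa using h) hr
      · rw [e]; exact mul_lt_mul_of_pos_left (omegaPow_lt_ofReal_mul h hr) hX
  have e2 : ∀ r : ℝ, ofReal.{u} r = ofReal (r / 2) + ofReal (r / 2) := fun r => by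
    rw [← ofReal_add, add_halves]
  -- The options of the product that stem from a pair of nonzero options.
  have key3 : ∀ r s : ℝ, 0 < r → 0 < s → ∀ a b, SimplerThan a x → SimplerThan b y → ∀ o,
      o = omegaPow x * omegaPow y -
        (omegaPow x - ofReal r * omegaPow a) * (omegaPow y - ofReal s * omegaPow b) →
      (o < omegaPow (x + y) ∧ o < omegaPow x * omegaPow y) ∨
      (omegaPow (x + y) < o ∧ omegaPow x * omegaPow y < o) := by
    intro r s hr hs a b ha hb o ho
    have ho' : o = ofReal r * omegaPow (a + y) + ofReal s * omegaPow (x + b) -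
        ofReal r * ofReal s * (omegaPow a * omegaPow b) := by
      rw [ho, h1 a ha, h2 b hb]; ring
    have hr' := ofReal_pos.{u}.2 hr
    have hs' := ofReal_pos.{u}.2 hs
    have hA := omegaPow_pos a
    have hB := omegaPow_pos b
    have hAB := mul_pos (mul_pos hr' hs') (mul_pos hA hB)
    rcases lt_or_gt_of_ne ha.ne with h | h <;> rcases lt_or_gt_of_ne hb.ne with h' | h'
    · left
      constructor
      · have l1 := ofReal_mul_omegaPow_lt (x := a + y) (y := x + y) (by simpa using h) (2 * r)
        have l2 := ofReal_mul_omegaPow_lt (x := x + b) (y := x + y) (by simpa using h') (2 * s)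
        rw [e2, mul_div_cancel_left₀ _ two_ne_zero] at l1 l2
        rw [ho']; linarith
      · rw [ho]
        linarith [mul_pos (sub_pos.2 (ofReal_mul_omegaPow_lt h r))
          (sub_pos.2 (ofReal_mul_omegaPow_lt h' s))]
    · right
      constructor
      · have l1 := ofReal_mul_omegaPow_lt h (2 * r)
        rw [e2, mul_div_cancel_left₀ _ two_ne_zero] at l1
        have l2 := omegaPow_lt_ofReal_mul (x := x + y) (y := x + b) (by simpa using h') (half_pos hs)
        have l3 := mul_lt_mul_of_pos_right l1 (mul_pos (ofReal_pos.{u}.2 (half_pos hs)) hB)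
        have l4 := mul_pos hr' (omegaPow_pos (a + y))
        rw [ho', e2 s]
        rw [h2 b hb] at l2 ⊢
        linarith
      · rw [ho]
        linarith [mul_pos (sub_pos.2 (ofReal_mul_omegaPow_lt h r))
          (sub_pos.2 (omegaPow_lt_ofReal_mul h' hs))]
    · right
      constructor
      · have l1 := ofReal_mul_omegaPow_lt h' (2 * s)
        rw [e2, mul_div_cancel_left₀ _ two_ne_zero] at l1
        have l2 := omegaPow_lt_ofReal_mul (x := x + y) (y := a + y) (by simpa using h) (half_pos hr)
        have l3 := mul_lt_mul_of_pos_right l1 (mul_pos (ofReal_pos.{u}.2 (half_pos hr)) hA)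
        have l4 := mul_pos hs' (omegaPow_pos (x + b))
        rw [ho', e2 r]
        rw [h1 a ha] at l2 ⊢
        linarith
      · rw [ho]
        linarith [mul_pos (sub_pos.2 (omegaPow_lt_ofReal_mul h hr))
          (sub_pos.2 (ofReal_mul_omegaPow_lt h' s))]
    · left
      constructor
      · have l1 := omegaPow_lt_ofReal_mul h (half_pos hr)
        have l2 := omegaPow_lt_ofReal_mul h' (half_pos hs)
        have l3 := mul_lt_mul_of_pos_left l1 (mul_pos hs' hB)
        have l4 := mul_lt_mul_of_pos_left l2 (mul_pos hr' hA)
        have e3 : ofReal s * omegaPow b * (ofReal (r / 2) * omegaPow a) +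
            ofReal s * omegaPow b * (ofReal (r / 2) * omegaPow a) =
            ofReal r * ofReal s * (omegaPow a * omegaPow b) := by rw [e2 r]; ring
        have e4 : ofReal r * omegaPow a * (ofReal (s / 2) * omegaPow b) +
            ofReal r * omegaPow a * (ofReal (s / 2) * omegaPow b) =
            ofReal r * ofReal s * (omegaPow a * omegaPow b) := by rw [e2 s]; ring
        rw [ho', h1 a ha, h2 b hb]
        linarith
      · rw [ho]
        linarith [mul_pos (sub_pos.2 (omegaPow_lt_ofReal_mul h hr))
          (sub_pos.2 (omegaPow_lt_ofReal_mul h' hs))]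
  have sides : ∀ {o : Surreal.{u}}, ((o < omegaPow (x + y) ∧ o < omegaPow x * omegaPow y) ∨
      (omegaPow (x + y) < o ∧ omegaPow x * omegaPow y < o)) →
      ((o < omegaPow (x + y) → o < omegaPow x * omegaPow y) ∧
        (omegaPow (x + y) < o → omegaPow x * omegaPow y < o)) ∧
      ((o < omegaPow x * omegaPow y → o < omegaPow (x + y)) ∧
        (omegaPow x * omegaPow y < o → omegaPow (x + y) < o)) := by
    rintro o (⟨h, h'⟩ | ⟨h, h'⟩)
    · exact ⟨⟨fun _ => h', fun h'' => absurd h'' h.asymm⟩, fun _ => h,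
        fun h'' => absurd h'' h'.asymm⟩
    · exact ⟨⟨fun h'' => absurd h'' h.asymm, fun _ => h'⟩, fun h'' => absurd h'' h'.asymm,
        fun _ => h⟩
  refine ((addBetween_and_isRep x y).2.omegaPow).eq
    ((omegaSpec_and_isRep x).2.mul (omegaSpec_and_isRep y).2) ?_ ?_
  · rintro _ (rfl | ⟨r, hr, _, (⟨a, ha, rfl⟩ | ⟨b, hb, rfl⟩), rfl⟩)
    · exact (sides (.inl ⟨hZ, hXY⟩)).1
    · beta_reduce; rw [h1 a ha]; exact (sides (key1 r hr a ha)).1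
    · beta_reduce; rw [h2 b hb]; exact (sides (key2 r hr b hb)).1
  · rintro _ ⟨_, (rfl | ⟨r, hr, a, ha, rfl⟩), _, (rfl | ⟨s, hs, b, hb, rfl⟩), rfl⟩ <;>
      rw [mulOption_eq]
    · rw [show ∀ p q : Surreal.{u}, p * q - (p - 0) * (q - 0) = 0 by intros; ring]
      exact (sides (.inl ⟨hZ, hXY⟩)).2
    · rw [show ∀ p q t w : Surreal.{u}, p * q - (p - 0) * (q - t * w) = t * (p * w) by
        intros; ring]
      exact (sides (key2 s hs b hb)).2
    · rw [show ∀ p q t w : Surreal.{u}, p * q - (p - t * w) * (q - 0) = t * (w * q) by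
        intros; ring]
      exact (sides (key1 r hr a ha)).2
    · exact (sides (key3 r s hr hs a b ha hb _ rfl)).2
termination_by (x.length, y.length)
decreasing_by
  · rename_i h; exact Prod.Lex.left _ _ h.1
  · rename_i h; exact Prod.Lex.right _ h.1

theorem omegaPow_neg_mul (e : Surreal.{u}) : omegaPow (-e) * omegaPow e = 1 := by
  rw [← omegaPow_add, neg_add_cancel, omegaPow_zero]

/-- Every positive number has the order of magnitude of a power of `ω`. -/
theorem exists_omegaPow_commensurate (x : Surreal.{u}) (hx : 0 < x) :
    ∃ e, Dominated x (omegaPow e) ∧ Dominated (omegaPow e) x := by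
  by_contra! hno
  have hch : ∀ a, SimplerThan a x → 0 < a →
      ∃ e, Dominated a (omegaPow e) ∧ Dominated (omegaPow e) a := fun a _ h =>
    exists_omegaPow_commensurate a h
  choose! e he1 he2 using hch
  have habs := abs_of_pos hx
  -- A power of `ω` that bounds `x` on one side up to a real factor does so for all real factors.
  have hL : ∀ a, SimplerThan a x → 0 < a → a < x → Negligible (omegaPow (e a)) x := by
    intro a ha h0 h
    have hd : Dominated (omegaPow (e a)) x := by
      obtain ⟨r, hr⟩ := he2 a ha h0
      obtain ⟨r, hr0, hr⟩ := Dominated.exists_pos ⟨r, hr⟩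
      refine ⟨r, hr.trans (mul_le_mul_of_nonneg_left ?_ (ofReal_pos.2 hr0).le)⟩
      rw [habs, abs_of_pos h0]; exact h.le
    refine negligible_of_forall_lt (omegaPow_pos _) fun r hr => ?_
    by_contra! h'
    exact hno (e a) ⟨r, by rwa [habs, abs_of_pos (omegaPow_pos _)]⟩ hd
  have hR : ∀ a, SimplerThan a x → 0 < a → x < a → Negligible x (omegaPow (e a)) := by
    intro a ha h0 h
    have hd : Dominated x (omegaPow (e a)) := by
      obtain ⟨r, hr⟩ := he1 a ha h0
      refine ⟨r, le_trans ?_ hr⟩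
      rw [habs, abs_of_pos h0]; exact h.le
    refine negligible_of_forall_gt hx (omegaPow_pos _) fun r hr => ?_
    by_contra! h'
    refine hno (e a) hd ⟨1 / r, ?_⟩
    rw [habs, abs_of_pos (omegaPow_pos _)]
    have := mul_le_mul_of_nonneg_left h' (ofReal_pos.{u}.2 (one_div_pos.2 hr)).le
    rwa [← mul_assoc, ← Surreal.ofReal_mul, one_div_mul_cancel hr.ne', ofReal_one, one_mul] at this
  set L := Set.range fun a : {a : left x // 0 < a.1} => e a.1.1
  set R := Set.range fun a : right x => e a.1
  have hR0 : ∀ a ∈ right x, 0 < a := fun a ha => hx.trans ha.2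
  have hLR : ∀ p ∈ L, ∀ q ∈ R, p < q := by
    rintro _ ⟨⟨⟨a, ha⟩, h0⟩, rfl⟩ _ ⟨⟨b, hb⟩, rfl⟩
    by_contra! h
    exact (((hL a ha.1 h0 ha.2).trans (hR b hb.1 (hR0 b hb) hb.2))).asymm (dominated_omegaPow h)
  have hrep := (isRep_cut hLR).omegaPow
  have hcut := (isSimplest_cut hLR).1
  have heq : x = omegaPow (cut L R) := by
    refine (isRep_predecessors x).eq hrep ?_ ?_
    · intro a ha
      constructor
      · intro h
        rcases le_or_gt a 0 with h0 | h0
        · exact h0.trans_lt (omegaPow_pos _)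
        · have h1 := hcut.1 _ ⟨⟨⟨a, ha, h⟩, h0⟩, rfl⟩
          have h2 := ((he1 a ha h0).trans_negligible (negligible_omegaPow h1)).abs_lt
          rwa [abs_of_pos h0, abs_of_pos (omegaPow_pos _)] at h2
      · intro h
        have h0 := hx.trans h
        have h1 := hcut.2 _ ⟨⟨a, ha, h⟩, rfl⟩
        have h2 := ((negligible_omegaPow h1).trans_dominated (he2 a ha h0)).abs_lt
        rwa [abs_of_pos h0, abs_of_pos (omegaPow_pos _)] at h2
    · rintro _ (rfl | ⟨r, hr, _, (⟨⟨⟨a, ha⟩, h0⟩, rfl⟩ | ⟨⟨b, hb⟩, rfl⟩), rfl⟩)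
      · exact ⟨fun _ => hx, fun h => absurd h (omegaPow_pos _).asymm⟩
      · exact ⟨fun _ => (hL a ha.1 h0 ha.2).ofReal_mul_lt hx r, fun h => absurd h
          (ofReal_mul_omegaPow_lt (hcut.1 _ ⟨⟨⟨a, ha⟩, h0⟩, rfl⟩) r).asymm⟩
      · exact ⟨fun h => absurd h (omegaPow_lt_ofReal_mul (hcut.2 _ ⟨⟨b, hb⟩, rfl⟩) hr).asymm,
          fun _ => (hR b hb.1 (hR0 b hb) hb.2).lt_ofReal_mul (omegaPow_pos _) hr⟩
  exact hno (cut L R) ⟨1, by rw [ofReal_one, one_mul, ← heq]⟩ ⟨1, by rw [ofReal_one, one_mul, ← heq]⟩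
termination_by x.length
decreasing_by
  rename_i h'; exact h'.1

/-! ### Truncations and coefficients -/

/-- `w` differs from `x` by something negligible relative to `ω ^ d` for each `d ∈ E`. -/
def Near (E : Set Surreal.{u}) (x w : Surreal.{u}) : Prop :=
  ∀ d ∈ E, Negligible (w - x) (omegaPow d)

/-- `x` is the simplest number modulo terms that are negligible relative to all `ω ^ d` with
`d ∈ E`. -/
def SimpleMod (E : Set Surreal.{u}) (x : Surreal.{u}) : Prop :=
  ∀ w, Near E x w → w = x ∨ SimplerThan x w

theorem Near.symm {E : Set Surreal.{u}} {x w : Surreal.{u}} (h : Near E x w) : Near E w x :=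
  fun d hd => by rw [← neg_sub]; exact (h d hd).neg

theorem Near.trans {E : Set Surreal.{u}} {x y z : Surreal.{u}} (h : Near E x y)
    (h' : Near E y z) : Near E x z := fun d hd => by
  rw [show z - x = (z - y) + (y - x) by ring]; exact (h' d hd).add (h d hd)

theorem Near.refl (E : Set Surreal.{u}) (x : Surreal.{u}) : Near E x x := fun d _ => by
  rw [sub_self]; exact negligible_zero (omegaPow_ne_zero d)

theorem Near.mono {E E' : Set Surreal.{u}} {x w : Surreal.{u}} (h : Near E x w) (hE : E' ⊆ E) :
    Near E' x w := fun d hd => h d (hE hd)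

theorem SimpleMod.mono {E E' : Set Surreal.{u}} {x : Surreal.{u}} (h : SimpleMod E x)
    (hE : E ⊆ E') : SimpleMod E' x := fun w hw => h w (hw.mono hE)

theorem negligible_convex {a b z x c : Surreal.{u}} (ha : Negligible (a - x) c)
    (hb : Negligible (b - x) c) (haz : a < z) (hzb : z < b) : Negligible (z - x) c := by
  refine negligible_iff.2 fun r hr => ?_
  have h1 := abs_lt.1 (ha.lt hr)
  have h2 := abs_lt.1 (hb.lt hr)
  rw [_root_.abs_lt]; constructor <;> linarith

theorem isSimplest_near_of_exists {ι : Type*} {x c : ι → Surreal.{u}}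
    (h : ∃ z, ∀ i, Negligible (z - x i) (c i)) :
    IsSimplest (fun z => ∀ i, Negligible (z - x i) (c i))
      (simplest fun z => ∀ i, Negligible (z - x i) (c i)) :=
  isSimplest_simplest (fun _ _ _ ha hb haz hzb i => negligible_convex (ha i) (hb i) haz hzb) h

/-- The options `x ± r ω ^ d` for `d ∈ E` and positive real `r`. -/
def nearOptions (E : Set Surreal.{u}) (x : Surreal.{u}) : Set Surreal.{u} :=
  {z | ∃ r : ℝ, 0 < r ∧ ∃ d ∈ E, z = x + ofReal r * omegaPow d ∨ z = x - ofReal r * omegaPow d}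

theorem simpleMod_iff {E : Set Surreal.{u}} {x : Surreal.{u}} :
    SimpleMod E x ↔ IsRep x (nearOptions E x) := by
  have hpos : ∀ r : ℝ, 0 < r → ∀ d, 0 < ofReal r * omegaPow.{u} d := fun r hr d =>
    mul_pos (ofReal_pos.2 hr) (omegaPow_pos d)
  constructor
  · intro h
    constructor
    · rintro ⟨r, hr, d, hd, h1 | h1⟩ <;> linarith [hpos r hr d]
    · intro w hw
      refine h w fun d hd => negligible_iff.2 fun r hr => ?_
      rw [abs_of_pos (omegaPow_pos d), _root_.abs_lt]
      have h1 := (hw _ ⟨r, hr, d, hd, .inl rfl⟩).2 (by linarith [hpos r hr d])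
      have h2 := (hw _ ⟨r, hr, d, hd, .inr rfl⟩).1 (by linarith [hpos r hr d])
      constructor <;> linarith
  · intro h w hw
    refine h.2 w ?_
    rintro _ ⟨r, hr, d, hd, rfl | rfl⟩ <;> have h1 := hpos r hr d <;>
      have h2 := (hw d hd).lt hr <;> rw [abs_of_pos (omegaPow_pos d), _root_.abs_lt] at h2 <;>
      exact ⟨fun h' => by linarith, fun h' => by linarith⟩

theorem SimpleMod.add {E E' : Set Surreal.{u}} {x y : Surreal.{u}} (hx : SimpleMod E x)
    (hy : SimpleMod E' y) : SimpleMod (E ∪ E') (x + y) := by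
  rw [simpleMod_iff] at *
  convert IsRep.add hx hy using 1
  ext z
  constructor
  · rintro ⟨r, hr, d, hd | hd, rfl | rfl⟩
    · exact .inl ⟨_, ⟨r, hr, d, hd, .inl rfl⟩, by ring⟩
    · exact .inl ⟨_, ⟨r, hr, d, hd, .inr rfl⟩, by ring⟩
    · exact .inr ⟨_, ⟨r, hr, d, hd, .inl rfl⟩, by ring⟩
    · exact .inr ⟨_, ⟨r, hr, d, hd, .inr rfl⟩, by ring⟩
  · rintro (⟨_, ⟨r, hr, d, hd, rfl | rfl⟩, rfl⟩ | ⟨_, ⟨r, hr, d, hd, rfl | rfl⟩, rfl⟩)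
    · exact ⟨r, hr, d, .inl hd, .inl (by ring)⟩
    · exact ⟨r, hr, d, .inl hd, .inr (by ring)⟩
    · exact ⟨r, hr, d, .inr hd, .inl (by ring)⟩
    · exact ⟨r, hr, d, .inr hd, .inr (by ring)⟩

/-- Simplicity is multiplicative, because the options of `x * y` that belong to `x ± r ω ^ d` and
`y ± s ω ^ d'` are `x * y ± r s ω ^ (d + d')`. -/
theorem SimpleMod.mul {E E' : Set Surreal.{u}} {x y : Surreal.{u}} (hx : SimpleMod E x)
    (hy : SimpleMod E' y) : SimpleMod (Set.image2 (· + ·) E E') (x * y) := by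
  rw [simpleMod_iff] at *
  convert IsRep.mul hx hy using 1
  ext z
  constructor
  · rintro ⟨r, hr, _, ⟨d, hd, d', hd', rfl⟩, rfl | rfl⟩
    · refine ⟨_, ⟨r, hr, d, hd, .inl rfl⟩, _, ⟨1, one_pos, d', hd', .inr rfl⟩, ?_⟩
      rw [mulOption_eq, ofReal_one, omegaPow_add]; ring
    · refine ⟨_, ⟨r, hr, d, hd, .inl rfl⟩, _, ⟨1, one_pos, d', hd', .inl rfl⟩, ?_⟩
      rw [mulOption_eq, ofReal_one, omegaPow_add]; ring
  · rintro ⟨_, ⟨r, hr, d, hd, rfl | rfl⟩, _, ⟨s, hs, d', hd', rfl | rfl⟩, rfl⟩ <;>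
      refine ⟨r * s, mul_pos hr hs, _, ⟨d, hd, d', hd', rfl⟩, ?_⟩ <;>
      rw [mulOption_eq, omegaPow_add, ofReal_mul]
    · exact .inr (by ring)
    · exact .inl (by ring)
    · exact .inl (by ring)
    · exact .inr (by ring)

theorem simpleMod_zero (E : Set Surreal.{u}) : SimpleMod E 0 := fun _ _ =>
  or_iff_not_imp_left.2 zero_simplerThan

/-- The part of `x` that consists of the terms with exponents above `e`: the simplest number that
differs from `x` by something negligible relative to all `ω ^ d` with `d > e`. -/
def trunc (e x : Surreal.{u}) : Surreal.{u} :=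
  simplest fun z => ∀ d : Set.Ioi e, Negligible (z - x) (omegaPow d.1)

theorem isSimplest_trunc (e x : Surreal.{u}) : IsSimplest (Near (Set.Ioi e) x) (trunc e x) := by
  have h := isSimplest_near_of_exists (ι := Set.Ioi e) (x := fun _ => x)
    (c := fun d => omegaPow d.1) ⟨x, fun d => Near.refl (Set.Ioi e) x d.1 d.2⟩
  exact ⟨fun d hd => h.1 ⟨d, hd⟩, fun w hw => h.2 w fun d => hw d.1 d.2⟩

theorem near_trunc (e x : Surreal.{u}) : Near (Set.Ioi e) x (trunc e x) := (isSimplest_trunc e x).1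

theorem trunc_eq_or_simplerThan (e x : Surreal.{u}) :
    trunc e x = x ∨ SimplerThan (trunc e x) x :=
  ((isSimplest_trunc e x).2 x (Near.refl _ x)).imp_left Eq.symm

theorem simpleMod_trunc (e x : Surreal.{u}) : SimpleMod (Set.Ioi e) (trunc e x) := fun w hw =>
  (isSimplest_trunc e x).2 w ((near_trunc e x).trans hw)

theorem trunc_eq_of_simpleMod {e x t : Surreal.{u}} (h : SimpleMod (Set.Ioi e) t)
    (h' : Near (Set.Ioi e) x t) : trunc e x = t :=
  (isSimplest_trunc e x).unique ⟨h', fun w hw => h w (h'.symm.trans hw)⟩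

theorem trunc_add (e x y : Surreal.{u}) : trunc e (x + y) = trunc e x + trunc e y := by
  refine trunc_eq_of_simpleMod ?_ fun d hd => ?_
  · simpa using (simpleMod_trunc e x).add (simpleMod_trunc e y)
  · rw [show trunc e x + trunc e y - (x + y) = (trunc e x - x) + (trunc e y - y) by ring]
    exact (near_trunc e x d hd).add (near_trunc e y d hd)

/-- Completeness of the real numbers provides the leading coefficient. -/
theorem exists_coefficient {y e : Surreal.{u}} (h : Dominated y (omegaPow e)) :
    ∃ c : ℝ, Negligible (y - ofReal c * omegaPow e) (omegaPow e) := by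
  obtain ⟨r, hr⟩ := h
  have hω := omegaPow_pos e
  rw [abs_of_pos hω, _root_.abs_le] at hr
  set S : Set ℝ := {s | ofReal s * omegaPow e ≤ y}
  have hne : S.Nonempty := ⟨-r, by
    change ofReal (-r) * omegaPow e ≤ y
    rw [ofReal_neg]; linarith⟩
  have hbdd : BddAbove S := ⟨r, fun s hs => by
    have h1 : ofReal s * omegaPow e ≤ ofReal r * omegaPow e := le_trans hs hr.2
    exact ofReal_le_iff.1 (le_of_mul_le_mul_right h1 hω)⟩
  refine ⟨sSup S, negligible_iff.2 fun t ht => ?_⟩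
  rw [abs_of_pos hω, _root_.abs_lt]
  obtain ⟨s, hs, hlt⟩ := exists_lt_of_lt_csSup hne (sub_lt_self (sSup S) ht)
  have h1 : sSup S + t ∉ S := fun h' => by linarith [le_csSup hbdd h']
  have h2 : y < ofReal (sSup S + t) * omegaPow e := not_le.1 h1
  have h3 := (mul_lt_mul_of_pos_right (ofReal_lt_iff.{u}.2 hlt) hω).trans_le hs
  rw [ofReal_add] at h2
  rw [ofReal_sub] at h3
  constructor <;> linarith

theorem eq_zero_of_negligible_ofReal_mul {c : ℝ} {a : Surreal.{u}}
    (h : Negligible (ofReal c * a) a) : c = 0 := by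
  by_contra hc
  exact h.asymm (dominated_ofReal_mul hc a)

theorem exists_leading {y : Surreal.{u}} (hy : y ≠ 0) :
    ∃ e, Dominated y (omegaPow e) ∧ Dominated (omegaPow e) y := by
  obtain ⟨e, ⟨r, hr⟩, ⟨s, hs⟩⟩ := exists_omegaPow_commensurate |y| (abs_pos.2 hy)
  exact ⟨e, ⟨r, by rwa [_root_.abs_abs] at hr⟩, ⟨s, by rwa [_root_.abs_abs] at hs⟩⟩

theorem dominated_of_forall_negligible {y e : Surreal.{u}}
    (h : ∀ d, e < d → Negligible y (omegaPow d)) : Dominated y (omegaPow e) := by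
  rcases eq_or_ne y 0 with rfl | hy
  · exact (negligible_zero (omegaPow_ne_zero e)).dominated
  obtain ⟨a, ha, ha'⟩ := exists_leading hy
  rcases le_or_gt a e with hae | hae
  · obtain ⟨r, hr0, hr⟩ := ha.exists_pos
    obtain ⟨s, hs⟩ := dominated_omegaPow hae
    refine ⟨r * s, hr.trans ?_⟩
    rw [ofReal_mul, mul_assoc]
    exact mul_le_mul_of_nonneg_left hs (ofReal_pos.2 hr0).le
  · exact absurd ha' (h a hae).asymm

theorem exists_normalCoeff (e x : Surreal.{u}) :
    ∃ c : ℝ, Negligible (x - trunc e x - ofReal c * omegaPow e) (omegaPow e) :=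
  exists_coefficient (dominated_of_forall_negligible fun d hd =>
    (near_trunc e x).symm d hd)

/-- The coefficient of `ω ^ e` in `x`, defined as the leading coefficient of `x - trunc e x`. -/
def normalCoeff (e x : Surreal.{u}) : ℝ := (exists_normalCoeff e x).choose

theorem normalCoeff_spec (e x : Surreal.{u}) :
    Negligible (x - trunc e x - ofReal (normalCoeff e x) * omegaPow e) (omegaPow e) :=
  (exists_normalCoeff e x).choose_spec

theorem normalCoeff_eq {e x : Surreal.{u}} {c : ℝ}
    (h : Negligible (x - trunc e x - ofReal c * omegaPow e) (omegaPow e)) :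
    normalCoeff e x = c := by
  have h1 := h.sub (normalCoeff_spec e x)
  rw [show x - trunc e x - ofReal c * omegaPow e -
    (x - trunc e x - ofReal (normalCoeff e x) * omegaPow e) =
    (ofReal (normalCoeff e x) - ofReal c) * omegaPow e by ring, ← ofReal_sub] at h1
  exact sub_eq_zero.1 (eq_zero_of_negligible_ofReal_mul h1)

theorem normalCoeff_add (e x y : Surreal.{u}) :
    normalCoeff e (x + y) = normalCoeff e x + normalCoeff e y := by
  refine normalCoeff_eq ?_
  have := (normalCoeff_spec e x).add (normalCoeff_spec e y)
  rw [trunc_add, ofReal_add]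
  convert this using 1
  ring

/-- `normalCoeff e` as a homomorphism of additive groups. -/
def normalCoeffHom (e : Surreal.{u}) : Surreal.{u} →+ ℝ :=
  AddMonoidHom.mk' (normalCoeff e) (normalCoeff_add e)

theorem normalCoeff_zero (e : Surreal.{u}) : normalCoeff e 0 = 0 := map_zero (normalCoeffHom e)

theorem normalCoeff_sub (e x y : Surreal.{u}) :
    normalCoeff e (x - y) = normalCoeff e x - normalCoeff e y := map_sub (normalCoeffHom e) x y

theorem trunc_eq_zero {e x : Surreal.{u}} (h : ∀ d, e < d → Negligible x (omegaPow d)) :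
    trunc e x = 0 :=
  trunc_eq_of_simpleMod (simpleMod_zero _) fun d hd => by rw [zero_sub]; exact (h d hd).neg

theorem normalCoeff_eq_of_negligible_sub {e x : Surreal.{u}} {c : ℝ}
    (h : Negligible (x - ofReal c * omegaPow e) (omegaPow e)) : normalCoeff e x = c := by
  refine normalCoeff_eq ?_
  rw [trunc_eq_zero, sub_zero]
  · exact h
  · intro d hd
    rw [show x = (x - ofReal c * omegaPow e) + ofReal c * omegaPow e by ring]
    exact (h.trans (negligible_omegaPow hd)).add ((negligible_omegaPow hd).ofReal_mul c)

theorem normalCoeff_eq_zero_of_negligible {e x : Surreal.{u}} (h : Negligible x (omegaPow e)) :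
    normalCoeff e x = 0 :=
  normalCoeff_eq_of_negligible_sub (by rwa [ofReal_zero, zero_mul, sub_zero])

theorem normalCoeff_eq_zero_of_dominated {a e x : Surreal.{u}} (h : Dominated x (omegaPow a))
    (hae : a < e) : normalCoeff e x = 0 :=
  normalCoeff_eq_zero_of_negligible (h.trans_negligible (negligible_omegaPow hae))

theorem normalCoeff_eq_zero_of_trunc_eq {e x : Surreal.{u}} (h : trunc e x = x) :
    normalCoeff e x = 0 := by
  refine normalCoeff_eq ?_
  rw [h, ofReal_zero, sub_self, zero_mul, sub_zero]
  exact negligible_zero (omegaPow_ne_zero e)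

theorem trunc_trunc_of_le {d e x : Surreal.{u}} (h : d ≤ e) : trunc d (trunc e x) = trunc e x :=
  trunc_eq_of_simpleMod ((simpleMod_trunc e x).mono (Set.Ioi_subset_Ioi h)) (Near.refl _ _)

theorem normalCoeff_trunc_of_le {d e x : Surreal.{u}} (h : d ≤ e) :
    normalCoeff d (trunc e x) = 0 := normalCoeff_eq_zero_of_trunc_eq (trunc_trunc_of_le h)

/-- The exponents that occur in `x`. -/
def exponents (x : Surreal.{u}) : Set Surreal.{u} := {e | normalCoeff e x ≠ 0}

/-- Truncations get longer with each term.  This bounds the number of the terms and orders their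
exponents. -/
theorem length_trunc_lt {d e x : Surreal.{u}} (he : e ∈ exponents x) (h : d < e) :
    (trunc e x).length < (trunc d x).length := by
  rcases (isSimplest_trunc e x).2 (trunc d x)
    ((near_trunc d x).mono (Set.Ioi_subset_Ioi h.le)) with h1 | h1
  · refine absurd (normalCoeff_eq ?_) he
    have := (near_trunc d x).symm e h
    rwa [h1, ← sub_zero (x - trunc e x), ← zero_mul (omegaPow e), ← ofReal_zero] at this
  · exact h1.1

theorem length_trunc_le (e x : Surreal.{u}) : (trunc e x).length ≤ x.length := by
  rcases trunc_eq_or_simplerThan e x with h | h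
  exacts [(congrArg length h).le, h.1.le]

theorem small_exponents (x : Surreal.{u}) : Small.{u} (exponents x) := by
  refine small_of_injective (β := Set.Iic x.length)
    (f := fun e => ⟨(trunc e.1 x).length, length_trunc_le e.1 x⟩) fun d e h => ?_
  have h' : (trunc d.1 x).length = (trunc e.1 x).length := congrArg Subtype.val h
  rcases lt_trichotomy d.1 e.1 with h1 | h1 | h1
  · exact absurd h' (length_trunc_lt e.2 h1).ne'
  · exact Subtype.ext h1
  · exact absurd h' (length_trunc_lt d.2 h1).ne

theorem wellFoundedOn_exponents (x : Surreal.{u}) :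
    (exponents x).WellFoundedOn (fun a b => b < a) := by
  refine WellFounded.mono (InvImage.wf (fun e : exponents x => (trunc e.1 x).length)
    (wellFounded_lt (α := Ordinal.{u}))) ?_
  intro a b h
  exact length_trunc_lt a.2 h

/-- A surreal number is the simplest one modulo terms that are negligible relative to all its own
terms. -/
theorem simpleMod_exponents (x : Surreal.{u}) : SimpleMod (exponents x) x := by
  have hz := isSimplest_near_of_exists (ι := exponents x) (x := fun _ => x)
    (c := fun d => omegaPow d.1) ⟨x, fun d => Near.refl (exponents x) x d.1 d.2⟩
  set z := simplest fun z => ∀ d : exponents x, Negligible (z - x) (omegaPow d.1)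
  by_cases hzx : z = x
  · intro w hw
    rw [← hzx]; exact hz.2 w fun d => hw d.1 d.2
  exfalso
  -- Below all exponents of `x`, at the leading exponent `e` of `z - x`, both `z` and `trunc e x`
  -- are candidates for each other, so they agree.  But `trunc e x` is closer to `x` than `z`.
  obtain ⟨e, he, he'⟩ := exists_leading (sub_ne_zero.2 hzx)
  have hlt : ∀ d ∈ exponents x, e < d := fun d hd => by
    by_contra! h
    exact ((hz.1 ⟨d, hd⟩).trans_dominated (dominated_omegaPow h)).asymm he'
  have hc : normalCoeff e x = 0 := by
    by_contra h
    exact (hlt e h).false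
  have hT : Negligible (trunc e x - x) (omegaPow e) := by
    have := normalCoeff_spec e x
    rw [hc, ofReal_zero, zero_mul, sub_zero] at this
    rw [← neg_sub]; exact this.neg
  have h1 := hz.2 (trunc e x) fun d => hT.trans (negligible_omegaPow (hlt d.1 d.2))
  have h2 := (isSimplest_trunc e x).2 z fun d hd => he.trans_negligible (negligible_omegaPow hd)
  have h3 : z = trunc e x := by
    rcases h1 with h1 | h1
    · exact h1.symm
    rcases h2 with h2 | h2
    · exact h2
    · exact absurd h1 h2.asymm
  rw [h3] at he'
  exact hT.asymm he'

theorem eq_zero_of_normalCoeff_eq_zero {x : Surreal.{u}} (h : ∀ e, normalCoeff e x = 0) : x = 0 := by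
  rcases simpleMod_exponents x 0 (fun d hd => absurd (h d) hd) with h1 | h1
  · exact h1.symm
  · exact absurd h1 not_simplerThan_zero

theorem simpleMod_ofReal (c : ℝ) : SimpleMod {0} (ofReal.{u} c) := fun w hw => by
  refine isReal_iff.1 (isReal_ofReal c) w fun k => ?_
  have h := (hw 0 rfl).lt (r := 1 / 2 ^ k) (by positivity)
  rw [omegaPow_zero, _root_.abs_one, mul_one] at h
  have h2 : ofReal.{u} (1 / 2 ^ k) = oneHalf ^ k := by
    have h3 := two_pow_mul_oneHalf_pow.{u} k
    have h4 : (2 : Surreal.{u}) ^ k * ofReal (1 / 2 ^ k) = 1 := by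
      have : ((2 ^ k : ℕ) : Surreal.{u}) * ofReal (1 / 2 ^ k) = 1 := by
        rw [← ofReal_natCast, ← ofReal_mul, ← ofReal_one]
        congr 1; push_cast; field_simp
      simpa using this
    have h5 : (2 : Surreal.{u}) ^ k ≠ 0 := by positivity
    exact mul_left_cancel₀ h5 (h4.trans h3.symm)
  rwa [h2] at h

theorem simpleMod_omegaPow (a : Surreal.{u}) : SimpleMod {a} (omegaPow a) := fun w hw => by
  have hω := omegaPow_pos a
  have hw1 := (hw a rfl).lt (r := 1 / 2) (by norm_num)
  rw [abs_of_pos hω, _root_.abs_lt] at hw1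
  have e2 : ofReal.{u} (1 / 2) * omegaPow a + ofReal (1 / 2) * omegaPow a = omegaPow a := by
    rw [← add_mul, ← ofReal_add]; norm_num [ofReal_one]
  have h0 : 0 < ofReal.{u} (1 / 2) * omegaPow a := mul_pos (ofReal_pos.2 (by norm_num)) hω
  refine (omegaSpec_and_isRep a).2.2 w ?_
  rintro _ (rfl | ⟨r, hr, b, hb, rfl⟩)
  · exact ⟨fun _ => by linarith, fun h => absurd h hω.asymm⟩
  · rcases lt_or_gt_of_ne (SimplerThan.ne hb) with h | h
    · refine ⟨fun _ => ?_, fun h' => absurd h' (ofReal_mul_omegaPow_lt h r).asymm⟩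
      have h1 := ofReal_mul_omegaPow_lt h (2 * r)
      have h2 : ofReal (2 * r) * omegaPow b = ofReal r * omegaPow b + ofReal r * omegaPow b := by
        rw [two_mul, ofReal_add]; ring
      linarith
    · refine ⟨fun h' => absurd h' (omegaPow_lt_ofReal_mul h hr).asymm, fun _ => ?_⟩
      have h1 := omegaPow_lt_ofReal_mul h (half_pos hr)
      have h2 : ofReal r * omegaPow b =
          ofReal (r / 2) * omegaPow b + ofReal (r / 2) * omegaPow b := by
        rw [← add_mul, ← ofReal_add, add_halves]
      linarith

theorem normalCoeff_ofReal_mul_omegaPow_self (c : ℝ) (a : Surreal.{u}) :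
    normalCoeff a (ofReal c * omegaPow a) = c :=
  normalCoeff_eq_of_negligible_sub (by
    rw [sub_self]; exact negligible_zero (omegaPow_ne_zero a))

theorem normalCoeff_ofReal_mul_omegaPow_of_ne (c : ℝ) {a e : Surreal.{u}} (h : e ≠ a) :
    normalCoeff e (ofReal c * omegaPow a) = 0 := by
  rcases lt_or_gt_of_ne h with h | h
  · refine normalCoeff_eq_zero_of_trunc_eq (trunc_eq_of_simpleMod ?_ (Near.refl _ _))
    refine ((simpleMod_ofReal c).mul (simpleMod_omegaPow a)).mono ?_
    rintro _ ⟨_, rfl, _, rfl, rfl⟩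
    simpa using h
  · exact normalCoeff_eq_zero_of_negligible ((negligible_omegaPow h).ofReal_mul c)

/-! ### The embedding into the Hahn series -/

open OrderDual in
/-- The Hahn series with the same terms as `x`, with exponents in reversed order. -/
def toHahn (x : Surreal.{u}) : HahnSeries Surreal.{u}ᵒᵈ ℝ where
  coeff e := normalCoeff (ofDual e) x
  isPWO_support' := Set.IsWF.isPWO (wellFoundedOn_exponents x)

theorem coeff_toHahn (x : Surreal.{u}) (e : Surreal.{u}ᵒᵈ) :
    (toHahn x).coeff e = normalCoeff (OrderDual.ofDual e) x := rfl

theorem toHahn_add (x y : Surreal.{u}) : toHahn (x + y) = toHahn x + toHahn y := by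
  ext e; simp [coeff_toHahn, normalCoeff_add]

theorem toHahn_sub (x y : Surreal.{u}) : toHahn (x - y) = toHahn x - toHahn y := by
  ext e; simp [coeff_toHahn, normalCoeff_sub]

open OrderDual in
theorem toHahn_ofReal_mul_omegaPow (c : ℝ) (a : Surreal.{u}) :
    toHahn (ofReal c * omegaPow a) = HahnSeries.single (toDual a) c := by
  ext e
  obtain ⟨e, rfl⟩ := toDual.surjective e
  rw [coeff_toHahn, ofDual_toDual]
  by_cases h : e = a
  · rw [h, normalCoeff_ofReal_mul_omegaPow_self, HahnSeries.coeff_single_same]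
  · rw [HahnSeries.coeff_single_of_ne (fun h' => h (toDual.injective h')),
      normalCoeff_ofReal_mul_omegaPow_of_ne c h]

theorem toHahn_injective : Function.Injective toHahn.{u} := by
  intro x y h
  refine sub_eq_zero.1 (eq_zero_of_normalCoeff_eq_zero fun e => ?_)
  have := congrArg (fun s => HahnSeries.coeff s (OrderDual.toDual e)) h
  simp only [coeff_toHahn, OrderDual.ofDual_toDual] at this
  rw [normalCoeff_sub, this, sub_self]

open OrderDual in
/-- The coefficients of products are given by convolution at the sum of leading exponents, where
the convolution has a single nonzero term. -/
theorem normalCoeff_mul_leading {a b x y : Surreal.{u}} {p q : ℝ}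
    (hx : Negligible (x - ofReal p * omegaPow a) (omegaPow a))
    (hy : Negligible (y - ofReal q * omegaPow b) (omegaPow b)) :
    normalCoeff (a + b) (x * y) = (toHahn x * toHahn y).coeff (toDual (a + b)) := by
  have hdom : ∀ {a x : Surreal.{u}} {p : ℝ}, Negligible (x - ofReal p * omegaPow a) (omegaPow a) →
      Dominated x (omegaPow a) := fun {a x p} h => by
    have := h.dominated.add ((Dominated.refl (omegaPow a)).ofReal_mul p)
    simpa using this
  have h1 : normalCoeff (a + b) (x * y) = p * q := by
    refine normalCoeff_eq_of_negligible_sub ?_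
    rw [omegaPow_add, ofReal_mul, show x * y - ofReal p * ofReal q * (omegaPow a * omegaPow b) =
      (x - ofReal p * omegaPow a) * y +
        ofReal p * (omegaPow a * (y - ofReal q * omegaPow b)) by ring]
    exact (hx.mul_dominated (hdom hy) (omegaPow_ne_zero b)).add
      ((hy.mul_left (omegaPow_ne_zero a)).ofReal_mul p)
  rw [h1, HahnSeries.coeff_mul, Finset.sum_eq_single (toDual a, toDual b)]
  · rw [coeff_toHahn, coeff_toHahn, ofDual_toDual, ofDual_toDual,
      normalCoeff_eq_of_negligible_sub hx, normalCoeff_eq_of_negligible_sub hy]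
  · rintro ⟨i, j⟩ hij hne
    by_contra h
    have hi : ofDual i ≤ a := by
      by_contra! h'
      refine h ?_
      rw [coeff_toHahn, normalCoeff_eq_zero_of_dominated (hdom hx) h', zero_mul]
    have hj : ofDual j ≤ b := by
      by_contra! h'
      refine h ?_
      rw [coeff_toHahn (x := y), normalCoeff_eq_zero_of_dominated (hdom hy) h', mul_zero]
    rw [Finset.mem_antidiagonal] at hij
    have hsum : ofDual i + ofDual j = a + b := congrArg ofDual hij.2.2
    have hia : ofDual i = a := le_antisymm hi (by linarith)
    have hjb : ofDual j = b := le_antisymm hj (by linarith)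
    exact hne (Prod.ext (congrArg toDual hia) (congrArg toDual hjb))
  · intro h
    rw [Finset.mem_antidiagonal] at h
    simp only [HahnSeries.mem_support, not_and_or, not_not] at h
    rcases h with h | h | h
    · rw [h, zero_mul]
    · rw [h, mul_zero]
    · exact absurd rfl h

open OrderDual in
/-- The coefficients of a product.  If `a + b = e`, then `x` and `y` are replaced by `trunc a x`
and `trunc b y`, which are simpler, up to a product of numbers with known leading terms; this
applies unless `e` is below all sums of exponents, in which case both sides vanish. -/
theorem normalCoeff_mul (x y e : Surreal.{u}) :
    normalCoeff e (x * y) = (toHahn x * toHahn y).coeff (toDual e) := by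
  have ih1 : ∀ x', SimplerThan x' x → ∀ y',
      normalCoeff e (x' * y') = (toHahn x' * toHahn y').coeff (toDual e) :=
    fun x' _ y' => normalCoeff_mul x' y' e
  have ih2 : ∀ y', SimplerThan y' y →
      normalCoeff e (x * y') = (toHahn x * toHahn y').coeff (toDual e) :=
    fun y' _ => normalCoeff_mul x y' e
  by_cases hex : ∃ a, trunc a x ≠ x ∧ trunc (e - a) y ≠ y
  · obtain ⟨a, hax, hby⟩ := hex
    have hx' := (trunc_eq_or_simplerThan a x).resolve_left hax
    have hy' := (trunc_eq_or_simplerThan (e - a) y).resolve_left hby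
    have h1 := ih1 _ hx' y
    have h2 := ih2 _ hy'
    have h3 := ih1 _ hx' (trunc (e - a) y)
    have h4 := normalCoeff_mul_leading (normalCoeff_spec a x) (normalCoeff_spec (e - a) y)
    rw [add_sub_cancel] at h4
    have e1 : x * y = trunc a x * y + x * trunc (e - a) y - trunc a x * trunc (e - a) y +
        (x - trunc a x) * (y - trunc (e - a) y) := by ring
    have e2 : toHahn x * toHahn y = toHahn (trunc a x) * toHahn y +
        toHahn x * toHahn (trunc (e - a) y) - toHahn (trunc a x) * toHahn (trunc (e - a) y) +
        toHahn (x - trunc a x) * toHahn (y - trunc (e - a) y) := by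
      rw [toHahn_sub, toHahn_sub]; ring
    rw [e1, e2, normalCoeff_add, normalCoeff_sub, normalCoeff_add, HahnSeries.coeff_add,
      HahnSeries.coeff_sub, HahnSeries.coeff_add, h1, h2, h3, h4]
  · push Not at hex
    have hlt : ∀ a ∈ exponents x, ∀ b ∈ exponents y, e < a + b := by
      intro a ha b hb
      have h1 := hex a fun h => ha (normalCoeff_eq_zero_of_trunc_eq h)
      by_contra! h2
      have h3 : b ≤ e - a := by linarith
      refine hb ?_
      rw [← h1]
      exact normalCoeff_trunc_of_le h3
    have h1 : SimpleMod (Set.Ioi e) (x * y) := by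
      refine ((simpleMod_exponents x).mul (simpleMod_exponents y)).mono ?_
      rintro _ ⟨a, ha, b, hb, rfl⟩
      exact hlt a ha b hb
    rw [normalCoeff_eq_zero_of_trunc_eq (trunc_eq_of_simpleMod h1 (Near.refl _ _)),
      HahnSeries.coeff_mul, Finset.sum_eq_zero]
    rintro ⟨i, j⟩ hij
    rw [Finset.mem_antidiagonal] at hij
    have hsum : ofDual i + ofDual j = e := congrArg ofDual hij.2.2
    exact absurd hsum (hlt _ hij.1 _ hij.2.1).ne'
termination_by (x.length, y.length)
decreasing_by
  · rename_i h; exact Prod.Lex.left _ _ h.1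
  · rename_i h; exact Prod.Lex.right _ h.1

/-- The normal form of surreal numbers as an embedding into the ring of Hahn series. -/
def hahnHom : Surreal.{u} →+* HahnSeries Surreal.{u}ᵒᵈ ℝ where
  toFun := toHahn
  map_one' := by
    have := toHahn_ofReal_mul_omegaPow.{u} 1 0
    rw [ofReal_one, omegaPow_zero, one_mul] at this
    exact this
  map_mul' x y := by
    ext e
    exact normalCoeff_mul x y (OrderDual.ofDual e)
  map_zero' := by
    ext e; exact normalCoeff_zero _
  map_add' := toHahn_add

theorem coeff_hahnHom (x : Surreal.{u}) (e : Surreal.{u}ᵒᵈ) :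
    (hahnHom x).coeff e = normalCoeff (OrderDual.ofDual e) x := rfl

theorem hahnHom_injective : Function.Injective hahnHom.{u} := toHahn_injective

/-! ### Normal forms -/

/-- `z` has the terms `r α ω ^ (y α)` for `α < β`, and no others. -/
def HasTerms (y : Ordinal.{u} → Surreal.{u}) (r : Ordinal.{u} → ℝ) (β : Ordinal.{u})
    (z : Surreal.{u}) : Prop :=
  (∀ α < β, normalCoeff (y α) z = r α) ∧ ∀ d, (∀ α < β, y α ≠ d) → normalCoeff d z = 0

theorem normalSum_eq (y : Ordinal.{u} → Surreal.{u}) (r : Ordinal.{u} → ℝ) (β : Ordinal.{u}) :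
    normalSum y r β = simplest fun z => ∀ α : Set.Iio β,
      Negligible (z - (normalSum y r α.1 + ofReal (r α.1) * omegaPow (y α.1)))
        (omegaPow (y α.1)) := by
  rw [normalSum]

/-- A normal sum has the terms that it is built from.  Above some exponent of the sum, the
coefficients are inherited from the partial sums; below all of them there are no terms, by
simplicity. -/
theorem normalSum_spec (y : Ordinal.{u} → Surreal.{u}) (r : Ordinal.{u} → ℝ) (β : Ordinal.{u})
    (hy : StrictAntiOn y (Set.Iio β)) :
    HasTerms y r β (normalSum y r β) ∧ ∀ α < β,
      Negligible (normalSum y r β - (normalSum y r α + ofReal (r α) * omegaPow (y α)))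
        (omegaPow (y α)) := by
  induction β using WellFoundedLT.induction with
  | ind β ih =>
    have ih' : ∀ α < β, HasTerms y r α (normalSum y r α) ∧ ∀ γ < α,
        Negligible (normalSum y r α - (normalSum y r γ + ofReal (r γ) * omegaPow (y γ)))
          (omegaPow (y γ)) := fun α hα =>
      ih α hα (hy.mono (Set.Iio_subset_Iio hα.le))
    set t : Ordinal.{u} → Surreal.{u} := fun α =>
      normalSum y r α + ofReal (r α) * omegaPow (y α) with ht
    have hlt : ∀ α < β, ∀ γ < α, Negligible (t α - t γ) (omegaPow (y γ)) := by
      intro α hα γ hγ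
      have h1 := (ih' α hα).2 γ hγ
      have h2 := (negligible_omegaPow (hy (hγ.trans hα) hα hγ)).ofReal_mul (r α)
      rw [ht, show ∀ a b c : Surreal.{u}, a + b - c = a - c + b by intros; ring]
      exact h1.add h2
    have hex : ∃ z, ∀ α : Set.Iio β, Negligible (z - t α.1) (omegaPow (y α.1)) := by
      obtain ⟨z, hz1, hz2⟩ := exists_between
        (Set.range fun p : {ε : ℝ // 0 < ε} × Set.Iio β =>
          t p.2.1 - ofReal p.1.1 * omegaPow (y p.2.1))
        (Set.range fun p : {ε : ℝ // 0 < ε} × Set.Iio β =>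
          t p.2.1 + ofReal p.1.1 * omegaPow (y p.2.1)) (by
        rintro _ ⟨⟨⟨ε, hε⟩, ⟨α, hα⟩⟩, rfl⟩ _ ⟨⟨⟨δ, hδ⟩, ⟨γ, hγ⟩⟩, rfl⟩
        dsimp only
        have p1 := mul_pos (ofReal_pos.{u}.2 hε) (omegaPow_pos (y α))
        have p2 := mul_pos (ofReal_pos.{u}.2 hδ) (omegaPow_pos (y γ))
        rcases lt_trichotomy α γ with h | rfl | h
        · have h1 := (hlt γ hγ α h).lt hε
          rw [abs_of_pos (omegaPow_pos (y α)), _root_.abs_lt] at h1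
          linarith
        · linarith
        · have h1 := (hlt α hα γ h).lt hδ
          rw [abs_of_pos (omegaPow_pos (y γ)), _root_.abs_lt] at h1
          linarith)
      refine ⟨z, fun α => negligible_iff.2 fun ε hε => ?_⟩
      have h1 := hz1 _ ⟨(⟨ε, hε⟩, α), rfl⟩
      have h2 := hz2 _ ⟨(⟨ε, hε⟩, α), rfl⟩
      dsimp only at h1 h2
      rw [abs_of_pos (omegaPow_pos (y α.1)), _root_.abs_lt]
      constructor <;> linarith
    have hS := isSimplest_near_of_exists hex
    rw [← normalSum_eq] at hS
    set S := normalSum y r β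
    have hmem : ∀ α < β, Negligible (S - t α) (omegaPow (y α)) := fun α hα => hS.1 ⟨α, hα⟩
    refine ⟨⟨fun α hα => ?_, fun d hd => ?_⟩, hmem⟩
    · have h1 := normalCoeff_eq_zero_of_negligible (hmem α hα)
      have h2 := (ih' α hα).1.2 (y α) fun γ hγ => (hy (hγ.trans hα) hα hγ).ne'
      rw [normalCoeff_sub, ht, normalCoeff_add, h2, normalCoeff_ofReal_mul_omegaPow_self] at h1
      linarith
    · by_cases h : ∃ α < β, y α < d
      · obtain ⟨α, hα, hαd⟩ := h
        have h1 := normalCoeff_eq_zero_of_negligible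
          ((hmem α hα).trans (negligible_omegaPow hαd))
        have h2 := (ih' α hα).1.2 d fun γ hγ => hd γ (hγ.trans hα)
        rw [normalCoeff_sub, ht, normalCoeff_add, h2,
          normalCoeff_ofReal_mul_omegaPow_of_ne _ (hd α hα).symm] at h1
        linarith
      · push Not at h
        have h1 : SimpleMod (y '' Set.Iio β) S := fun w hw => hS.2 w fun α => by
          have h2 := (hw (y α.1) ⟨α.1, α.2, rfl⟩).add (hmem α.1 α.2)
          rwa [sub_add_sub_cancel] at h2
        refine normalCoeff_eq_zero_of_trunc_eq (trunc_eq_of_simpleMod (h1.mono ?_) (Near.refl _ _))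
        rintro _ ⟨α, hα, rfl⟩
        exact lt_of_le_of_ne (h α hα) (hd α hα).symm

/-- A small class of exponents that is well-ordered downwards is enumerated by an ordinal. -/
theorem exists_enumeration (E : Set Surreal.{u}) [Small.{u} E]
    (hE : E.WellFoundedOn fun a b => b < a) :
    ∃ (β : Ordinal.{u}) (y : Ordinal.{u} → Surreal.{u}), StrictAntiOn y (Set.Iio β) ∧
      y '' Set.Iio β = E := by
  let s : Shrink.{u} E → Shrink.{u} E → Prop := fun a b =>
    ((equivShrink E).symm b).1 < ((equivShrink E).symm a).1
  have hwf : WellFounded s := InvImage.wf (equivShrink E).symm hE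
  have : IsWellOrder (Shrink.{u} E) s :=
    { trichotomous := fun a b h h' => by
        have h1 : ((equivShrink E).symm a).1 = ((equivShrink E).symm b).1 :=
          le_antisymm (not_lt.1 h) (not_lt.1 h')
        exact (equivShrink E).symm.injective (Subtype.ext h1)
      wf := hwf }
  classical
  let y : Ordinal.{u} → Surreal.{u} := fun α =>
    if h : α < Ordinal.type s then ((equivShrink E).symm (Ordinal.enum s ⟨α, h⟩)).1 else 0
  refine ⟨Ordinal.type s, y, fun α hα γ hγ hlt => ?_, ?_⟩
  · have h1 : s (Ordinal.enum s ⟨α, hα⟩) (Ordinal.enum s ⟨γ, hγ⟩) :=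
      (Ordinal.enum s).map_rel_iff.2 hlt
    simp only [y, dif_pos (show α < Ordinal.type s from hα),
      dif_pos (show γ < Ordinal.type s from hγ)]
    exact h1
  · ext e
    constructor
    · rintro ⟨α, hα, rfl⟩
      simp only [y, dif_pos (show α < Ordinal.type s from hα)]
      exact Subtype.property _
    · intro he
      obtain ⟨⟨α, hα⟩, h⟩ := (Ordinal.enum s).surjective (equivShrink E ⟨e, he⟩)
      refine ⟨α, hα, ?_⟩
      simp only [y, dif_pos (show α < Ordinal.type s from hα)]
      rw [h, Equiv.symm_apply_apply]

theorem normalCoeff_ext {x z : Surreal.{u}} (h : ∀ e, normalCoeff e x = normalCoeff e z) : x = z :=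
  toHahn_injective (by ext e; exact h _)

theorem HasTerms.unique {y : Ordinal.{u} → Surreal.{u}} {r : Ordinal.{u} → ℝ} {β : Ordinal.{u}}
    {x z : Surreal.{u}} (hx : HasTerms y r β x) (hz : HasTerms y r β z) : x = z := by
  refine normalCoeff_ext fun d => ?_
  by_cases h : ∃ α < β, y α = d
  · obtain ⟨α, hα, rfl⟩ := h
    rw [hx.1 α hα, hz.1 α hα]
  · push Not at h
    rw [hx.2 d h, hz.2 d h]

theorem exists_isNormalForm (x : Surreal.{u}) : ∃ (β : Ordinal.{u}) (y : Ordinal.{u} → Surreal.{u})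
    (r : Ordinal.{u} → ℝ), IsNormalForm x β y r ∧ y '' Set.Iio β = exponents x := by
  have := small_exponents x
  obtain ⟨β, y, hy, hE⟩ := exists_enumeration (exponents x) (wellFoundedOn_exponents x)
  have hmem : ∀ α < β, y α ∈ exponents x := fun α hα => hE ▸ ⟨α, hα, rfl⟩
  refine ⟨β, y, fun α => normalCoeff (y α) x, ⟨hy, hmem, ?_⟩, hE⟩
  refine (normalSum_spec y _ β hy).1.unique ⟨fun α _ => rfl, fun d hd => ?_⟩
  by_contra h
  obtain ⟨α, hα, rfl⟩ : d ∈ y '' Set.Iio β := hE ▸ h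
  exact hd α hα rfl

theorem coeff_eq_normalCoeff (e x : Surreal.{u}) : coeff e x = normalCoeff e x := by
  have key : ∀ (c : ℝ), (∃ β y r, IsNormalForm x β y r ∧ ∃ α < β, y α = e ∧ r α = c) →
      c = normalCoeff e x := by
    rintro c ⟨β, y, r, ⟨hy, -, rfl⟩, α, hα, rfl, rfl⟩
    exact ((normalSum_spec y r β hy).1.1 α hα).symm
  rw [coeff]
  split_ifs with h
  · exact key _ h.choose_spec
  · by_contra hne
    obtain ⟨β, y, r, hnf, hE⟩ := exists_isNormalForm x
    have he : e ∈ y '' Set.Iio β := hE ▸ Ne.symm hne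
    obtain ⟨α, hα, rfl⟩ := he
    exact h ⟨r α, β, y, r, hnf, α, hα, rfl, rfl⟩

instance small_support_hahnHom (x : Surreal.{u}) : Small.{u} (hahnHom x).support :=
  small_exponents x

/-- Every Hahn series with a small support is the normal form of a surreal number. -/
theorem exists_hahnHom_eq (H : HahnSeries Surreal.{u}ᵒᵈ ℝ) [hs : Small.{u} H.support] :
    ∃ x, hahnHom x = H := by
  have : Small.{u} ({e | H.coeff (OrderDual.toDual e) ≠ 0} : Set Surreal.{u}) := hs
  have hwf : ({e | H.coeff (OrderDual.toDual e) ≠ 0} : Set Surreal.{u}).WellFoundedOn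
      fun a b => b < a := H.isWF_support
  obtain ⟨β, y, hy, hE⟩ := exists_enumeration _ hwf
  have h := (normalSum_spec y (fun α => H.coeff (OrderDual.toDual (y α))) β hy).1
  refine ⟨normalSum y (fun α => H.coeff (OrderDual.toDual (y α))) β, ?_⟩
  ext d
  obtain ⟨d, rfl⟩ := OrderDual.toDual.surjective d
  rw [coeff_hahnHom, OrderDual.ofDual_toDual]
  by_cases hd : ∃ α < β, y α = d
  · obtain ⟨α, hα, rfl⟩ := hd
    exact h.1 α hα
  · push Not at hd
    rw [h.2 d hd]
    by_contra hne
    obtain ⟨α, hα, rfl⟩ : d ∈ y '' Set.Iio β := hE ▸ Ne.symm hne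
    exact hd α hα rfl

/-! ### Inverses -/

theorem zero_lt_orderTop_hahnHom {x : Surreal.{u}} (h : Negligible x 1) :
    0 < (hahnHom x).orderTop := by
  cases hx : (hahnHom x).orderTop with
  | top => exact WithTop.coe_lt_top 0
  | coe g =>
    have h1 := HahnSeries.coeff_orderTop_ne hx
    refine WithTop.coe_lt_coe.2 (not_le.1 fun hg => h1 ?_)
    have hg' : 0 ≤ OrderDual.ofDual g := hg
    rw [coeff_hahnHom]
    refine normalCoeff_eq_zero_of_negligible (h.trans_dominated ?_)
    rw [← omegaPow_zero]
    exact dominated_omegaPow hg'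

theorem small_support_hsum {ι : Type} [Countable ι]
    (S : HahnSeries.SummableFamily Surreal.{u}ᵒᵈ ℝ ι) (hS : ∀ i, ∃ x, hahnHom x = S i) :
    Small.{u} S.hsum.support := by
  have : ∀ i, Small.{u} (S i).support := fun i => by
    obtain ⟨x, hx⟩ := hS i
    rw [← hx]; infer_instance
  exact small_subset HahnSeries.SummableFamily.support_hsum_subset

/-- Geometric series in infinitesimal numbers. -/
theorem exists_one_sub_mul_eq_one {x : Surreal.{u}} (h : Negligible x 1) :
    ∃ z, (1 - x) * z = 1 := by
  have hpos := zero_lt_orderTop_hahnHom h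
  have hs := small_support_hsum (HahnSeries.SummableFamily.powers (hahnHom x)) fun n =>
    ⟨x ^ n, by rw [HahnSeries.SummableFamily.powers_of_orderTop_pos hpos, map_pow]⟩
  obtain ⟨z, hz⟩ := exists_hahnHom_eq (HahnSeries.SummableFamily.powers (hahnHom x)).hsum
  refine ⟨z, hahnHom_injective ?_⟩
  rw [map_mul, map_sub, map_one, hz]
  exact HahnSeries.SummableFamily.one_sub_self_mul_hsum_powers hpos

/-- Every nonzero number is of the form `c ω ^ e (1 - y)` with `y` infinitesimal. -/
theorem exists_mul_eq_one {x : Surreal.{u}} (hx : x ≠ 0) : ∃ z, x * z = 1 := by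
  obtain ⟨e, h1, h2⟩ := exists_leading hx
  obtain ⟨c, hc⟩ := exists_coefficient h1
  have hc0 : c ≠ 0 := by
    rintro rfl
    rw [ofReal_zero, zero_mul, sub_zero] at hc
    exact hc.asymm h2
  have hc1 : ofReal.{u} c⁻¹ * ofReal c = 1 := by
    rw [← ofReal_mul, inv_mul_cancel₀ hc0, ofReal_one]
  have h3 := (hc.mul_left (omegaPow_ne_zero (-e))).ofReal_mul c⁻¹
  rw [omegaPow_neg_mul] at h3
  obtain ⟨z, hz⟩ := exists_one_sub_mul_eq_one h3.neg
  refine ⟨ofReal c⁻¹ * omegaPow (-e) * z, ?_⟩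
  rw [← hz]
  linear_combination z * (ofReal c⁻¹ * ofReal c * omegaPow_neg_mul e + hc1)

open Classical in
theorem inv_eq (x : Surreal.{u}) : x⁻¹ = if h : ∃ z, x * z = 1 then h.choose else 0 := rfl

instance instField : Field Surreal.{u} where
  __ := instCommRing
  __ := instNontrivial
  inv x := x⁻¹
  div x y := x / y
  div_eq_mul_inv _ _ := rfl
  zpow k x := x ^ k
  zpow_zero' _ := rfl
  zpow_succ' _ _ := rfl
  zpow_neg' _ _ := rfl
  mul_inv_cancel x hx := by
    have h := exists_mul_eq_one hx
    rw [inv_eq, dif_pos h]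
    exact h.choose_spec
  inv_zero := by
    rw [inv_eq, dif_neg]
    rintro ⟨z, hz⟩
    rw [zero_mul] at hz
    exact zero_ne_one hz
  nnqsmul := _
  qsmul := _

/-! ### Conway sums -/

/-- The series `∑ k, a k` is summable as a family of Hahn series, with sum `s`. -/
def HahnSum {ι : Type} (a : ι → Surreal.{u}) (s : Surreal.{u}) : Prop :=
  ∃ S : HahnSeries.SummableFamily Surreal.{u}ᵒᵈ ℝ ι, (∀ k, S k = hahnHom (a k)) ∧
    S.hsum = hahnHom s

theorem HahnSum.hasConwaySum {ι : Type} {a : ι → Surreal.{u}} {s : Surreal.{u}}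
    (h : HahnSum a s) : HasConwaySum a s := by
  classical
  obtain ⟨S, hS, hs⟩ := h
  intro e
  refine ⟨(S.finite_co_support (OrderDual.toDual e)).toFinset, fun l hl hF => ?_⟩
  rw [coeff_eq_normalCoeff, coeff_eq_normalCoeff]
  have h1 : normalCoeff e s = S.hsum.coeff (OrderDual.toDual e) := by rw [hs]; rfl
  have h2 : normalCoeff e (l.map a).sum = (l.map fun k => normalCoeff e (a k)).sum := by
    have := map_list_sum (normalCoeffHom e) (l.map a)
    rw [List.map_map] at this
    exact this
  rw [h1, h2, HahnSeries.SummableFamily.coeff_hsum_eq_sum_of_subset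
    (t := l.toFinset) (fun k hk => List.mem_toFinset.2 (hF k
      ((Set.Finite.mem_toFinset _).2 (by simpa using hk)))),
    List.sum_toFinset _ hl]
  refine congrArg List.sum (List.map_congr_left fun k _ => ?_)
  rw [hS]; rfl

theorem HasConwaySum.unique {ι : Type} {a : ι → Surreal.{u}} {s t : Surreal.{u}}
    (hs : HasConwaySum a s) (ht : HasConwaySum a t) : s = t := by
  classical
  refine normalCoeff_ext fun e => ?_
  obtain ⟨F, hF⟩ := hs e
  obtain ⟨G, hG⟩ := ht e
  rw [← coeff_eq_normalCoeff, ← coeff_eq_normalCoeff,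
    ← hF (F ∪ G).toList (Finset.nodup_toList _) (fun k hk => by simp [hk]),
    ← hG (F ∪ G).toList (Finset.nodup_toList _) (fun k hk => by simp [hk])]

theorem HahnSum.congr {ι : Type} {a b : ι → Surreal.{u}} {s : Surreal.{u}} (h : HahnSum a s)
    (hab : ∀ k, a k = b k) : HahnSum b s := by
  rwa [← funext hab]

theorem HahnSum.add {ι : Type} {a b : ι → Surreal.{u}} {s t : Surreal.{u}} (h : HahnSum a s)
    (h' : HahnSum b t) : HahnSum (fun k => a k + b k) (s + t) := by
  obtain ⟨S, hS, hs⟩ := h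
  obtain ⟨T, hT, ht⟩ := h'
  exact ⟨S + T, fun k => by rw [HahnSeries.SummableFamily.add_apply, hS, hT, map_add],
    by rw [HahnSeries.SummableFamily.hsum_add, hs, ht, map_add]⟩

theorem HahnSum.sub {ι : Type} {a b : ι → Surreal.{u}} {s t : Surreal.{u}} (h : HahnSum a s)
    (h' : HahnSum b t) : HahnSum (fun k => a k - b k) (s - t) := by
  obtain ⟨S, hS, hs⟩ := h
  obtain ⟨T, hT, ht⟩ := h'
  exact ⟨S - T, fun k => by rw [HahnSeries.SummableFamily.sub_apply, hS, hT, map_sub],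
    by rw [HahnSeries.SummableFamily.hsum_sub, hs, ht, map_sub]⟩

theorem HahnSum.mul_left {ι : Type} {a : ι → Surreal.{u}} {s : Surreal.{u}} (h : HahnSum a s)
    (b : Surreal.{u}) : HahnSum (fun k => b * a k) (b * s) := by
  obtain ⟨S, hS, hs⟩ := h
  refine ⟨hahnHom b • S, fun k => ?_, by rw [HahnSeries.SummableFamily.hsum_smul, hs, map_mul]⟩
  rw [HahnSeries.SummableFamily.smul_apply, HahnSeries.of_symm_smul_of_eq_mul, hS, map_mul]

theorem hahnSum_zero {ι : Type} : HahnSum (fun _ : ι => (0 : Surreal.{u})) 0 :=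
  ⟨0, fun _ => by simp, by simp⟩

theorem HahnSum.sum {ι κ : Type} {a : κ → ι → Surreal.{u}} {s : κ → Surreal.{u}} (t : Finset κ)
    (h : ∀ i ∈ t, HahnSum (a i) (s i)) : HahnSum (fun k => ∑ i ∈ t, a i k) (∑ i ∈ t, s i) := by
  classical
  induction t using Finset.induction_on with
  | empty => simpa using hahnSum_zero
  | insert i t hi ih =>
    rw [Finset.sum_insert hi]
    refine ((h i (Finset.mem_insert_self i t)).add
      (ih fun j hj => h j (Finset.mem_insert_of_mem hj))).congr fun k => ?_
    rw [Finset.sum_insert hi]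

theorem HahnSum.embDomain {ι κ : Type} {a : ι → Surreal.{u}} {b : κ → Surreal.{u}}
    {s : Surreal.{u}} (h : HahnSum a s) (φ : ι ↪ κ) (hb : ∀ i, b (φ i) = a i)
    (hb' : ∀ k, k ∉ Set.range φ → b k = 0) : HahnSum b s := by
  obtain ⟨S, hS, hs⟩ := h
  refine ⟨S.embDomain φ, fun k => ?_, by rw [HahnSeries.SummableFamily.hsum_embDomain, hs]⟩
  by_cases hk : k ∈ Set.range φ
  · obtain ⟨i, rfl⟩ := hk
    rw [HahnSeries.SummableFamily.embDomain_image, hS, hb]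
  · rw [HahnSeries.SummableFamily.embDomain_of_notMem_range _ _ hk, hb' k hk, map_zero]

theorem HahnSum.comp_injective {ι κ : Type} {b : κ → Surreal.{u}} {s : Surreal.{u}}
    (h : HahnSum b s) {φ : ι → κ} (hφ : Function.Injective φ)
    (hb : ∀ k, k ∉ Set.range φ → b k = 0) : HahnSum (fun i => b (φ i)) s := by
  obtain ⟨S, hS, hs⟩ := h
  refine ⟨⟨fun i => S (φ i), S.isPWO_iUnion_support.mono (Set.iUnion_subset fun i =>
    Set.subset_iUnion (fun k => (S k).support) (φ i)), fun g =>
      (S.finite_co_support g).preimage hφ.injOn⟩, fun i => hS (φ i), ?_⟩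
  rw [← hs]
  ext g
  rw [HahnSeries.SummableFamily.coeff_hsum, HahnSeries.SummableFamily.coeff_hsum]
  change ∑ᶠ i, (S (φ i)).coeff g = _
  rw [← finsum_mem_range (f := fun k => (S k).coeff g) hφ]
  refine finsum_congr fun k => ?_
  by_cases hk : k ∈ Set.range φ
  · simp [hk]
  · simp [hk, hS, hb k hk]

theorem dominated_of_normalCoeff_eq_zero {e x : Surreal.{u}}
    (h : ∀ d, e < d → normalCoeff d x = 0) : Dominated x (omegaPow e) := by
  rcases eq_or_ne x 0 with rfl | hx
  · exact (negligible_zero (omegaPow_ne_zero e)).dominated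
  obtain ⟨a, ha, ha'⟩ := exists_leading hx
  obtain ⟨c, hc⟩ := exists_coefficient ha
  have hae : a ≤ e := by
    by_contra! h'
    have h1 := h a h'
    rw [normalCoeff_eq_of_negligible_sub hc] at h1
    rw [h1, ofReal_zero, zero_mul, sub_zero] at hc
    exact hc.asymm ha'
  refine dominated_of_forall_negligible fun d hd => ?_
  exact ha.trans_negligible (negligible_omegaPow (hae.trans_lt hd))

theorem Dominated.trans {a b c : Surreal.{u}} (h : Dominated a b) (h' : Dominated b c) :
    Dominated a c := by
  obtain ⟨r, hr0, hr⟩ := h.exists_pos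
  obtain ⟨s, hs⟩ := h'
  refine ⟨r * s, hr.trans ?_⟩
  rw [Surreal.ofReal_mul, mul_assoc]
  exact mul_le_mul_of_nonneg_left hs (ofReal_pos.2 hr0).le

theorem eq_zero_of_dominated_zero {a : Surreal.{u}} (h : Dominated a 0) : a = 0 := by
  obtain ⟨r, hr⟩ := h
  rw [_root_.abs_zero, mul_zero] at hr
  exact abs_eq_zero.1 (le_antisymm hr (_root_.abs_nonneg a))

/-- A sum of terms that are at most of the order of magnitude of `b` has the same property.  The
real factors that occur in the bounds of the terms need not be bounded. -/
theorem HahnSum.dominated {ι : Type} {a : ι → Surreal.{u}} {s b : Surreal.{u}} (h : HahnSum a s)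
    (hb : ∀ k, Dominated (a k) b) : Dominated s b := by
  obtain ⟨S, hS, hs⟩ := h
  have key : ∀ d, (∀ k, normalCoeff d (a k) = 0) → normalCoeff d s = 0 := by
    intro d hd
    have h1 : S.hsum.coeff (OrderDual.toDual d) = normalCoeff d s := by rw [hs]; rfl
    rw [← h1, HahnSeries.SummableFamily.coeff_hsum]
    refine finsum_eq_zero_of_forall_eq_zero fun k => ?_
    rw [hS]; exact hd k
  rcases eq_or_ne b 0 with rfl | hb0
  · have : s = 0 := eq_zero_of_normalCoeff_eq_zero fun d => key d fun k => by
      rw [eq_zero_of_dominated_zero (hb k), normalCoeff_zero]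
    rw [this]; exact Dominated.refl 0
  obtain ⟨e, he, he'⟩ := exists_leading hb0
  refine (dominated_of_normalCoeff_eq_zero fun d hd => key d fun k => ?_).trans he'
  exact normalCoeff_eq_zero_of_dominated ((hb k).trans he) hd

/-! ### Power series in infinitesimal numbers -/

theorem infinitesimal_iff {x : Surreal.{u}} : Infinitesimal x ↔ Negligible x 1 := by
  unfold Infinitesimal Negligible
  rw [show Surreal.abs (1 : Surreal.{u}) = 1 from (abs_eq 1).trans _root_.abs_one]

theorem hahnHom_ofReal_mul (c : ℝ) (x : Surreal.{u}) :
    hahnHom (ofReal c * x) = c • hahnHom x := by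
  have h := toHahn_ofReal_mul_omegaPow.{u} c 0
  rw [omegaPow_zero, mul_one] at h
  have h' : hahnHom (ofReal.{u} c) = HahnSeries.single 0 c := h
  rw [map_mul, h', HahnSeries.single_zero_mul_eq_smul]

/-- The monomials in infinitesimal numbers form a summable family. -/
theorem exists_summableFamily_monomials (m : ℕ) (v : Fin m → Surreal.{u})
    (hv : ∀ i, Negligible (v i) 1) :
    ∃ S : HahnSeries.SummableFamily Surreal.{u}ᵒᵈ ℝ (Fin m → ℕ),
      ∀ j, S j = hahnHom (∏ i, v i ^ j i) := by
  induction m with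
  | zero =>
    refine ⟨HahnSeries.SummableFamily.const (Fin 0 → ℕ) 1, fun j => ?_⟩
    simp [HahnSeries.SummableFamily.const]
  | succ m ih =>
    obtain ⟨S, hS⟩ := ih (fun i => v i.succ) fun i => hv i.succ
    refine ⟨HahnSeries.SummableFamily.Equiv (Fin.consEquiv fun _ => ℕ)
      ((HahnSeries.SummableFamily.powers (hahnHom (v 0))).mul S), fun j => ?_⟩
    change (HahnSeries.SummableFamily.powers (hahnHom (v 0))) (j 0) *
      S (fun i => j i.succ) = _
    rw [HahnSeries.SummableFamily.powers_of_orderTop_pos (zero_lt_orderTop_hahnHom (hv 0)), hS,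
      ← map_pow, ← map_mul, Fin.prod_univ_succ]

/-- The term with exponents `j` of the power series with coefficients `p` at `v`. -/
def powerTerm {m : ℕ} (p : (Fin m → ℕ) → ℝ) (v : Fin m → Surreal.{u}) (j : Fin m → ℕ) :
    Surreal.{u} := ofReal (p j) * ∏ i, v i ^ j i

theorem exists_hahnSum_powerTerm {m : ℕ} (p : (Fin m → ℕ) → ℝ) {v : Fin m → Surreal.{u}}
    (hv : ∀ i, Negligible (v i) 1) : ∃ s, HahnSum (powerTerm p v) s := by
  obtain ⟨S, hS⟩ := exists_summableFamily_monomials m v hv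
  have hS' : ∀ j, (HahnSeries.SummableFamily.smulFamily p S) j = hahnHom (powerTerm p v j) := by
    intro j
    change p j • S j = _
    rw [hS, powerTerm, hahnHom_ofReal_mul]
  have := small_support_hsum (HahnSeries.SummableFamily.smulFamily p S) fun j => ⟨_, (hS' j).symm⟩
  obtain ⟨s, hs⟩ := exists_hahnHom_eq (HahnSeries.SummableFamily.smulFamily p S).hsum
  exact ⟨s, _, hS', hs.symm⟩

/-- The `i`-th partial derivative of `powerTerm p v j` as a function of `v`. -/
def powerTermDeriv {m : ℕ} (p : (Fin m → ℕ) → ℝ) (v : Fin m → Surreal.{u}) (i : Fin m)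
    (j : Fin m → ℕ) : Surreal.{u} :=
  ofReal (p j) * (j i * v i ^ (j i - 1) * ∏ l ∈ Finset.univ.erase i, v l ^ j l)

/-- Up to a shift of the exponents, the termwise derivative is a power series again. -/
theorem exists_hahnSum_powerTermDeriv {m : ℕ} (p : (Fin m → ℕ) → ℝ) {v : Fin m → Surreal.{u}}
    (hv : ∀ i, Negligible (v i) 1) (i : Fin m) : ∃ s, HahnSum (powerTermDeriv p v i) s := by
  let φ : (Fin m → ℕ) ↪ (Fin m → ℕ) := ⟨fun j => j + Pi.single i 1, add_left_injective _⟩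
  obtain ⟨s, hs⟩ := exists_hahnSum_powerTerm (fun j => p (φ j) * (j i + 1 : ℕ)) hv
  refine ⟨s, hs.embDomain φ (fun j => ?_) fun j hj => ?_⟩
  · have h1 : φ j i = j i + 1 := by simp [φ]
    have h2 : ∀ l ∈ Finset.univ.erase i, v l ^ φ j l = v l ^ j l := fun l hl => by
      have : l ≠ i := Finset.ne_of_mem_erase hl
      simp [φ, this]
    rw [powerTermDeriv, powerTerm, Finset.prod_congr rfl h2, h1, Nat.add_sub_cancel,
      ← Finset.mul_prod_erase _ _ (Finset.mem_univ i), ofReal_mul, ofReal_natCast]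
    ring
  · have h1 : j i = 0 := by
      by_contra h
      refine hj ⟨j - Pi.single i 1, ?_⟩
      ext l
      by_cases hl : l = i
      · subst hl
        simp only [φ, Function.Embedding.coeFn_mk, Pi.add_apply, Pi.sub_apply, Pi.single_eq_same]
        omega
      · simp [φ, hl]
    rw [powerTermDeriv, h1]
    simp

/-- The finite number `A` is the sum of `a` and an increment `d` of first order in `H`, up to a
remainder of second order in `H`. -/
structure Approx (H A a d : Surreal.{u}) : Prop where
  bound : Dominated A 1
  bound' : Dominated a 1
  increment : Dominated d H
  remainder : Dominated (A - a - d) (H * H)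

theorem Approx.mul {H A a d B b e : Surreal.{u}} (hH : Dominated H 1) (h : Approx H A a d)
    (h' : Approx H B b e) : Approx H (A * B) (a * b) (d * b + a * e) where
  bound := by simpa using h.bound.mul h'.bound
  bound' := by simpa using h.bound'.mul h'.bound'
  increment := by
    have h1 := h.increment.mul h'.bound'
    have h2 := h.bound'.mul h'.increment
    rw [mul_one] at h1
    rw [one_mul] at h2
    exact h1.add h2
  remainder := by
    have e1 : A * B - a * b - (d * b + a * e) =
        (A - a - d) * B + a * (B - b - e) + (d * e + d * (B - b - e)) := by ring
    have h1 := h.remainder.mul h'.bound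
    have h2 := h.bound'.mul h'.remainder
    have h3 := h.increment.mul h'.increment
    have h4 := (h.increment.trans hH).mul h'.remainder
    rw [mul_one] at h1
    rw [one_mul] at h2 h4
    rw [e1]
    exact (h1.add h2).add (h3.add h4)

theorem Approx.one (H : Surreal.{u}) : Approx H 1 1 0 where
  bound := Dominated.refl 1
  bound' := Dominated.refl 1
  increment := ⟨0, by simp [ofReal_zero]⟩
  remainder := ⟨0, by simp [ofReal_zero]⟩

theorem Approx.pow {H A a d : Surreal.{u}} (hH : Dominated H 1) (h : Approx H A a d) (n : ℕ) :
    Approx H (A ^ n) (a ^ n) (n * a ^ (n - 1) * d) := by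
  induction n with
  | zero => simpa using Approx.one H
  | succ n ih =>
    have := ih.mul hH h
    rw [pow_succ, pow_succ]
    convert this using 1
    rcases n with _ | n
    · simp
    · simp only [Nat.add_sub_cancel]
      push_cast
      ring

theorem Approx.prod {κ : Type} [DecidableEq κ] {H : Surreal.{u}} {A a d : κ → Surreal.{u}}
    (hH : Dominated H 1) (t : Finset κ) (h : ∀ i ∈ t, Approx H (A i) (a i) (d i)) :
    Approx H (∏ i ∈ t, A i) (∏ i ∈ t, a i) (∑ i ∈ t, d i * ∏ l ∈ t.erase i, a l) := by
  induction t using Finset.induction_on with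
  | empty => simpa using Approx.one H
  | insert x t hx ih =>
    have h1 := (h x (Finset.mem_insert_self x t)).mul hH
      (ih fun i hi => h i (Finset.mem_insert_of_mem hi))
    rw [Finset.prod_insert hx, Finset.prod_insert hx]
    convert h1 using 1
    rw [Finset.sum_insert hx, Finset.erase_insert hx, Finset.mul_sum]
    congr 1
    refine Finset.sum_congr rfl fun i hi => ?_
    have hxi : x ≠ i := fun h => hx (h ▸ hi)
    rw [Finset.erase_insert_of_ne hxi, Finset.prod_insert (fun h => hx (Finset.mem_of_mem_erase h))]
    ring

/-- First order Taylor expansion of a power series in infinitesimal numbers.  It holds termwise, and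
bounds on the order of magnitude are inherited by sums. -/
theorem dominated_powerSeries_sub {m : ℕ} {p : (Fin m → ℕ) → ℝ} {v w : Fin m → Surreal.{u}}
    (hv : ∀ i, Negligible (v i) 1) (hw : ∀ i, Negligible (w i) 1) {H : Surreal.{u}}
    (hH : Dominated H 1) (hvw : ∀ i, Dominated (w i - v i) H) {s t : Surreal.{u}}
    {D : Fin m → Surreal.{u}} (hs : HahnSum (powerTerm p v) s) (ht : HahnSum (powerTerm p w) t)
    (hD : ∀ i, HahnSum (powerTermDeriv p v i) (D i)) :
    Dominated (t - s - ∑ i, (w i - v i) * D i) (H * H) := by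
  refine ((ht.sub hs).sub (HahnSum.sum Finset.univ fun i _ =>
    (hD i).mul_left (w i - v i))).dominated fun j => ?_
  have h1 : ∀ i ∈ Finset.univ, Approx H (w i ^ j i) (v i ^ j i)
      (j i * v i ^ (j i - 1) * (w i - v i)) := fun i _ => by
    refine Approx.pow hH ⟨(hw i).dominated, (hv i).dominated, hvw i, ?_⟩ (j i)
    exact ⟨0, by simp [ofReal_zero]⟩
  have h2 := (Approx.prod hH Finset.univ h1).remainder.ofReal_mul (p j)
  convert h2 using 1
  simp only [powerTerm, powerTermDeriv, mul_sub, Finset.mul_sum]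
  congr 1
  refine Finset.sum_congr rfl fun i _ => ?_
  ring

open Filter Topology

/-! ### Differentiation -/

instance : TopologicalSpace Surreal.{u} := Preorder.topology _

instance : OrderTopology Surreal.{u} := ⟨rfl⟩

theorem hasDerivative_iff {f : Surreal.{u} → Surreal.{u}} {d a : Surreal.{u}} :
    HasDerivative f d a ↔ Tendsto (fun x => (f x - f a) / (x - a)) (𝓝[≠] a) (𝓝 d) := by
  have hb := (nhdsWithin_hasBasis (nhds_basis_abs_sub_lt a) {a}ᶜ)
  rw [hb.tendsto_iff (nhds_basis_abs_sub_lt d)]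
  refine forall₂_congr fun ε _ => exists_congr fun δ => and_congr Iff.rfl ?_
  refine forall_congr' fun x => ?_
  rw [abs_eq, abs_eq]
  exact ⟨fun h hx => h hx.2 hx.1, fun h hx hx' => h ⟨hx', hx⟩⟩

theorem HasDerivative.tendsto {f : Surreal.{u} → Surreal.{u}} {d a : Surreal.{u}}
    (h : HasDerivative f d a) : Tendsto f (𝓝[≠] a) (𝓝 (f a)) := by
  have h1 : Tendsto (fun x : Surreal.{u} => x - a) (𝓝[≠] a) (𝓝 (a - a)) :=
    ((continuous_id.sub continuous_const).tendsto a).mono_left nhdsWithin_le_nhds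
  have h2 := ((hasDerivative_iff.1 h).mul h1).add_const (f a)
  rw [sub_self, mul_zero, zero_add] at h2
  refine h2.congr' ?_
  filter_upwards [self_mem_nhdsWithin] with x hx
  have : x - a ≠ 0 := sub_ne_zero.2 hx
  field_simp
  ring

theorem HasDerivative.congr {f g : Surreal.{u} → Surreal.{u}} {d a : Surreal.{u}}
    (h : HasDerivative f d a) (hfg : ∀ᶠ x in 𝓝 a, g x = f x) : HasDerivative g d a := by
  rw [hasDerivative_iff] at h ⊢
  refine h.congr' ?_
  filter_upwards [hfg.filter_mono nhdsWithin_le_nhds] with x hx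
  rw [hx, hfg.self_of_nhds]

theorem hasDerivative_const (c a : Surreal.{u}) : HasDerivative (fun _ => c) 0 a := by
  rw [hasDerivative_iff]
  simp

theorem HasDerivative.mul {f g : Surreal.{u} → Surreal.{u}} {d e a : Surreal.{u}}
    (h : HasDerivative f d a) (h' : HasDerivative g e a) :
    HasDerivative (fun x => f x * g x) (d * g a + f a * e) a := by
  have h1 := ((hasDerivative_iff.1 h).mul h'.tendsto).add
    ((hasDerivative_iff.1 h').const_mul (f a))
  rw [hasDerivative_iff]
  refine h1.congr fun x => ?_
  ring

theorem HasDerivative.inv {f : Surreal.{u} → Surreal.{u}} {d a : Surreal.{u}}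
    (h : HasDerivative f d a) (ha : f a ≠ 0) :
    HasDerivative (fun x => (f x)⁻¹) (-d * (f a)⁻¹ * (f a)⁻¹) a := by
  have h1 := ((hasDerivative_iff.1 h).neg.mul_const (f a)⁻¹).mul (h.tendsto.inv₀ ha)
  rw [hasDerivative_iff]
  refine h1.congr' ?_
  filter_upwards [h.tendsto.eventually_ne ha] with x hx
  field_simp
  ring

theorem HasDerivative.pow {f : Surreal.{u} → Surreal.{u}} {d a : Surreal.{u}}
    (h : HasDerivative f d a) (n : ℕ) :
    HasDerivative (fun x => f x ^ n) (n * f a ^ (n - 1) * d) a := by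
  induction n with
  | zero => simpa using hasDerivative_const 1 a
  | succ n ih =>
    have h1 := ih.mul h
    simp only [← pow_succ] at h1
    convert h1 using 1
    rcases n with _ | n
    · simp
    · simp only [Nat.add_sub_cancel]
      push_cast
      ring

theorem HasDerivative.zpow {f : Surreal.{u} → Surreal.{u}} {d a : Surreal.{u}}
    (h : HasDerivative f d a) {n : ℤ} (hn : n ≠ 0 → f a ≠ 0) :
    HasDerivative (fun x => f x ^ n) (n * f a ^ (n - 1) * d) a := by
  rcases eq_or_ne n 0 with rfl | h0
  · simpa using hasDerivative_const 1 a
  have ha := hn h0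
  obtain ⟨k, rfl | rfl⟩ := n.eq_nat_or_neg
  · have h1 := h.pow k
    have hk : 1 ≤ k := by omega
    simpa only [zpow_natCast, Int.cast_natCast, ← Nat.cast_pred hk, ← Nat.cast_one (R := ℤ),
      ← Nat.cast_sub hk] using h1
  · have h1 := (h.pow k).inv (pow_ne_zero k ha)
    have hk : 1 ≤ k := by omega
    obtain ⟨l, rfl⟩ := Nat.exists_eq_add_of_le' hk
    simp only [zpow_neg, zpow_natCast]
    convert h1 using 1
    rw [show (-((l + 1 : ℕ) : ℤ) - 1) = -((l + 2 : ℕ) : ℤ) by push_cast; ring, zpow_neg,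
      zpow_natCast]
    simp only [Nat.add_sub_cancel]
    push_cast
    field_simp
    ring

theorem HasDerivative.prod {κ : Type} [DecidableEq κ] {f : κ → Surreal.{u} → Surreal.{u}}
    {d : κ → Surreal.{u}} {a : Surreal.{u}} (t : Finset κ)
    (h : ∀ i ∈ t, HasDerivative (f i) (d i) a) :
    HasDerivative (fun x => ∏ i ∈ t, f i x) (∑ i ∈ t, d i * ∏ l ∈ t.erase i, f l a) a := by
  induction t using Finset.induction_on with
  | empty => simpa using hasDerivative_const 1 a
  | insert x t hx ih =>
    have h1 := (h x (Finset.mem_insert_self x t)).mul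
      (ih fun i hi => h i (Finset.mem_insert_of_mem hi))
    simp only [Finset.prod_insert hx]
    convert h1 using 1
    rw [Finset.sum_insert hx, Finset.erase_insert hx, Finset.mul_sum]
    congr 1
    refine Finset.sum_congr rfl fun i hi => ?_
    have hxi : x ≠ i := fun h => hx (h ▸ hi)
    rw [Finset.erase_insert_of_ne hxi, Finset.prod_insert (fun h => hx (Finset.mem_of_mem_erase h))]
    ring

/-- A real multiple of `b` is bounded by the fixed multiple `ω b`, whichever the real factor is. -/
theorem Dominated.abs_le {a b : Surreal.{u}} (h : Dominated a b) : |a| ≤ omegaPow 1 * |b| := by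
  obtain ⟨r, hr⟩ := h
  refine hr.trans (mul_le_mul_of_nonneg_right ?_ (_root_.abs_nonneg b))
  have h := negligible_omegaPow (zero_lt_one' Surreal.{u})
  rw [omegaPow_zero] at h
  simpa using (h.ofReal_mul_lt (omegaPow_pos 1) r).le

/-- The chain rule for power series in infinitesimal functions.  With a common bound `M` for the
difference quotients of the functions, the increment `H` in the Taylor expansion is
`M * (x - a)`. -/
theorem HasDerivative.powerSeries {m : ℕ} {p : (Fin m → ℕ) → ℝ}
    {f : Fin m → Surreal.{u} → Surreal.{u}} {d D : Fin m → Surreal.{u}} {a : Surreal.{u}}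
    {P : Surreal.{u} → Surreal.{u}} (hinf : ∀ᶠ x in 𝓝 a, ∀ i, Negligible (f i x) 1)
    (hf : ∀ i, HasDerivative (f i) (d i) a)
    (hP : ∀ᶠ x in 𝓝 a, HahnSum (powerTerm p fun i => f i x) (P x))
    (hD : ∀ i, HahnSum (powerTermDeriv p (fun i => f i a) i) (D i)) :
    HasDerivative P (∑ i, d i * D i) a := by
  obtain ⟨M, hM0, hM⟩ : ∃ M : Surreal.{u}, 0 < M ∧ ∀ i, |d i| < M := by
    have h0 : ∀ i ∈ Finset.univ, 0 ≤ |d i| := fun i _ => _root_.abs_nonneg (d i)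
    refine ⟨∑ i, |d i| + 1, add_pos_of_nonneg_of_pos (Finset.sum_nonneg h0) one_pos, fun i => ?_⟩
    exact (Finset.single_le_sum h0 (Finset.mem_univ i)).trans_lt (lt_add_one _)
  have hslope := fun i => hasDerivative_iff.1 (hf i)
  have hbound : ∀ᶠ x in 𝓝[≠] a, ∀ i, |(f i x - f i a) / (x - a)| < M :=
    eventually_all.2 fun i => (hslope i).abs.eventually_lt_const (hM i)
  have hsub : Tendsto (fun x : Surreal.{u} => |x - a|) (𝓝[≠] a) (𝓝 0) := by
    have : Tendsto (fun x : Surreal.{u} => |x - a|) (𝓝 a) (𝓝 |a - a|) :=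
      ((continuous_id.sub continuous_const).tendsto a).abs
    rw [sub_self, _root_.abs_zero] at this
    exact this.mono_left nhdsWithin_le_nhds
  have hsmall : ∀ᶠ x in 𝓝[≠] a, |x - a| < M⁻¹ := hsub.eventually_lt_const (inv_pos.2 hM0)
  set K : Surreal.{u} := omegaPow 1 * (M * M)
  have hrem : ∀ᶠ x in 𝓝[≠] a,
      |(P x - P a) / (x - a) - ∑ i, (f i x - f i a) / (x - a) * D i| ≤ K * |x - a| := by
    filter_upwards [hbound, hsmall, hinf.filter_mono nhdsWithin_le_nhds,
      hP.filter_mono nhdsWithin_le_nhds, self_mem_nhdsWithin] with x h1 h2 h3 h4 hx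
    have hx0 : x - a ≠ 0 := sub_ne_zero.2 hx
    have hxp : 0 < |x - a| := abs_pos.2 hx0
    have hH : Dominated (M * (x - a)) 1 := by
      refine ⟨1, ?_⟩
      rw [ofReal_one, one_mul, _root_.abs_one, abs_mul, abs_of_pos hM0]
      have := mul_le_mul_of_nonneg_left h2.le hM0.le
      rwa [mul_inv_cancel₀ hM0.ne'] at this
    have hvw : ∀ i, Dominated (f i x - f i a) (M * (x - a)) := fun i => by
      refine ⟨1, ?_⟩
      have := h1 i
      rw [abs_div, div_lt_iff₀ hxp] at this
      rw [ofReal_one, one_mul, abs_mul, abs_of_pos hM0]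
      exact this.le
    have h5 := (dominated_powerSeries_sub hinf.self_of_nhds h3 hH hvw hP.self_of_nhds h4 hD).abs_le
    rw [abs_mul, abs_mul, abs_of_pos hM0] at h5
    have e1 : (P x - P a) / (x - a) - ∑ i, (f i x - f i a) / (x - a) * D i =
        (P x - P a - ∑ i, (f i x - f i a) * D i) / (x - a) := by
      rw [sub_div _ (∑ i, _), Finset.sum_div]
      congr 1
      exact Finset.sum_congr rfl fun i _ => by ring
    rw [e1, abs_div, div_le_iff₀ hxp]
    refine h5.trans_eq ?_
    ring
  have hzero : Tendsto (fun x => (P x - P a) / (x - a) - ∑ i, (f i x - f i a) / (x - a) * D i)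
      (𝓝[≠] a) (𝓝 0) := by
    have h1 := hsub.const_mul K
    have h2 := h1.neg
    rw [mul_zero] at h1 h2
    rw [neg_zero] at h2
    refine tendsto_of_tendsto_of_tendsto_of_le_of_le' h2 h1 ?_ ?_
    · exact hrem.mono fun x hx => (abs_le.1 hx).1
    · exact hrem.mono fun x hx => (abs_le.1 hx).2
  have hsum : Tendsto (fun x => ∑ i, (f i x - f i a) / (x - a) * D i) (𝓝[≠] a)
      (𝓝 (∑ i, d i * D i)) := tendsto_finsetSum _ fun i _ => (hslope i).mul_const (D i)
  rw [hasDerivative_iff]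
  simpa using hzero.add hsum

/-! ### Series of monomials with integer exponents -/

theorem monomial_eq_prod {m : ℕ} (h : Fin m → Surreal.{u}) (k : Fin m → ℤ) :
    monomial h k = ∏ i, h i ^ k i := List.prod_ofFn

theorem monomial_update {m : ℕ} (h : Fin m → Surreal.{u}) (k : Fin m → ℤ) (i : Fin m) (a : ℤ) :
    monomial h (Function.update k i a) = h i ^ a * ∏ l ∈ Finset.univ.erase i, h l ^ k l := by
  rw [monomial_eq_prod, ← Finset.mul_prod_erase _ _ (Finset.mem_univ i), Function.update_self]
  congr 1
  refine Finset.prod_congr rfl fun l hl => ?_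
  rw [Function.update_of_ne (Finset.ne_of_mem_erase hl)]

theorem monomialDeriv_eq_sum {m : ℕ} (h h' : Fin m → Surreal.{u}) (k : Fin m → ℤ) :
    monomialDeriv h h' k =
      ∑ i, k i * h' i * (h i ^ (k i - 1) * ∏ l ∈ Finset.univ.erase i, h l ^ k l) := by
  rw [monomialDeriv, List.sum_ofFn]
  refine Finset.sum_congr rfl fun i _ => ?_
  rw [monomial_update, ofReal_intCast]

theorem monomialLogDeriv_eq {m : ℕ} {h h' : Fin m → Surreal.{u}} (hh : ∀ i, h i = 0 → h' i = 0)
    (k : Fin m → ℤ) : monomialLogDeriv h h' k = monomialDeriv h h' k := by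
  rw [monomialLogDeriv, monomialDeriv_eq_sum, List.sum_ofFn, Finset.sum_mul, monomial_eq_prod]
  refine Finset.sum_congr rfl fun i _ => ?_
  rw [ofReal_intCast, ← Finset.mul_prod_erase _ _ (Finset.mem_univ i)]
  rcases eq_or_ne (h i) 0 with h0 | h0
  · rw [hh i h0, zero_div, mul_zero, zero_mul, zero_mul]
  · rw [zpow_sub_one₀ h0]
    field_simp

theorem zpow_add_natCast {u : Surreal.{u}} {N : ℤ} (h : N ≠ 0 → u ≠ 0) (j : ℕ) :
    u ^ (N + j) = u ^ N * u ^ j := by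
  rcases eq_or_ne N 0 with rfl | hN
  · simp
  · rw [zpow_add₀ (h hN), zpow_natCast]

/-- The product rule for the derivative of `u ^ N * u ^ j`. -/
theorem zpow_deriv_add_natCast {u : Surreal.{u}} {N : ℤ} (h : N ≠ 0 → u ≠ 0) (j : ℕ) :
    ((N + j : ℤ) : Surreal.{u}) * u ^ (N + j - 1) =
      N * u ^ (N - 1) * u ^ j + u ^ N * (j * u ^ (j - 1)) := by
  rcases eq_or_ne N 0 with rfl | hN
  · rcases j with _ | j
    · simp
    · simp only [zero_add, Nat.add_sub_cancel, Nat.cast_add, Nat.cast_one, add_sub_cancel_right,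
        zpow_natCast]
      push_cast
      simp
  · have h0 := h hN
    rw [zpow_sub_one₀ h0, zpow_sub_one₀ h0, zpow_add₀ h0, zpow_natCast]
    rcases j with _ | j
    · simp
    · simp only [Nat.add_sub_cancel]
      push_cast
      field_simp
      ring

/-- If the coefficients `c` vanish outside of the cone of the exponents above `N`, then a series
over the exponents with coefficients `c` can be summed over this cone. -/
theorem HahnSum.of_shift {m : ℕ} {n : ℤ} {c : {k : Fin m → ℤ // ∀ i, n ≤ k i} → ℝ}
    {N : Fin m → ℤ} (hN : ∀ k i, c k ≠ 0 → N i ≤ k.1 i) {B : (Fin m → ℤ) → Surreal.{u}}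
    {s : Surreal.{u}} (h : HahnSum (fun j : Fin m → ℕ =>
      ofReal (Function.extend Subtype.val c 0 fun i => N i + j i) * B fun i => N i + j i) s) :
    HahnSum (fun k => ofReal (c k) * B k.1) s := by
  let φ : (Fin m → ℕ) ↪ (Fin m → ℤ) := ⟨fun j i => N i + j i, fun j j' hj => by
    ext i
    have := congrFun hj i
    simp only at this
    omega⟩
  have h1 : HahnSum (fun k => ofReal (Function.extend Subtype.val c 0 k) * B k) s := by
    refine h.embDomain φ (fun j => rfl) fun k hk => ?_
    by_cases hn : ∀ i, n ≤ k i
    · have h2 := Subtype.val_injective.extend_apply c 0 ⟨k, hn⟩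
      rw [h2]
      by_cases hc : c ⟨k, hn⟩ = 0
      · rw [hc, ofReal_zero, zero_mul]
      · refine absurd ⟨fun i => (k i - N i).toNat, funext fun i => ?_⟩ hk
        have := hN ⟨k, hn⟩ i hc
        change N i + ((k i - N i).toNat : ℤ) = k i
        change N i ≤ k i at this
        omega
    · rw [Function.extend_apply' _ _ _ (by rintro ⟨a, rfl⟩; exact hn a.2), Pi.zero_apply,
        ofReal_zero, zero_mul]
  refine (h1.comp_injective Subtype.val_injective fun k hk => ?_).congr fun k => ?_
  · rw [Function.extend_apply' _ _ _ (by simpa using hk), Pi.zero_apply, ofReal_zero, zero_mul]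
  · rw [Subtype.val_injective.extend_apply]

theorem monomial_shift {m : ℕ} {v : Fin m → Surreal.{u}} {N : Fin m → ℤ}
    (hN : ∀ i, N i ≠ 0 → v i ≠ 0) (p : (Fin m → ℕ) → ℝ) (j : Fin m → ℕ) :
    ofReal (p j) * monomial v (fun i => N i + j i) = (∏ i, v i ^ N i) * powerTerm p v j := by
  rw [monomial_eq_prod, powerTerm, mul_left_comm, ← Finset.prod_mul_distrib]
  simp only [zpow_add_natCast (hN _)]

/-- The product rule for the monomial with exponents `N + j` as the product of the monomials with
exponents `N` and `j`. -/
theorem monomialDeriv_shift {m : ℕ} {v v' : Fin m → Surreal.{u}} {N : Fin m → ℤ}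
    (hN : ∀ i, N i ≠ 0 → v i ≠ 0) (p : (Fin m → ℕ) → ℝ) (j : Fin m → ℕ) :
    ofReal (p j) * monomialDeriv v v' (fun i => N i + j i) =
      (∑ i, N i * v i ^ (N i - 1) * v' i * ∏ l ∈ Finset.univ.erase i, v l ^ N l) *
          powerTerm p v j +
        (∏ i, v i ^ N i) * ∑ i, v' i * powerTermDeriv p v i j := by
  rw [monomialDeriv_eq_sum, Finset.mul_sum, Finset.mul_sum, Finset.sum_mul,
    ← Finset.sum_add_distrib]
  refine Finset.sum_congr rfl fun i _ => ?_
  have h1 : ∏ l ∈ Finset.univ.erase i, v l ^ (N l + j l : ℤ) =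
      (∏ l ∈ Finset.univ.erase i, v l ^ N l) * ∏ l ∈ Finset.univ.erase i, v l ^ j l := by
    rw [← Finset.prod_mul_distrib]
    exact Finset.prod_congr rfl fun l _ => zpow_add_natCast (hN l) _
  rw [h1, powerTerm, powerTermDeriv, ← Finset.mul_prod_erase _ _ (Finset.mem_univ i),
    ← Finset.mul_prod_erase _ (fun i => v i ^ N i) (Finset.mem_univ i)]
  generalize ∏ l ∈ Finset.univ.erase i, v l ^ N l = A
  generalize ∏ l ∈ Finset.univ.erase i, v l ^ j l = B
  calc _ = ofReal (p j) * v' i * A * B *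
        (((N i + j i : ℤ) : Surreal.{u}) * v i ^ (N i + j i - 1)) := by ring
    _ = _ := by
      rw [zpow_deriv_add_natCast (hN i)]
      ring

theorem PosInfinite.eventually {a : Surreal.{u}} (ha : a.PosInfinite) :
    ∀ᶠ x in 𝓝 a, x.PosInfinite := by
  filter_upwards [Ioi_mem_nhds (sub_one_lt a)] with x hx n
  have := ha (n + 1)
  rw [succ_nsmul] at this
  exact (lt_sub_iff_add_lt.2 this).trans hx

end

end Surreal

theorem mainTheorem11 (m : ℕ) (n : ℤ)
    (f f' : Fin m → Surreal.{u} → Surreal.{u})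
    (c : {k : Fin m → ℤ // ∀ i, n ≤ k i} → ℝ)
    (hinf : ∀ i x, x.PosInfinite → (f i x).Infinitesimal)
    (hf : ∀ i x, x.PosInfinite → Surreal.HasDerivative (f i) (f' i x) x)
    (hf' : ∀ i x, x.PosInfinite → ∃ d, Surreal.HasDerivative (f' i) d x)
    (hne : ∀ k i, c k ≠ 0 → k.1 i < 0 → ∀ x, x.PosInfinite → f i x ≠ 0) :
    (∀ x : Surreal.{u}, x.PosInfinite → ∃! s, Surreal.HasConwaySum
      (fun k => Surreal.ofReal (c k) * Surreal.monomial (fun i => f i x) k.1) s) ∧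
    ∀ g : Surreal.{u} → Surreal.{u},
      (∀ x : Surreal.{u}, x.PosInfinite → Surreal.HasConwaySum
        (fun k => Surreal.ofReal (c k) * Surreal.monomial (fun i => f i x) k.1) (g x)) →
      ∀ x : Surreal.{u}, x.PosInfinite → ∃ d, Surreal.HasDerivative g d x ∧
        Surreal.HasConwaySum (fun k => Surreal.ofReal (c k) *
          Surreal.monomialDeriv (fun i => f i x) (fun i => f' i x) k.1) d ∧
        ((∀ i, f i x = 0 → f' i x = 0) →
          Surreal.HasConwaySum (fun k => Surreal.ofReal (c k) *
            Surreal.monomialLogDeriv (fun i => f i x) (fun i => f' i x) k.1) d) := by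
  classical
  -- The exponents of `f i` that occur are bounded below by `n`, and by `0` unless `f i` is
  -- invertible.
  obtain ⟨N, hN, hN0⟩ : ∃ N : Fin m → ℤ, (∀ k i, c k ≠ 0 → N i ≤ k.1 i) ∧
      ∀ i, N i ≠ 0 → ∀ x : Surreal.{u}, x.PosInfinite → f i x ≠ 0 := by
    refine ⟨fun i => if ∃ k, c k ≠ 0 ∧ k.1 i < 0 then n else 0, fun k i hc => ?_, fun i hi => ?_⟩
    · dsimp only
      split_ifs with h
      · exact k.2 i
      · exact not_lt.1 fun h' => h ⟨k, hc, h'⟩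
    · dsimp only at hi
      split_ifs at hi with h
      · obtain ⟨k, hc, hk⟩ := h
        exact hne k i hc hk
      · exact absurd rfl hi
  have hneg : ∀ x : Surreal.{u}, x.PosInfinite → ∀ i, Surreal.Negligible (f i x) 1 :=
    fun x hx i => Surreal.infinitesimal_iff.1 (hinf i x hx)
  -- The coefficients after the shift of the exponents by `N`.
  let p : (Fin m → ℕ) → ℝ := fun j => Function.extend Subtype.val c 0 fun i => N i + j i
  choose! P hP using fun (x : Surreal.{u}) (hx : x.PosInfinite) =>
    Surreal.exists_hahnSum_powerTerm p (hneg x hx)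
  have hsum : ∀ x : Surreal.{u}, x.PosInfinite → Surreal.HasConwaySum
      (fun k => Surreal.ofReal (c k) * Surreal.monomial (fun i => f i x) k.1)
      ((∏ i, f i x ^ N i) * P x) := fun x hx =>
    (Surreal.HahnSum.of_shift hN (((hP x hx).mul_left _).congr fun j =>
      (Surreal.monomial_shift (fun i hi => hN0 i hi x hx) p j).symm)).hasConwaySum
  refine ⟨fun x hx => ⟨_, hsum x hx, fun s hs => hs.unique (hsum x hx)⟩, fun g hg x hx => ?_⟩
  choose D hD using Surreal.exists_hahnSum_powerTermDeriv p (hneg x hx)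
  have hseries : Surreal.HasConwaySum (fun k => Surreal.ofReal (c k) *
      Surreal.monomialDeriv (fun i => f i x) (fun i => f' i x) k.1) _ :=
    (Surreal.HahnSum.of_shift hN ((((hP x hx).mul_left _).add
      ((Surreal.HahnSum.sum Finset.univ fun i _ => (hD i).mul_left (f' i x)).mul_left _)).congr
        fun j => (Surreal.monomialDeriv_shift (fun i hi => hN0 i hi x hx) p j).symm)).hasConwaySum
  refine ⟨_, ?_, hseries, fun h0 => ?_⟩
  · have h1 := Surreal.HasDerivative.prod (a := x) Finset.univ
      fun i _ => (hf i x hx).zpow fun hi => hN0 i hi x hx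
    have h2 := Surreal.HasDerivative.powerSeries (hx.eventually.mono hneg) (fun i => hf i x hx)
      (hx.eventually.mono hP) hD
    exact (h1.mul h2).congr (hx.eventually.mono fun y hy => (hg y hy).unique (hsum y hy))
  · simpa only [Surreal.monomialLogDeriv_eq h0] using hseries
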